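/- **Setting.** There are $2N$ parties: main parties $A_1,\dots,A_N$ and auxiliary parties $B_1,\dots,B_N$. A *quantum realisation* of correlations $P(\mathbf a,\mathbf b|\mathbf x,\mathbf y)$ consists of Hilbert spaces of arbitrary dimension for the $2N$ parties, a joint pure state $|\Psi\rangle$ (with no assumed product structure), and projective local measurements that yield $P$. A *local map* of $A_j$ is a quantum channel on the system of $A_j$ alone, given by an isometry into $\mathbb C^{d_j}\otimes\mathbb C^2\otimes\mathcal K_j$ (system register, flag qubit, discarded junk). $|\cdot^*\rangle$ is complex conjugation in the computational basis. A pure state is *genuinely multipartite entangled* (GME) if it is not a product across any bipartition of its parties; every pure state is a tensor product of GME states of subsets of the parties. Let $|\psi_N\rangle\in\bigotimes_{j=1}^N\mathbb C^{d_j}$ be any unit vector. We say that local maps *extract $|\psi_N\rangle$ up to heralded conjugations* from $|\Psi\rangle$ if there are local isometries of the $N$ main parties such that, for every GME tensor factor $|\chi\rangle$ of $|\psi_N\rangle$, held by a set $S$ of parties (so $\chi=\psi_N$ if $\psi_N$ is GME), they map $|\Psi\rangle$ to $$\sqrt\alpha\,|\chi\rangle|0\cdots0\rangle|\zeta_0\rangle+\sqrt{1-\alpha}\,|\chi^*\rangle|1\cdots1\rangle|\zeta_1\rangle$$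 for some $\alpha\in[0,1]$ and some unit vectors $\zeta_0,\zeta_1$ of the remaining registers; the flags are those of the parties in $S$. **Theorem.** 1. (Arbitrary local dimensions.) For every pure state $|\psi_N\rangle$: (a) There are quantum correlations $P$ of $2N$ parties with finitely many inputs and outputs, produced in the network in which the main parties share some pure state and each $A_j$ shares a maximally entangled state with $B_j$, such that for every quantum realisation of $P$ there are local maps of the $N$ main parties that extract exactly the pure state $\sqrt\alpha|\psi_N\rangle|0\rangle^{\otimes N}+\sqrt{1-\alpha}|\psi_N^*\rangle|1\rangle^{\otimes N}$ for some $\alpha\in[0,1]$. (b) There are such correlations $P$ produced in the network in which the main parties share $|\psi_N\rangle$ itself and $A_j,B_j$ share a maximally entangled state of dimension $2^{\lceil\log_2 d_j\rceil}$, such that from every quantum realisation of $P$ local maps extract $|\psi_N\rangle$ up to heralded conjugations. 2. (Qubits, explicit correlations.) Let all $d_j=2$. Let each $A_j$ have inputs $x\in\{0,\dots,5\}$ with outputs $a\in\{0,1\}$ and an input $\diamond$ with outputs $a\in\{0,1\}^2$, and let each $B_j$ have inputs $y\in\{0,1,2\}$ with outputs $b\in\{0,1\}$; let $M_{a|\diamond}$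 and $N_{b|y}$ be the projectors for $\diamond$ and $y$, and $A^{(j)}_x$, $B^{(j)}_y$ the $\pm1$-valued observables. Consider the conditions $$\mathsf{CHSH}_j(0,1;0,1)+\mathsf{CHSH}_j(2,3;0,2)+\mathsf{CHSH}_j(4,5;1,2)=6\sqrt2\quad\text{for all }j,$$ where $\mathsf{CHSH}_j(x_1,x_2;y_1,y_2)=\langle A^{(j)}_{x_1}B^{(j)}_{y_1}\rangle+\langle A^{(j)}_{x_1}B^{(j)}_{y_2}\rangle+\langle A^{(j)}_{x_2}B^{(j)}_{y_1}\rangle-\langle A^{(j)}_{x_2}B^{(j)}_{y_2}\rangle$, and, for all $a_j\in\{0,1\}^2$, $y_j\in\{0,1,2\}$, $b_j\in\{0,1\}$, $$\langle\Psi|\bigotimes_j M^{(j)}_{a_j|\diamond}\otimes N^{(j)}_{b_j|y_j}|\Psi\rangle=\frac1{4^N}\langle\psi_N|\bigotimes_j U_{a_j}^\dagger\,\tfrac{1+(-1)^{b_j}\sigma_{y_j}}2\,U_{a_j}|\psi_N\rangle,$$ with $\sigma_0=\sigma_z,\sigma_1=\sigma_x,\sigma_2=\sigma_y$ and $U_{00}=1,U_{01}=\sigma_z,U_{10}=\sigma_x,U_{11}=\sigma_z\sigma_x$.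 These conditions are satisfied by projective measurements on the network state $|\psi_N\rangle\otimes|\phi^+\rangle^{\otimes N}$, with $|\phi^+\rangle=(|00\rangle+|11\rangle)/\sqrt2$ shared by $A_j$ and $B_j$; and from every quantum realisation that satisfies them, local maps extract $|\psi_N\rangle$ up to heralded conjugations. -/

import Mathlib

open scoped ComplexConjugate

universe u

noncomputable section

/-! ### Hilbert spaces, product operators -/

/-- The Hilbert space with orthonormal basis (the computational basis) indexed by `ι`. The index
type is arbitrary, so every complex Hilbert space is of this form, up to a unitary. -/
abbrev Hil (ι : Type*) : Type _ := lp (fun _ : ι => ℂ) 2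

open Classical in
/-- The matrix entry `⟨y| T |x⟩` of a bounded operator in the computational bases. -/
def entry {ι κ : Type*} (T : Hil ι →L[ℂ] Hil κ) (y : κ) (x : ι) : ℂ :=
  T (lp.single 2 x (1 : ℂ)) y

/-- The vector `(⨂ⱼ Sⱼ ⊗ ⨂ⱼ Tⱼ) Ψ`, in coordinates: `Sⱼ` acts on the `j`-th main party and `Tⱼ` on
the `j`-th auxiliary party. The Hilbert tensor product of the spaces `Hil (ιA j)` and `Hil (ιB j)`
is `Hil ((∀ j, ιA j) × (∀ j, ιB j))`. Every row of the matrix of a bounded operator is square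
summable, so the series converges absolutely for every vector `Ψ` of that space. -/
def localApply {N : ℕ} {ιA ιB κA κB : Fin N → Type*}
    (S : ∀ j, Hil (ιA j) →L[ℂ] Hil (κA j)) (T : ∀ j, Hil (ιB j) →L[ℂ] Hil (κB j))
    (Ψ : (∀ j, ιA j) × (∀ j, ιB j) → ℂ) : (∀ j, κA j) × (∀ j, κB j) → ℂ :=
  fun y => ∑' x : (∀ j, ιA j) × (∀ j, ιB j),
    ((∏ j, entry (S j) (y.1 j) (x.1 j)) * (∏ j, entry (T j) (y.2 j) (x.2 j))) * Ψ x

/-- The expectation value `⟨Ψ| ⨂ⱼ Sⱼ ⊗ ⨂ⱼ Tⱼ |Ψ⟩`. -/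
def expect {N : ℕ} {ιA ιB : Fin N → Type*} (Ψ : (∀ j, ιA j) × (∀ j, ιB j) → ℂ)
    (S : ∀ j, Hil (ιA j) →L[ℂ] Hil (ιA j)) (T : ∀ j, Hil (ιB j) →L[ℂ] Hil (ιB j)) : ℂ :=
  ∑' y : (∀ j, ιA j) × (∀ j, ιB j), conj (Ψ y) * localApply S T Ψ y

/-! ### Experiments with `N` main and `N` auxiliary parties -/

/-- An experiment with `2N` parties: main parties `0, …, N-1` and auxiliary parties `0, …, N-1`,
a joint pure state with no assumed product structure, and, for each party and each input, a
measurement. `OA x` and `OB y` are the output alphabets for the inputs `x` and `y`. -/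
structure Experiment {N : ℕ} (ιA ιB : Fin N → Type u) {X Y : Type}
    (OA : X → Type) (OB : Y → Type) [∀ x, Fintype (OA x)] [∀ y, Fintype (OB y)] where
  /-- the joint state -/
  state : Hil ((∀ j, ιA j) × (∀ j, ιB j))
  norm_state : ‖state‖ = 1
  /-- the measurement operators of the main parties -/
  A : ∀ (j : Fin N) (x : X), OA x → (Hil (ιA j) →L[ℂ] Hil (ιA j))
  /-- the measurement operators of the auxiliary parties -/
  B : ∀ (j : Fin N) (y : Y), OB y → (Hil (ιB j) →L[ℂ] Hil (ιB j))
  A_pos : ∀ j x a, (A j x a).IsPositive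
  A_sum : ∀ j x, ∑ a, A j x a = 1
  B_pos : ∀ j y b, (B j y b).IsPositive
  B_sum : ∀ j y, ∑ b, B j y b = 1

namespace Experiment

variable {N : ℕ} {ιA ιB : Fin N → Type u} {X Y : Type} {OA : X → Type} {OB : Y → Type}
  [∀ x, Fintype (OA x)] [∀ y, Fintype (OB y)]

/-- All measurements are projective. -/
def IsProjective (E : Experiment ιA ιB OA OB) : Prop :=
  (∀ j x a, IsStarProjection (E.A j x a)) ∧ (∀ j y b, IsStarProjection (E.B j y b))

/-- The correlations `P(a, b | x, y)`. -/
def corr (E : Experiment ιA ιB OA OB) (x : Fin N → X) (y : Fin N → Y)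
    (a : ∀ j, OA (x j)) (b : ∀ j, OB (y j)) : ℂ :=
  expect E.state (fun j => E.A j (x j) (a j)) (fun j => E.B j (y j) (b j))

end Experiment

/-- The network state: the main parties share `Θ`, and the `j`-th main party also shares with the
`j`-th auxiliary party the maximally entangled state `(1/√n) ∑ᵢ |i i⟩` of dimension `n = n j`. -/
def netState {N : ℕ} {d : Fin N → ℕ} (n : Fin N → ℕ) (Θ : (∀ j, Fin (d j)) → ℂ) :
    (∀ j, Fin (d j) × Fin (n j)) × (∀ j, Fin (n j)) → ℂ :=
  fun x => Θ (fun j => (x.1 j).1) *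
    ∏ j, if (x.1 j).2 = x.2 j then (((√(n j : ℝ))⁻¹ : ℝ) : ℂ) else 0

/-- `2 ^ ⌈log₂ d⌉`: the dimension of the maximally entangled state used for local dimension `d`. -/
def auxDim (d : ℕ) : ℕ := 2 ^ Nat.clog 2 d

/-! ### Multipartite states -/

/-- `χ` is a unit vector of `⨂ₚ ℂ^(d p)`. -/
def IsUnitVector {P : Type} [Fintype P] [DecidableEq P] {d : P → ℕ}
    (χ : (∀ p, Fin (d p)) → ℂ) : Prop :=
  ∑ i, ‖χ i‖ ^ 2 = 1

/-- `χ` is a product of `u`, on the parties in `T`, and `v`, on the other parties. -/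
def IsTensor {P : Type} {d : P → ℕ} (χ : (∀ p, Fin (d p)) → ℂ) (T : Set P)
    (u : (∀ p : {p // p ∈ T}, Fin (d p)) → ℂ) (v : (∀ p : {p // p ∉ T}, Fin (d p)) → ℂ) : Prop :=
  ∀ i : ∀ p, Fin (d p), χ i = u (fun p => i p) * v (fun p => i p)

/-- Genuine multipartite entanglement: `χ` is not a product across any bipartition of the parties
into two nonempty sets. -/
def IsGME {P : Type} {d : P → ℕ} (χ : (∀ p, Fin (d p)) → ℂ) : Prop :=
  ∀ T : Set P, T.Nonempty → Tᶜ.Nonempty → ¬ ∃ u v, IsTensor χ T u v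

/-- `χ` is a genuinely multipartite entangled tensor factor of `ψ`, held by the parties in `S`. If
`ψ` is itself genuinely multipartite entangled, then one can take all parties for `S`, and
`ψ` for `χ`. -/
def IsGMEFactor {N : ℕ} {d : Fin N → ℕ} (ψ : (∀ j, Fin (d j)) → ℂ) (S : Finset (Fin N))
    (χ : (∀ p : {j // j ∈ S}, Fin (d p)) → ℂ) : Prop :=
  IsUnitVector χ ∧ IsGME χ ∧
    ∃ φ : (∀ p : {j // j ∉ S}, Fin (d p)) → ℂ,
      ∀ i : ∀ j, Fin (d j), ψ i = χ (fun p => i p) * φ (fun p => i p)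

/-- The vector `χ ⊗ |c … c⟩`, with one flag qubit for each party. -/
def heralded {P : Type} [Fintype P] {d : P → ℕ} (χ : (∀ p, Fin (d p)) → ℂ) (c : Fin 2)
    (i : ∀ p, Fin (d p)) (f : P → Fin 2) : ℂ :=
  if ∀ p, f p = c then χ i else 0

/-- The vector `χ*`, conjugated in the computational basis. -/
def conjVec {P : Type} {d : P → ℕ} (χ : (∀ p, Fin (d p)) → ℂ) : (∀ p, Fin (d p)) → ℂ :=
  fun i => conj (χ i)

/-- The vector `√α χ ⊗ |0 … 0⟩ + √(1 - α) χ* ⊗ |1 … 1⟩`. -/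
def superposed {P : Type} [Fintype P] {d : P → ℕ} (χ : (∀ p, Fin (d p)) → ℂ) (α : ℝ)
    (i : ∀ p, Fin (d p)) (f : P → Fin 2) : ℂ :=
  (√α : ℂ) * heralded χ 0 i f + (√(1 - α) : ℂ) * heralded (conjVec χ) 1 i f

/-! ### Extraction by local maps

A local map of the `j`-th main party is given by its isometric dilation `W j`, from the space of
that party into `ℂ^(d j) ⊗ ℂ² ⊗ Hil (κ j)`: a system register, a flag qubit and a discarded
register. Nothing is done to the auxiliary parties. -/

/-- Local maps of the `N` main parties extract exactly the pure state
`√α ψ ⊗ |0 … 0⟩ + √(1 - α) ψ* ⊗ |1 … 1⟩`, for some `α`. -/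
def ExtractsSuperposition {N : ℕ} {ιA ιB : Fin N → Type u} {d : Fin N → ℕ}
    (Ψ : (∀ j, ιA j) × (∀ j, ιB j) → ℂ) (ψ : (∀ j, Fin (d j)) → ℂ) : Prop :=
  ∃ (κ : Fin N → Type u) (W : ∀ j, Hil (ιA j) →L[ℂ] Hil (Fin (d j) × Fin 2 × κ j)),
    (∀ j v, ‖W j v‖ = ‖v‖) ∧
    ∃ α ∈ Set.Icc (0 : ℝ) 1, ∃ ζ : Hil ((∀ j, κ j) × (∀ j, ιB j)), ‖ζ‖ = 1 ∧
      ∀ y : (∀ j, Fin (d j) × Fin 2 × κ j) × (∀ j, ιB j),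
        localApply W (fun _ => 1) Ψ y =
          superposed ψ α (fun j => (y.1 j).1) (fun j => (y.1 j).2.1) *
            ζ (fun j => (y.1 j).2.2, y.2)

/-- Local maps of the `N` main parties, the same for all factors of `ψ`, extract every genuinely
multipartite entangled tensor factor `χ` of `ψ` up to a heralded conjugation: the resulting vector
is `√α χ ⊗ |0 … 0⟩ ⊗ ζ₀ + √(1 - α) χ* ⊗ |1 … 1⟩ ⊗ ζ₁`, where the flags are those of the parties `S`
that hold `χ`, and the unit vectors `ζ₀`, `ζ₁` are states of all the other registers: the system and
flag registers of the parties outside `S`, the discarded registers, and the auxiliary parties. -/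
def ExtractsHeralded {N : ℕ} {ιA ιB : Fin N → Type u} {d : Fin N → ℕ}
    (Ψ : (∀ j, ιA j) × (∀ j, ιB j) → ℂ) (ψ : (∀ j, Fin (d j)) → ℂ) : Prop :=
  ∃ (κ : Fin N → Type u) (W : ∀ j, Hil (ιA j) →L[ℂ] Hil (Fin (d j) × Fin 2 × κ j)),
    (∀ j v, ‖W j v‖ = ‖v‖) ∧
    ∀ (S : Finset (Fin N)) (χ : (∀ p : {j // j ∈ S}, Fin (d p)) → ℂ), IsGMEFactor ψ S χ →
      ∃ α ∈ Set.Icc (0 : ℝ) 1,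
      ∃ ζ₀ ζ₁ : Hil ((∀ p : {j // j ∉ S}, Fin (d p) × Fin 2) × (∀ j, κ j) × (∀ j, ιB j)),
        ‖ζ₀‖ = 1 ∧ ‖ζ₁‖ = 1 ∧
        ∀ y : (∀ j, Fin (d j) × Fin 2 × κ j) × (∀ j, ιB j),
          localApply W (fun _ => 1) Ψ y =
            (√α : ℂ) * heralded χ 0 (fun p => (y.1 p).1) (fun p => (y.1 p).2.1) *
                ζ₀ (fun p => ((y.1 p).1, (y.1 p).2.1), fun j => (y.1 j).2.2, y.2) +
              (√(1 - α) : ℂ) *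
                heralded (conjVec χ) 1 (fun p => (y.1 p).1) (fun p => (y.1 p).2.1) *
                ζ₁ (fun p => ((y.1 p).1, (y.1 p).2.1), fun j => (y.1 j).2.2, y.2)

/-! ### Self-testing of states of arbitrary local dimensions -/

/-- Experiments with `m` inputs and `r` outputs for every party. -/
abbrev UniformExperiment {N : ℕ} (ιA ιB : Fin N → Type u) (m r : ℕ) : Type u :=
  Experiment ιA ιB (fun _ : Fin m => Fin r) (fun _ : Fin m => Fin r)

/-- Network experiments: the main parties share some state `Θ`, and each main party shares a
maximally entangled state with its own auxiliary party. -/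
structure NetworkExperiment {N : ℕ} {D : Fin N → ℕ} (Θ : (∀ j, Fin (D j)) → ℂ) (m r : ℕ) extends
    UniformExperiment (fun j => Fin (D j) × Fin (auxDim (D j))) (fun j => Fin (auxDim (D j)))
      m r where
  state_eq : ∀ x, state x = netState (fun j => auxDim (D j)) Θ x

/-- Network-assisted self-testing: some correlations, produced in the network of `N` main parties
sharing some state and `N` maximally entangled states, are such that from any of their `2N`-partite
quantum realisations, local maps of the main parties extract the pure state
`√α ψ ⊗ |0 … 0⟩ + √(1 - α) ψ* ⊗ |1 … 1⟩`, for some `α`. -/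
def NetworkSelfTestable {N : ℕ} {d : Fin N → ℕ} (ψ : (∀ j, Fin (d j)) → ℂ) : Prop :=
  ∃ (D : Fin N → ℕ) (Θ : (∀ j, Fin (D j)) → ℂ) (m r : ℕ) (E : NetworkExperiment Θ m r),
    ∀ (ιA ιB : Fin N → Type u) (R : UniformExperiment ιA ιB m r),
      R.IsProjective → R.corr = E.corr → ExtractsSuperposition R.state ψ

/-- Some correlations, produced in the network where the main parties share `ψ` itself, are such
that from any of their `2N`-partite quantum realisations, local maps of the main parties extract
the factors of `ψ` up to heralded conjugations. -/
def NetworkSelfTestableFromItself {N : ℕ} {d : Fin N → ℕ} (ψ : (∀ j, Fin (d j)) → ℂ) : Prop :=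
  ∃ (m r : ℕ) (E : NetworkExperiment ψ m r),
    ∀ (ιA ιB : Fin N → Type u) (R : UniformExperiment ιA ιB m r),
      R.IsProjective → R.corr = E.corr → ExtractsHeralded R.state ψ

/-! ### The explicit reference correlations for qubits -/

/-- The inputs of a main party: `0, …, 5` and `⋄`. -/
inductive MainInput : Type
  | chsh (x : Fin 6)
  | diamond

/-- The outputs of a main party: one bit, and two bits for the input `⋄`. -/
def MainOutput : MainInput → Type
  | .chsh _ => Fin 2
  | .diamond => Fin 2 × Fin 2

instance instFintypeMainOutput : ∀ x : MainInput, Fintype (MainOutput x)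
  | .chsh _ => inferInstanceAs (Fintype (Fin 2))
  | .diamond => inferInstanceAs (Fintype (Fin 2 × Fin 2))

/-- Experiments in the qubit scenario; the auxiliary parties have three inputs and one output
bit. -/
abbrev QubitExperiment {N : ℕ} (ιA ιB : Fin N → Type u) : Type u :=
  Experiment ιA ιB MainOutput (fun _ : Fin 3 => Fin 2)

namespace QubitExperiment

variable {N : ℕ} {ιA ιB : Fin N → Type u}

/-- The observable `A_x` of the `j`-th main party. -/
def obsA (E : QubitExperiment ιA ιB) (j : Fin N) (x : Fin 6) : Hil (ιA j) →L[ℂ] Hil (ιA j) :=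
  E.A j (.chsh x) (0 : Fin 2) - E.A j (.chsh x) (1 : Fin 2)

/-- The observable `B_y` of the `j`-th auxiliary party. -/
def obsB (E : QubitExperiment ιA ιB) (j : Fin N) (y : Fin 3) : Hil (ιB j) →L[ℂ] Hil (ιB j) :=
  E.B j y 0 - E.B j y 1

/-- The correlator `⟨A_x B_y⟩` of the `j`-th main and the `j`-th auxiliary party. -/
def correlator (E : QubitExperiment ιA ιB) (j : Fin N) (x : Fin 6) (y : Fin 3) : ℂ :=
  expect E.state (Function.update (fun _ => 1) j (E.obsA j x))
    (Function.update (fun _ => 1) j (E.obsB j y))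

/-- The quantity `CHSHⱼ(x₁, x₂; y₁, y₂)`. -/
def chsh (E : QubitExperiment ιA ιB) (j : Fin N) (x₁ x₂ : Fin 6) (y₁ y₂ : Fin 3) : ℂ :=
  E.correlator j x₁ y₁ + E.correlator j x₁ y₂ + E.correlator j x₂ y₁ - E.correlator j x₂ y₂

end QubitExperiment

/-- The Pauli matrices `σ₀ = σ_z`, `σ₁ = σ_x`, `σ₂ = σ_y`. -/
def pauli : Fin 3 → Matrix (Fin 2) (Fin 2) ℂ :=
  ![!![1, 0; 0, -1], !![0, 1; 1, 0], !![0, -Complex.I; Complex.I, 0]]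

/-- The projector `(1 + (-1)^b σ) / 2`, for the Pauli matrix `σ = pauli y`. -/
def pauliProj (y : Fin 3) (b : Fin 2) : Matrix (Fin 2) (Fin 2) ℂ :=
  (1 / 2 : ℂ) • (1 + (-1 : ℂ) ^ (b : ℕ) • pauli y)

/-- The correction unitaries `U₀₀ = 1`, `U₀₁ = σ_z`, `U₁₀ = σ_x`, `U₁₁ = σ_z σ_x`. -/
def correction (a : Fin 2 × Fin 2) : Matrix (Fin 2) (Fin 2) ℂ :=
  pauli 0 ^ (a.2 : ℕ) * pauli 1 ^ (a.1 : ℕ)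

/-- `⟨ψ| ⨂ⱼ Kⱼ |ψ⟩` for an `N`-qubit vector `ψ`. -/
def qubitExpect {N : ℕ} (ψ : (Fin N → Fin 2) → ℂ) (K : Fin N → Matrix (Fin 2) (Fin 2) ℂ) : ℂ :=
  ∑ i, ∑ k, conj (ψ i) * (∏ j, K j (i j) (k j)) * ψ k

/-- The reference correlations for the `N`-qubit state `ψ`: every main party and its auxiliary
party violate the 3-CHSH inequality maximally, and when all main parties receive `⋄`, the
statistics are those of Pauli tomography of the teleported state `ψ`. -/
def QubitExperiment.IsReference {N : ℕ} {ιA ιB : Fin N → Type u} (E : QubitExperiment ιA ιB)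
    (ψ : (Fin N → Fin 2) → ℂ) : Prop :=
  (∀ j, E.chsh j 0 1 0 1 + E.chsh j 2 3 0 2 + E.chsh j 4 5 1 2 = 6 * (√2 : ℂ)) ∧
  ∀ (a : Fin N → Fin 2 × Fin 2) (y : Fin N → Fin 3) (b : Fin N → Fin 2),
    E.corr (fun _ => .diamond) y a b =
      (1 / 4 ^ N : ℂ) *
        qubitExpect ψ fun j =>
          (correction (a j)).conjTranspose * pauliProj (y j) (b j) * correction (a j)

end

/-! The correlations between `A_j` and `B_j` make the relevant operators of `B_j` act on the state
`Ψ` like operators of `A_j` (`Mirror`). Since operators of different parties commute, mirroring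
reverses products. Identities that hold on `Ψ` become identities between operators of `A_j` once
these are cut down to the support of its reduced state (`IsSupport`). What is certified in this way
is a linear map `π` from a full matrix algebra into the operators of `A_j` that respects adjoints
and the Jordan product `XY + YX`, but not the product itself, because correlations cannot tell a
realisation from its complex conjugate. For qubits, `π` comes from three maximal CHSH violations,
which force anticommuting reflections (`exists_jordan_of_chsh`). In general it comes from spectral
measurements of sums of two hermitian matrices: the squares of these sums are respected, and
polarization gives the Jordan product (`exists_jordan_of_frame`).

A Jordan homomorphism of a matrix algebra is the sum of an antihomomorphism `α` and a homomorphism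
`β` (`exists_antihom_add_hom`), and both parts remain mirrored. The flag of a party records which
part is used: `0` for `α`, `1` for `β`. Kraus operators built from the teleportation measurement,
the correction unitaries and the images of matrix units under `α` or `β` move the teleported system
into a register. For mirrored operators the state behaves like a trace (`inner_op_mul_op_mul`).
Hence the inner products of the resulting vectors `V g c i`, with `g` the flags and `c` the record,
are expectation values. After an exchange of indices at the parties with flag `1`, their sum over
`g` and `c` is given by the tomographic statistics as `conj (ψ i) * ψ k` (`sum_inner_krausVec`).

Let `T g` be the projector onto `ψ`, partially transposed at the parties with flag `1`. Its
Frobenius norm is `1`. The total of `⟨V, T g V⟩` is `1`, while the total squared norm of the vectors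
`V` is at most `1`. So Cauchy–Schwarz is tight, and `V = T g V` (`eq_partialTranspose_sum`). A
partial transpose with eigenvalue `1` has rank one, which forces `ψ` to factor across the partition
given by the flags (`mul_eq_mul_mix_of_fixed`). Therefore the holders of a genuinely entangled
factor `χ` never have mixed flags. If all their flags are `0` the register holds `χ`, if all are `1`
it holds `χ*` (`IsFixed.exists_heralded`).

For the exact extraction the result is applied to `(ψ|0…0⟩ + ψ*|1…1⟩)/√2`. For at least one party
this is a unit vector, genuinely multipartite entangled for every `ψ`, and complex conjugation only
flips its flags. The heralding flag says when to flip them back, after which it can be discarded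
(`extractsSuperposition_of_double`). -/

noncomputable section

/-! ### Bounded operators in the computational basis -/

section Instances

variable {ι : Type*}

instance Hil.instNormedAddCommGroup : NormedAddCommGroup (Hil ι) := inferInstance
instance Hil.instAddCommGroup : AddCommGroup (Hil ι) := inferInstance
instance Hil.instAddCommMonoid : AddCommMonoid (Hil ι) := inferInstance
instance Hil.instSeminormedAddCommGroup : SeminormedAddCommGroup (Hil ι) := inferInstance
instance Hil.instTopologicalSpace : TopologicalSpace (Hil ι) := inferInstance
instance Hil.instModule : Module ℂ (Hil ι) := inferInstance
instance Hil.instInnerProductSpace : InnerProductSpace ℂ (Hil ι) := inferInstance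
instance Hil.instCompleteSpace : CompleteSpace (Hil ι) := inferInstance
instance Hil.instRingOp : Ring (Hil ι →L[ℂ] Hil ι) := inferInstance
instance Hil.instSemiringOp : Semiring (Hil ι →L[ℂ] Hil ι) := inferInstance
instance Hil.instMonoidOp : Monoid (Hil ι →L[ℂ] Hil ι) := inferInstance
instance Hil.instMulOp : Mul (Hil ι →L[ℂ] Hil ι) := inferInstance
instance Hil.instAddOp : Add (Hil ι →L[ℂ] Hil ι) := inferInstance
instance Hil.instAddCommMonoidOp : AddCommMonoid (Hil ι →L[ℂ] Hil ι) := inferInstance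
instance Hil.instModuleOp : Module ℂ (Hil ι →L[ℂ] Hil ι) := inferInstance
instance Hil.instSMulOp : SMul ℂ (Hil ι →L[ℂ] Hil ι) := inferInstance
instance Hil.instStarRingOp : StarRing (Hil ι →L[ℂ] Hil ι) := inferInstance
instance Hil.instAlgebraOp : Algebra ℂ (Hil ι →L[ℂ] Hil ι) := inferInstance

end Instances

section Basis

open Classical in
/-- The computational basis vector `|i⟩`. -/
def ket {ι : Type*} (i : ι) : Hil ι := lp.single 2 i (1 : ℂ)

open Classical in
theorem ket_apply {ι : Type*} (i x : ι) : ket i x = if x = i then (1 : ℂ) else 0 := by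
  simp [ket, Pi.single_apply]

theorem entry_eq {ι κ : Type*} (T : Hil ι →L[ℂ] Hil κ) (y : κ) (x : ι) :
    entry T y x = T (ket x) y := by
  rfl

theorem norm_ket {ι : Type*} (i : ι) : ‖ket i‖ = 1 := by
  classical
  unfold ket
  rw [lp.norm_single (by norm_num)]; simp

theorem hasSum_ket {ι : Type*} (f : Hil ι) : HasSum (fun i => f i • ket i) f := by
  classical
  have e : (fun i => f i • ket i) = fun i => lp.single (E := fun _ : ι => ℂ) 2 i (f i) := by
    funext i
    ext x
    simp [ket_apply, Pi.single_apply]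
  rw [e]
  exact lp.hasSum_single (p := 2) (by norm_num) f

/-- Continuity of `T` and of evaluation carries the basis expansion of `f` through. This is what
identifies coordinate series with genuine operators. -/
theorem hasSum_apply {ι κ : Type*} (T : Hil ι →L[ℂ] Hil κ) (f : Hil ι) (y : κ) :
    HasSum (fun x => entry T y x * f x) (T f y) := by
  have h := ((hasSum_ket f).mapL T).mapL (lp.evalCLM ℂ (fun _ : κ => ℂ) 2 y)
  have e : (fun x => lp.evalCLM ℂ (fun _ : κ => ℂ) 2 y (T (f x • ket x)))
      = fun x => entry T y x * f x := by
    funext x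
    rw [map_smul, map_smul, entry_eq, smul_eq_mul, mul_comm]
    rfl
  rw [e] at h
  exact h

theorem clm_ext_ket {ι : Type*} {F : Type*} [NormedAddCommGroup F] [NormedSpace ℂ F]
    {S T : Hil ι →L[ℂ] F} (h : ∀ i, S (ket i) = T (ket i)) : S = T := by
  ext f
  refine ((hasSum_ket f).mapL S).unique ?_
  simpa [h] using (hasSum_ket f).mapL T

theorem hil_inner_eq_tsum {ι : Type*} (f g : Hil ι) : inner ℂ f g = ∑' i, conj (f i) * g i := by
  rw [lp.inner_eq_tsum]
  simp [mul_comm]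

theorem hil_hasSum_inner {ι : Type*} (f g : Hil ι) :
    HasSum (fun i => conj (f i) * g i) (inner ℂ f g) := by
  simpa [mul_comm] using lp.hasSum_inner (𝕜 := ℂ) f g

theorem hil_hasSum_norm_sq {ι : Type*} (f : Hil ι) : HasSum (fun i => ‖f i‖ ^ 2) (‖f‖ ^ 2) := by
  simpa using lp.hasSum_norm (p := 2) (by norm_num) f

theorem hil_memℓp {ι : Type*} {f : ι → ℂ} (h : Summable fun i => ‖f i‖ ^ 2) :
    Memℓp (E := fun _ : ι => ℂ) f 2 := by
  apply memℓp_gen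
  simpa using h

/-- A square-summable family as a vector. -/
def hilMk {ι : Type*} (f : ι → ℂ) (h : Summable fun i => ‖f i‖ ^ 2) : Hil ι :=
  ⟨f, hil_memℓp h⟩

@[simp] theorem hilMk_apply {ι : Type*} (f : ι → ℂ) (h : Summable fun i => ‖f i‖ ^ 2) (i : ι) :
    hilMk f h i = f i := rfl

theorem norm_hilMk_sq {ι : Type*} (f : ι → ℂ) (h : Summable fun i => ‖f i‖ ^ 2) :
    ‖hilMk f h‖ ^ 2 = ∑' i, ‖f i‖ ^ 2 :=
  (hil_hasSum_norm_sq (hilMk f h)).tsum_eq.symm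

theorem hil_summable {ι : Type*} (f : Hil ι) : Summable fun i => ‖f i‖ ^ 2 :=
  (hil_hasSum_norm_sq f).summable

end Basis

/-! ### Operators on one tensor factor -/

section Slice

variable {I ι R : Type*} (e : I ≃ ι × R)

theorem hasSum_fiber_norm (f : Hil I) (r : R) :
    Summable fun x => ‖f (e.symm (x, r))‖ ^ 2 :=
  (hil_summable f).comp_injective (i := fun x => e.symm (x, r)) fun x y h => by simpa using h

/-- The slice of a vector at fixed index of the other factor. -/
def slice (f : Hil I) (r : R) : Hil ι := hilMk (fun x => f (e.symm (x, r))) (hasSum_fiber_norm e f r)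

@[simp] theorem slice_apply (f : Hil I) (r : R) (x : ι) : slice e f r x = f (e.symm (x, r)) := rfl

theorem slice_add (f g : Hil I) (r : R) : slice e (f + g) r = slice e f r + slice e g r := by
  ext x; simp

theorem slice_smul (c : ℂ) (f : Hil I) (r : R) : slice e (c • f) r = c • slice e f r := by
  ext x; simp

theorem slice_ext {f g : Hil I} (h : ∀ r, slice e f r = slice e g r) : f = g := by
  ext i
  have := congrArg (fun v : Hil ι => v (e i).1) (h (e i).2)
  simpa using this

/-- Summation over the product index, fibre by fibre. The slices exhibit `Hil I` as a Hilbert sum of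
copies of `Hil ι`, on which `S ⊗ 1` acts diagonally. -/
theorem hasSum_slice_norm (f : Hil I) : HasSum (fun r => ‖slice e f r‖ ^ 2) (‖f‖ ^ 2) := by
  have h : HasSum (fun p : R × ι => ‖f (e.symm p.swap)‖ ^ 2) (‖f‖ ^ 2) :=
    (((Equiv.prodComm R ι).trans e.symm).hasSum_iff (f := fun i => ‖f i‖ ^ 2)).2
      (hil_hasSum_norm_sq f)
  exact h.prod_fiberwise fun r => hil_hasSum_norm_sq (slice e f r)

theorem hasSum_slice_inner (f g : Hil I) :
    HasSum (fun r => inner ℂ (slice e f r) (slice e g r)) (inner ℂ f g) := by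
  have h : HasSum (fun p : R × ι => conj (f (e.symm p.swap)) * g (e.symm p.swap)) (inner ℂ f g) :=
    (((Equiv.prodComm R ι).trans e.symm).hasSum_iff (f := fun i => conj (f i) * g i)).2
      (hil_hasSum_inner f g)
  exact h.prod_fiberwise fun r => hil_hasSum_inner (slice e f r) (slice e g r)

theorem summable_siteFun (S : Hil ι →L[ℂ] Hil ι) (f : Hil I) :
    Summable fun i => ‖S (slice e f (e i).2) (e i).1‖ ^ 2 := by
  have h1 : Summable fun r => ‖S (slice e f r)‖ ^ 2 := by
    refine Summable.of_nonneg_of_le (fun _ => by positivity) (fun r => ?_)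
      ((hasSum_slice_norm e f).summable.mul_left (‖S‖ ^ 2))
    rw [← mul_pow]
    gcongr
    exact S.le_opNorm _
  have h2 : Summable fun p : R × ι => ‖S (slice e f p.1) p.2‖ ^ 2 := by
    rw [summable_prod_of_nonneg (fun _ => by positivity)]
    exact ⟨fun r => hil_summable (S (slice e f r)),
      h1.congr fun r => (hil_hasSum_norm_sq (S (slice e f r))).tsum_eq.symm⟩
  have h3 := (Equiv.summable_iff (e.trans (Equiv.prodComm ι R))
    (f := fun p : R × ι => ‖S (slice e f p.1) p.2‖ ^ 2)).2 h2
  exact h3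

/-- The vector `(S ⊗ 1) f`. -/
def siteVec (S : Hil ι →L[ℂ] Hil ι) (f : Hil I) : Hil I :=
  hilMk (fun i => S (slice e f (e i).2) (e i).1) (summable_siteFun e S f)

@[simp] theorem slice_siteVec (S : Hil ι →L[ℂ] Hil ι) (f : Hil I) (r : R) :
    slice e (siteVec e S f) r = S (slice e f r) := by
  ext x; simp [siteVec]

theorem norm_siteVec_le (S : Hil ι →L[ℂ] Hil ι) (f : Hil I) : ‖siteVec e S f‖ ≤ ‖S‖ * ‖f‖ := by
  refine le_of_sq_le_sq ?_ (by positivity)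
  rw [← (hasSum_slice_norm e (siteVec e S f)).tsum_eq, mul_pow, ← (hasSum_slice_norm e f).tsum_eq,
    ← tsum_mul_left]
  refine (hasSum_slice_norm e _).summable.tsum_le_tsum (fun r => ?_)
    ((hasSum_slice_norm e f).summable.mul_left _)
  rw [slice_siteVec, ← mul_pow]
  gcongr
  exact S.le_opNorm _

/-- The operator `S ⊗ 1`. -/
def siteCLM (S : Hil ι →L[ℂ] Hil ι) : Hil I →L[ℂ] Hil I :=
  LinearMap.mkContinuous
    { toFun := siteVec e S
      map_add' := fun f g => slice_ext e fun r => by simp [slice_add]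
      map_smul' := fun c f => slice_ext e fun r => by simp [slice_smul] } ‖S‖ (norm_siteVec_le e S)

@[simp] theorem slice_siteCLM (S : Hil ι →L[ℂ] Hil ι) (f : Hil I) (r : R) :
    slice e (siteCLM e S f) r = S (slice e f r) := slice_siteVec e S f r

/-- `S ↦ S ⊗ 1`. -/
def siteOp : (Hil ι →L[ℂ] Hil ι) →⋆ₐ[ℂ] (Hil I →L[ℂ] Hil I) where
  toFun := siteCLM e
  map_one' := by ext1 f; exact slice_ext e fun r => by simp
  map_mul' S T := by ext1 f; exact slice_ext e fun r => by simp
  map_zero' := by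
    ext1 f
    exact slice_ext e fun r => by
      rw [slice_siteCLM]; ext x; simp
  map_add' S T := by ext1 f; exact slice_ext e fun r => by simp [slice_add]
  commutes' c := by
    ext1 f
    exact slice_ext e fun r => by simp [Algebra.algebraMap_eq_smul_one, slice_smul]
  map_star' S := by
    rw [ContinuousLinearMap.star_eq_adjoint, ContinuousLinearMap.star_eq_adjoint,
      ContinuousLinearMap.eq_adjoint_iff]
    intro f g
    refine (hasSum_slice_inner e _ _).unique ?_
    convert hasSum_slice_inner e f (siteCLM e S g) using 2 with r
    simp [ContinuousLinearMap.adjoint_inner_left]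

@[simp] theorem slice_siteOp (S : Hil ι →L[ℂ] Hil ι) (f : Hil I) (r : R) :
    slice e (siteOp e S f) r = S (slice e f r) := slice_siteVec e S f r

theorem siteOp_apply (S : Hil ι →L[ℂ] Hil ι) (f : Hil I) (i : I) :
    siteOp e S f i = S (slice e f (e i).2) (e i).1 := rfl

end Slice

/-! ### Product operators -/

section Sites

theorem ket_pi_apply {P : Type*} [Fintype P] {ι : P → Type*} (x y : ∀ p, ι p) : ket x y = ∏ p, ket (x p) (y p) := by
  classical
  simp_rw [ket_apply, Finset.prod_ite_zero, funext_iff]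
  simp

variable {P : Type*} [dP : DecidableEq P] {ι : P → Type*}

/-- The operator acting as `S` on the site `p`. -/
def atSite (p : P) : (Hil (ι p) →L[ℂ] Hil (ι p)) →⋆ₐ[ℂ] (Hil (∀ p, ι p) →L[ℂ] Hil (∀ p, ι p)) :=
  siteOp (Equiv.piSplitAt p ι)

theorem piSplitAt_symm_self (p : P) (x : ι p) (r : ∀ q : {q // q ≠ p}, ι q) :
    (Equiv.piSplitAt p ι).symm (x, r) p = x := by
  simp [Equiv.piSplitAt]

theorem piSplitAt_symm_ne (p : P) (x : ι p) (r : ∀ q : {q // q ≠ p}, ι q) {q : P} (h : q ≠ p) :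
    (Equiv.piSplitAt p ι).symm (x, r) q = r ⟨q, h⟩ := by
  simp [Equiv.piSplitAt, h]

variable [Fintype P]

/-- Every slice of a product vector along `p` is a multiple of `v p`, so only that factor changes.
Basis vectors are products, so this formula determines all products of such operators. -/
theorem atSite_apply_prod (p : P) (S : Hil (ι p) →L[ℂ] Hil (ι p)) {f : Hil (∀ p, ι p)}
    {v : ∀ p, Hil (ι p)} (hf : ∀ y, f y = ∏ q, v q (y q)) (y : ∀ p, ι p) :
    atSite p S f y = ∏ q, (Function.update v p (S (v p)) q) (y q) := by
  have h : slice (Equiv.piSplitAt p ι) f (Equiv.piSplitAt p ι y).2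
      = (∏ q ∈ Finset.univ.erase p, v q (y q)) • v p := by
    ext x
    rw [slice_apply, hf, ← Finset.mul_prod_erase _ _ (Finset.mem_univ p), piSplitAt_symm_self,
      lp.coeFn_smul, Pi.smul_apply, smul_eq_mul, mul_comm]
    congr 1
    refine Finset.prod_congr rfl fun q hq => ?_
    rw [piSplitAt_symm_ne p _ _ (Finset.ne_of_mem_erase hq)]
    rfl
  rw [atSite, siteOp_apply, h, map_smul, lp.coeFn_smul, Pi.smul_apply, smul_eq_mul, mul_comm,
    ← Finset.mul_prod_erase _ _ (Finset.mem_univ p), Function.update_self]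
  congr 1
  refine Finset.prod_congr rfl fun q hq => ?_
  rw [Function.update_of_ne (Finset.ne_of_mem_erase hq)]

/-- `atSite p` as a homomorphism of monoids. -/
def atSiteHom (p : P) :
    (Hil (ι p) →L[ℂ] Hil (ι p)) →* (Hil (∀ p, ι p) →L[ℂ] Hil (∀ p, ι p)) where
  toFun := atSite p
  map_one' := map_one _
  map_mul' := map_mul _

/-- It is enough to compare both orders on basis vectors, where each operator updates one factor of
a product and updates at distinct sites commute. -/
theorem atSite_commute :
    Pairwise fun p q : P => ∀ (S : Hil (ι p) →L[ℂ] Hil (ι p)) (T : Hil (ι q) →L[ℂ] Hil (ι q)),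
      Commute (atSiteHom p S : Hil (∀ p, ι p) →L[ℂ] Hil (∀ p, ι p))
        (atSiteHom q T) := by
  intro p q hpq S T
  refine clm_ext_ket fun x => ?_
  ext y
  change atSite p S (atSite q T (ket x)) y = atSite q T (atSite p S (ket x)) y
  rw [atSite_apply_prod p S (atSite_apply_prod q T (ket_pi_apply x)),
    atSite_apply_prod q T (atSite_apply_prod p S (ket_pi_apply x)),
    Function.update_of_ne hpq, Function.update_of_ne hpq.symm, Function.update_comm hpq]

/-- The product operator `⨂ₚ Sₚ`. -/
def prodOp : (∀ p, Hil (ι p) →L[ℂ] Hil (ι p)) →* (Hil (∀ p, ι p) →L[ℂ] Hil (∀ p, ι p)) :=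
  MonoidHom.noncommPiCoprod atSiteHom atSite_commute

theorem prodOp_mulSingle (p : P) (S : Hil (ι p) →L[ℂ] Hil (ι p)) :
    prodOp (Pi.mulSingle p S) = atSite p S :=
  MonoidHom.noncommPiCoprod_mulSingle atSiteHom p S

/-- The dependence on one entry is isolated in a factor that is linear in it; multilinearity of the
product operator follows. -/
theorem prodOp_update (S : ∀ p, Hil (ι p) →L[ℂ] Hil (ι p)) (p : P) (T : Hil (ι p) →L[ℂ] Hil (ι p)) :
    prodOp (Function.update S p T) = atSite p T * prodOp (Function.update S p 1) := by
  rw [← prodOp_mulSingle, ← map_mul]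
  congr 1
  ext1 q
  rcases eq_or_ne q p with rfl | h
  · simp
  · simp [h]

/-- An induction principle: a property of families that is stable under products and holds
for families with one nontrivial entry holds for all families. -/
theorem pi_mulSingle_induction {M : P → Type*} [∀ p, Monoid (M p)] (C : (∀ p, M p) → Prop)
    (h1 : C 1) (hs : ∀ p (x : M p) (y : ∀ p, M p), C y → y p = 1 → C (Pi.mulSingle p x * y))
    (x : ∀ p, M p) : C x := by
  have key : ∀ s : Finset P, C fun p => if p ∈ s then x p else 1 := by
    intro s
    induction s using Finset.induction_on with
    | empty => exact h1
    | insert p s hp ih =>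
      convert hs p (x p) _ ih (by simp [hp]) using 1
      ext1 q
      rcases eq_or_ne q p with rfl | h
      · simp [hp]
      · simp [h]
  simpa using key Finset.univ

theorem prodOp_apply_prod (S : ∀ p, Hil (ι p) →L[ℂ] Hil (ι p)) {f : Hil (∀ p, ι p)}
    {v : ∀ p, Hil (ι p)} (hf : ∀ y, f y = ∏ q, v q (y q)) (y : ∀ p, ι p) :
    prodOp S f y = ∏ q, (S q (v q)) (y q) := by
  revert y
  induction S using pi_mulSingle_induction with
  | h1 => intro y; rw [map_one]; exact hf y
  | hs p x T ih hp =>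
    intro y
    rw [map_mul, prodOp_mulSingle]
    change atSite p x (prodOp T f) y = _
    rw [atSite_apply_prod p x (v := fun q => T q (v q)) ih]
    refine Finset.prod_congr rfl fun q _ => ?_
    rcases eq_or_ne q p with rfl | h
    · simp [hp]
    · simp [h]

theorem entry_prodOp (S : ∀ p, Hil (ι p) →L[ℂ] Hil (ι p)) (y x : ∀ p, ι p) :
    entry (prodOp S) y x = ∏ p, entry (S p) (y p) (x p) :=
  prodOp_apply_prod S (ket_pi_apply x) y

theorem prodOp_star (S : ∀ p, Hil (ι p) →L[ℂ] Hil (ι p)) :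
    prodOp (star S) = star (prodOp S) := by
  induction S using pi_mulSingle_induction with
  | h1 => simp
  | hs p x T ih hp =>
    -- The adjoint reverses products, so the entry at `p` is first moved past `T`, which is trivial
    -- at `p`.
    have hc : Pi.mulSingle p x * T = T * Pi.mulSingle p x := by
      ext1 q
      rcases eq_or_ne q p with rfl | h
      · simp [hp]
      · simp [h]
    have hx : star (Pi.mulSingle p x : ∀ p, Hil (ι p) →L[ℂ] Hil (ι p)) = Pi.mulSingle p (star x) := by
      ext1 q
      rcases eq_or_ne q p with rfl | h
      · simp
      · simp [h]
    rw [hc, star_mul, map_mul, map_mul, star_mul, ih, hx, prodOp_mulSingle, prodOp_mulSingle,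
      map_star]

/-- The product operator as a multilinear map. -/
def prodOpMulti : MultilinearMap ℂ (fun p => Hil (ι p) →L[ℂ] Hil (ι p))
    (Hil (∀ p, ι p) →L[ℂ] Hil (∀ p, ι p)) where
  toFun := prodOp
  map_update_add' := by
    intro inst S p x y
    cases Subsingleton.elim inst dP
    rw [prodOp_update _ p (x + y), prodOp_update _ p x, prodOp_update _ p y, map_add, add_mul]
  map_update_smul' := by
    intro inst S p c x
    cases Subsingleton.elim inst dP
    rw [prodOp_update _ p (c • x), prodOp_update _ p x, map_smul, smul_mul_assoc]

end Sites

/-! ### Local algebras -/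

/-- A commuting family of representations of the local algebras of `N` parties, packaged as the
multilinear map that sends a family of local operators to its product. -/
structure LocalRep {N : ℕ} (𝔸 : Fin N → Type*) [∀ j, Ring (𝔸 j)] [∀ j, StarRing (𝔸 j)]
    [∀ j, Algebra ℂ (𝔸 j)] (H : Type*) [NormedAddCommGroup H] [InnerProductSpace ℂ H]
    [CompleteSpace H] where
  /-- the product of a family of local operators -/
  op : MultilinearMap ℂ 𝔸 (H →L[ℂ] H)
  op_one : op 1 = 1
  op_mul : ∀ S T, op (S * T) = op S * op T
  op_star : ∀ S, op (star S) = star (op S)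

/-! ### Main and auxiliary parties on the joint Hilbert space. -/

section Joint

variable {N : ℕ} {ιA ιB : Fin N → Type u}

/-- The index types of all `2N` parties. -/
abbrev Sites (ιA ιB : Fin N → Type u) : Fin N ⊕ Fin N → Type u := Sum.elim ιA ιB

/-- An operator of a main party as an operator on its site. -/
def mainOp {j : Fin N} (x : Hil (ιA j) →L[ℂ] Hil (ιA j)) :
    Hil (Sites ιA ιB (.inl j)) →L[ℂ] Hil (Sites ιA ιB (.inl j)) := x

/-- An operator of an auxiliary party as an operator on its site. -/
def auxOp {j : Fin N} (x : Hil (ιB j) →L[ℂ] Hil (ιB j)) :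
    Hil (Sites ιA ιB (.inr j)) →L[ℂ] Hil (Sites ιA ιB (.inr j)) := x

/-- A family of operators for all parties. -/
def bothOps (S : ∀ j, Hil (ιA j) →L[ℂ] Hil (ιA j)) (T : ∀ j, Hil (ιB j) →L[ℂ] Hil (ιB j)) :
    ∀ p, Hil (Sites ιA ιB p) →L[ℂ] Hil (Sites ιA ιB p)
  | .inl j => S j
  | .inr j => T j

theorem bothOps_update_left (S : ∀ j, Hil (ιA j) →L[ℂ] Hil (ιA j))
    (T : ∀ j, Hil (ιB j) →L[ℂ] Hil (ιB j)) (j : Fin N) (x) :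
    bothOps (Function.update S j x) T = Function.update (bothOps S T) (.inl j) (mainOp x) := by
  funext p
  rcases p with k | k
  · rcases eq_or_ne k j with rfl | h
    · rw [Function.update_self]
      exact Function.update_self k x S
    · rw [Function.update_of_ne fun e => h (Sum.inl_injective e)]
      exact Function.update_of_ne h x S
  · exact (Function.update_of_ne Sum.inr_ne_inl _ _).symm

theorem bothOps_update_right (S : ∀ j, Hil (ιA j) →L[ℂ] Hil (ιA j))
    (T : ∀ j, Hil (ιB j) →L[ℂ] Hil (ιB j)) (j : Fin N) (x) :
    bothOps S (Function.update T j x) = Function.update (bothOps S T) (.inr j) (auxOp x) := by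
  funext p
  rcases p with k | k
  · exact (Function.update_of_ne Sum.inl_ne_inr _ _).symm
  · rcases eq_or_ne k j with rfl | h
    · rw [Function.update_self]
      exact Function.update_self k x T
    · rw [Function.update_of_ne fun e => h (Sum.inr_injective e)]
      exact Function.update_of_ne h x T

theorem bothOps_mul (S S' : ∀ j, Hil (ιA j) →L[ℂ] Hil (ιA j))
    (T T' : ∀ j, Hil (ιB j) →L[ℂ] Hil (ιB j)) :
    bothOps (S * S') (T * T') = bothOps S T * bothOps S' T' := by
  funext p; rcases p with k | k <;> rfl

theorem bothOps_one :
    bothOps (1 : ∀ j, Hil (ιA j) →L[ℂ] Hil (ιA j)) (1 : ∀ j, Hil (ιB j) →L[ℂ] Hil (ιB j)) = 1 := by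
  funext p; rcases p with k | k <;> rfl

theorem bothOps_star (S : ∀ j, Hil (ιA j) →L[ℂ] Hil (ιA j))
    (T : ∀ j, Hil (ιB j) →L[ℂ] Hil (ιB j)) :
    bothOps (star S) (star T) = star (bothOps S T) := by
  funext p; rcases p with k | k <;> rfl

variable (ιA ιB) in
/-- The Hilbert space of all parties. -/
abbrev Joint : Type u := Hil (∀ p, Sites ιA ιB p)

variable (ιA ιB) in
/-- The representation of the main parties. -/
def mainRep : LocalRep (fun j => Hil (ιA j) →L[ℂ] Hil (ιA j)) (Joint ιA ιB) where
  op :=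
    { toFun := fun S => prodOp (bothOps S 1)
      map_update_add' := by
        intro inst S j x y
        cases Subsingleton.elim inst (instDecidableEqFin N)
        simp only [bothOps_update_left]
        exact (prodOpMulti (ι := Sites ιA ιB)).map_update_add (bothOps S 1) _ (mainOp x) (mainOp y)
      map_update_smul' := by
        intro inst S j c x
        cases Subsingleton.elim inst (instDecidableEqFin N)
        simp only [bothOps_update_left]
        exact (prodOpMulti (ι := Sites ιA ιB)).map_update_smul (bothOps S 1) _ c (mainOp x) }
  op_one := (congrArg prodOp (bothOps_one (ιA := ιA) (ιB := ιB))).trans (map_one prodOp)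
  op_mul S T := by
    have h := map_mul prodOp (bothOps (ιB := ιB) S 1) (bothOps T 1)
    rw [← bothOps_mul, one_mul] at h
    exact h
  op_star S := by
    have h := prodOp_star (bothOps (ιB := ιB) S 1)
    rw [← bothOps_star, star_one] at h
    exact h

variable (ιA ιB) in
/-- The representation of the auxiliary parties. -/
def auxRep : LocalRep (fun j => Hil (ιB j) →L[ℂ] Hil (ιB j)) (Joint ιA ιB) where
  op :=
    { toFun := fun T => prodOp (bothOps 1 T)
      map_update_add' := by
        intro inst S j x y
        cases Subsingleton.elim inst (instDecidableEqFin N)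
        simp only [bothOps_update_right]
        exact (prodOpMulti (ι := Sites ιA ιB)).map_update_add (bothOps 1 S) _ (auxOp x) (auxOp y)
      map_update_smul' := by
        intro inst S j c x
        cases Subsingleton.elim inst (instDecidableEqFin N)
        simp only [bothOps_update_right]
        exact (prodOpMulti (ι := Sites ιA ιB)).map_update_smul (bothOps 1 S) _ c (auxOp x) }
  op_one := (congrArg prodOp (bothOps_one (ιA := ιA) (ιB := ιB))).trans (map_one prodOp)
  op_mul S T := by
    have h := map_mul prodOp (bothOps (ιA := ιA) 1 S) (bothOps 1 T)
    rw [← bothOps_mul, one_mul] at h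
    exact h
  op_star S := by
    have h := prodOp_star (bothOps (ιA := ιA) 1 S)
    rw [← bothOps_star, star_one] at h
    exact h

theorem prodOp_bothOps (S : ∀ j, Hil (ιA j) →L[ℂ] Hil (ιA j))
    (T : ∀ j, Hil (ιB j) →L[ℂ] Hil (ιB j)) :
    prodOp (bothOps S T) = (mainRep ιA ιB).op S * (auxRep ιA ιB).op T := by
  change _ = prodOp (bothOps S 1) * prodOp (bothOps 1 T)
  rw [← map_mul, ← bothOps_mul, one_mul, mul_one]

theorem mainRep_commute_auxRep (S : ∀ j, Hil (ιA j) →L[ℂ] Hil (ιA j))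
    (T : ∀ j, Hil (ιB j) →L[ℂ] Hil (ιB j)) :
    Commute ((mainRep ιA ιB).op S) ((auxRep ιA ιB).op T) := by
  change prodOp (bothOps S 1) * prodOp (bothOps 1 T) = prodOp (bothOps 1 T) * prodOp (bothOps S 1)
  rw [← map_mul, ← map_mul, ← bothOps_mul, ← bothOps_mul, one_mul, mul_one, one_mul, mul_one]

variable (ιA ιB) in
/-- The joint index as a pair of indices of the main and the auxiliary parties. -/
def jointEquiv : (∀ p, Sites ιA ιB p) ≃ (∀ j, ιA j) × (∀ j, ιB j) :=
  Equiv.sumPiEquivProdPi (Sites ιA ιB)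

/-- The joint state as a vector of `Joint ιA ιB`. -/
def jointVec (Ψ : Hil ((∀ j, ιA j) × (∀ j, ιB j))) : Joint ιA ιB :=
  hilMk (fun x => Ψ (jointEquiv ιA ιB x)) ((jointEquiv ιA ιB).summable_iff.2 (hil_summable Ψ))

theorem jointVec_symm (Ψ : Hil ((∀ j, ιA j) × (∀ j, ιB j))) (y : (∀ j, ιA j) × (∀ j, ιB j)) :
    jointVec Ψ ((jointEquiv ιA ιB).symm y) = Ψ y := by
  simp [jointVec]

theorem norm_jointVec (Ψ : Hil ((∀ j, ιA j) × (∀ j, ιB j))) : ‖jointVec Ψ‖ = ‖Ψ‖ := by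
  rw [← sq_eq_sq₀ (norm_nonneg _) (norm_nonneg _), jointVec, norm_hilMk_sq,
    ← (hil_hasSum_norm_sq Ψ).tsum_eq]
  exact (jointEquiv ιA ιB).tsum_eq fun y => ‖Ψ y‖ ^ 2

/-- The bridge from coordinates to operators: the matrix entries of a product operator are products
of entries, so the defining series is the coordinate expansion of an operator applied to `Ψ`. -/
theorem localApply_eq (S : ∀ j, Hil (ιA j) →L[ℂ] Hil (ιA j))
    (T : ∀ j, Hil (ιB j) →L[ℂ] Hil (ιB j)) (Ψ : Hil ((∀ j, ιA j) × (∀ j, ιB j)))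
    (y : (∀ j, ιA j) × (∀ j, ιB j)) :
    localApply S T Ψ y =
      (mainRep ιA ιB).op S ((auxRep ιA ιB).op T (jointVec Ψ)) ((jointEquiv ιA ιB).symm y) := by
  change _ = ((mainRep ιA ιB).op S * (auxRep ιA ιB).op T) (jointVec Ψ) ((jointEquiv ιA ιB).symm y)
  rw [← prodOp_bothOps, ← (hasSum_apply _ _ _).tsum_eq, localApply,
    ← (jointEquiv ιA ιB).symm.tsum_eq]
  refine tsum_congr fun x => ?_
  rw [entry_prodOp, jointVec_symm, Fintype.prod_sum_type]
  rfl

theorem expect_eq (Ψ : Hil ((∀ j, ιA j) × (∀ j, ιB j))) (S : ∀ j, Hil (ιA j) →L[ℂ] Hil (ιA j))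
    (T : ∀ j, Hil (ιB j) →L[ℂ] Hil (ιB j)) :
    expect Ψ S T =
      inner ℂ (jointVec Ψ) ((mainRep ιA ιB).op S ((auxRep ιA ιB).op T (jointVec Ψ))) := by
  rw [hil_inner_eq_tsum, expect, ← (jointEquiv ιA ιB).symm.tsum_eq]
  simp_rw [localApply_eq, jointVec_symm]

end Joint

/-! ### Jordan homomorphisms of matrix algebras -/

section JordanUnits

variable {R : Type*} [Ring R] [StarRing R] [Algebra ℂ R]

/-- The images of the matrix units under a Jordan homomorphism. -/
structure JordanUnits {n : ℕ} (e : Fin n → Fin n → R) : Prop where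
  jordan : ∀ i j k l, e i j * e k l + e k l * e i j =
    (if j = k then e i l else 0) + (if l = i then e k j else 0)
  star_eq : ∀ i j, star (e i j) = e j i

namespace JordanUnits

omit [StarRing R] in
theorem eq_of_add_self {x y : R} (h : x + x = y + y) : x = y := by
  have h2 : (2 : ℂ) • x = (2 : ℂ) • y := by simpa [two_smul] using h
  have := congrArg ((2⁻¹ : ℂ) • ·) h2
  simpa [smul_smul] using this

variable {n : ℕ} {e : Fin n → Fin n → R} (he : JordanUnits e)
include he

omit [Algebra ℂ R] in
theorem transpose : JordanUnits fun i j => e j i where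
  jordan i j k l := by
    rw [he.jordan, add_comm]
    simp only [eq_comm]
  star_eq i j := he.star_eq j i

theorem sq (i : Fin n) : e i i * e i i = e i i := by
  apply eq_of_add_self
  simpa using he.jordan i i i i

theorem sq_zero {i j : Fin n} (h : i ≠ j) : e i j * e i j = 0 := by
  apply eq_of_add_self
  simpa [h.symm] using he.jordan i j i j

omit [Algebra ℂ R] in
theorem left {i j : Fin n} (h : i ≠ j) : e i i * e i j + e i j * e i i = e i j := by
  simpa [h.symm] using he.jordan i i i j

omit [Algebra ℂ R] in
theorem right {i j : Fin n} (h : i ≠ j) : e j j * e i j + e i j * e j j = e i j := by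
  simpa [h.symm] using he.jordan j j i j

/-- Multiplying the identity `left` by the idempotent `e i i` produces the same term on both sides,
and what is left over must vanish. -/
theorem corner {i j : Fin n} (h : i ≠ j) : e i i * e i j * e i i = 0 := by
  have h1 := congrArg (e i i * ·) (he.left h)
  simp only [mul_add, ← mul_assoc, he.sq] at h1
  simpa using h1

theorem corner' {i j : Fin n} (h : i ≠ j) : e i i * e j i * e i i = 0 :=
  he.transpose.corner h

/-- The Jordan relation says that the idempotent `p = e k k` anticommutes with `x = e i j`.
Compression gives `2 p x p = 0`, and then multiplication by `p` gives `p x = 0`. -/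
theorem off_left {i j k : Fin n} (hi : k ≠ i) (hj : k ≠ j) : e k k * e i j = 0 := by
  have h0 : e k k * e i j + e i j * e k k = 0 := by simpa [hi, hj.symm] using he.jordan k k i j
  have h1 := congrArg (e k k * ·) h0
  have h2 := congrArg (· * e k k) h1
  simp only [mul_add, add_mul, ← mul_assoc, he.sq, mul_zero, zero_mul] at h1 h2
  rw [mul_assoc (e k k * e i j), he.sq] at h2
  have h3 : e k k * e i j * e k k = 0 := eq_of_add_self (by simpa using h2)
  simpa [h3] using h1

theorem off_right {i j k : Fin n} (hi : k ≠ i) (hj : k ≠ j) : e i j * e k k = 0 := by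
  have h0 : e k k * e i j + e i j * e k k = 0 := by simpa [hi, hj.symm] using he.jordan k k i j
  simpa [he.off_left hi hj] using h0

/-- So `e i j` is a partial isometry although `e` need not be multiplicative. The anticommutator of
`e i j` and `e j i` is multiplied by `e i j` from the left and from the right; the squares drop out
and the two results add up. -/
theorem triple {i j : Fin n} (h : i ≠ j) : e i j * e j i * e i j = e i j := by
  have h0 : e i j * e j i + e j i * e i j = e i i + e j j := by simpa using he.jordan i j j i
  have h1 := congrArg (e i j * ·) h0
  simp only [mul_add, ← mul_assoc, he.sq_zero h, zero_mul, zero_add] at h1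
  have h2 := congrArg (· * e i j) h0
  simp only [add_mul, mul_assoc, he.sq_zero h, mul_zero, add_zero] at h2
  rw [← mul_assoc] at h2
  apply eq_of_add_self
  calc e i j * e j i * e i j + e i j * e j i * e i j
      = (e i j * e i i + e i j * e j j) + (e i i * e i j + e j j * e i j) :=
        congrArg₂ (· + ·) h1 h2
    _ = (e i i * e i j + e i j * e i i) + (e j j * e i j + e i j * e j j) := by abel
    _ = e i j + e i j := by rw [he.left h, he.right h]

variable {z : Fin n}

/-- Inside the row, `e z i` may be followed by `e i i`, which annihilates `e k z`. -/
theorem row_mul_row_of_ne {i k : Fin n} (hi : i ≠ z) (hik : i ≠ k) :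
    (e z z * e z i) * (e k z * e z z) = 0 := by
  have h1 : e z z * e z i = e z z * e z i * e i i := by
    nth_rewrite 1 [← he.right hi.symm]
    rw [mul_add, ← mul_assoc, he.off_left hi.symm hi.symm, zero_mul, zero_add, mul_assoc]
  rw [h1, mul_assoc, ← mul_assoc (e i i), he.off_left hik hi, zero_mul, mul_zero]

theorem row_trans {i k : Fin n} (hi : i ≠ z) (hk : k ≠ z) :
    e z z * e z i = e z z * e z k * e k i := by
  have h0 : e z k * e k i + e k i * e z k = e z i := by simpa [hi] using he.jordan z k k i
  rw [← h0, mul_add, ← mul_assoc, ← mul_assoc (e z z) (e k i), he.off_left hk.symm hi.symm,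
    zero_mul, add_zero]

theorem col_trans {i k : Fin n} (hi : i ≠ z) (hk : k ≠ z) :
    e i z * e z z = e i k * (e k z * e z z) := by
  have h := congrArg star (he.row_trans hi hk)
  simpa [he.star_eq, mul_assoc] using h

/-- This makes `rowProj` independent of its auxiliary second index. -/
theorem row_mul_col {i k : Fin n} (hi : i ≠ z) (hk : k ≠ z) :
    (e z z * e z i) * (e i z * e z z) = (e z z * e z k) * (e k z * e z z) := by
  rw [he.row_trans hi hk, he.col_trans hk hi, mul_assoc]

theorem proj_mul_row {i : Fin n} (hi : i ≠ z) :
    (e z z * e z i) * (e i z * e z z) * (e z z * e z i) = e z z * e z i := by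
  have h1 : e z z * e z i * e i z = (e z z * e z i) * (e i z * e z z) := by
    nth_rewrite 1 [← he.right hi]
    rw [mul_add, ← mul_assoc, he.corner hi.symm, zero_mul, zero_add]
  calc _ = (e z z * e z i) * (e i z * e z z) * e z i := by
        rw [mul_assoc, mul_assoc (e i z), ← mul_assoc (e z z) (e z z), he.sq]
        simp only [mul_assoc]
    _ = e z z * (e z i * e i z * e z i) := by rw [← h1]; simp only [mul_assoc]
    _ = _ := by rw [he.triple hi.symm]

end JordanUnits

/-- The projection onto the homomorphic part of the `z`-th diagonal matrix unit. -/
def rowProj {n : ℕ} (e : Fin n → Fin n → R) (z w : Fin n) : R :=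
  (e z z * e z w) * (e w z * e z z)

/-- The `z`-th row of matrix units of the homomorphic part of a Jordan homomorphism. -/
def row {n : ℕ} (e : Fin n → Fin n → R) (z w i : Fin n) : R :=
  if i = z then rowProj e z w else e z z * e z i

namespace JordanUnits

variable {n : ℕ} {e : Fin n → Fin n → R} (he : JordanUnits e) {z w : Fin n} (hw : w ≠ z)
include he

omit [Algebra ℂ R] in
theorem star_rowProj : star (rowProj e z w) = rowProj e z w := by
  simp [rowProj, he.star_eq, mul_assoc]

omit [Algebra ℂ R] in
theorem star_row_of_ne {i : Fin n} (hi : i ≠ z) : star (row e z w i) = e i z * e z z := by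
  simp [row, hi, he.star_eq]

include hw

theorem rowProj_mul_row (i : Fin n) : rowProj e z w * row e z w i = row e z w i := by
  by_cases hi : i = z
  · simp only [row, hi, if_true, rowProj]
    rw [← mul_assoc, he.proj_mul_row hw]
  · simp only [row, hi, if_false, rowProj]
    rw [he.row_mul_col hw hi, he.proj_mul_row hi]

/-- These relations make `E i j ↦ star (r i) * r j` multiplicative. If exactly one index is `z`, the
product vanishes because `e z z` compresses off-diagonal units to zero. -/
theorem row_mul_star_row (j k : Fin n) :
    row e z w j * star (row e z w k) = if j = k then rowProj e z w else 0 := by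
  have key : ∀ i, i ≠ z → rowProj e z w * star (row e z w i) = 0 := fun i hi => by
    rw [he.star_row_of_ne hi, rowProj, mul_assoc, mul_assoc (e w z), ← mul_assoc (e z z) (e i z),
      he.corner' hi.symm, mul_zero, mul_zero]
  by_cases hj : j = z
  · subst hj
    by_cases hk : k = j
    · subst hk
      have h := he.rowProj_mul_row hw k
      simp only [row, if_true] at h ⊢
      rw [he.star_rowProj, h]
    · rw [if_neg (Ne.symm hk)]
      have : row e j w j = rowProj e j w := if_pos rfl
      rw [this, key k hk]
  · by_cases hk : k = z
    · subst hk
      rw [if_neg hj]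
      have h : row e k w k = rowProj e k w := if_pos rfl
      have := congrArg star (key j hj)
      rw [h, he.star_rowProj]
      simpa [he.star_rowProj] using this
    · rw [he.star_row_of_ne hk, row, if_neg hj]
      by_cases hjk : j = k
      · subst hjk
        rw [if_pos rfl, rowProj, he.row_mul_col hw hj]
      · rw [if_neg hjk, he.row_mul_row_of_ne hj hjk]

/-- Compressing the anticommutator of `e z w` and `e w z` by `e z z` splits the diagonal unit into
its homomorphic and its antihomomorphic part; the latter is the row projection of the transposed
units. -/
theorem rowProj_add : rowProj e z w + rowProj (fun i j => e j i) z w = e z z := by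
  have h0 : e z w * e w z + e w z * e z w = e z z + e w w := by simpa using he.jordan z w w z
  have h1 : e z z * (e z w * e w z + e w z * e z w) * e z z = e z z := by
    rw [h0, mul_add, he.sq, add_mul, he.sq, he.off_left hw.symm hw.symm, zero_mul, add_zero]
  rw [mul_add, add_mul] at h1
  simp only [rowProj]
  simpa only [mul_assoc] using h1

/-- For `i, j ≠ z`, each product in the anticommutator of `e i z` and `e z j` splits into two terms
by inserting `e z z` on either side of its second factor. The terms with `e z z` in the middle are
the two summands claimed, and the others cancel. -/
theorem eq_row_add_row (i j : Fin n) :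
    e i j = star (row e z w i) * row e z w j +
      star (row (fun i j => e j i) z w j) * row (fun i j => e j i) z w i := by
  have hT := he.transpose
  have hrow0 : ∀ e : Fin n → Fin n → R, row e z w z = rowProj e z w := fun e => if_pos rfl
  have hrow : ∀ (e : Fin n → Fin n → R) {i}, i ≠ z → row e z w i = e z z * e z i :=
    fun e i hi => if_neg hi
  have hz : ∀ j, j ≠ z → e z j = star (row e z w z) * row e z w j +
      star (row (fun i j => e j i) z w j) * row (fun i j => e j i) z w z := fun j hj => by
    have h1 := congrArg star (hT.rowProj_mul_row hw j)
    rw [star_mul, hT.star_rowProj] at h1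
    rw [hrow0, hrow0, he.star_rowProj, he.rowProj_mul_row hw, h1, hrow e hj, hT.star_row_of_ne hj,
      he.left hj.symm]
  by_cases hi : i = z
  · subst hi
    by_cases hj : j = i
    · subst hj
      have h1 := he.rowProj_mul_row hw j
      have h2 := hT.rowProj_mul_row hw j
      rw [hrow0] at h1 h2
      rw [hrow0, hrow0, he.star_rowProj, hT.star_rowProj, h1, h2, he.rowProj_add hw]
    · exact hz j hj
  · by_cases hj : j = z
    · subst hj
      have h := congrArg star (hz i hi)
      simpa [he.star_eq] using h
    · rw [he.star_row_of_ne hi, hT.star_row_of_ne hj, hrow e hj, hrow _ hi]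
      have h1 : e i z * e z j + e z j * e i z = (if i = j then e z z else 0) + e i j := by
        rw [he.jordan, if_pos rfl, add_comm]
        simp only [eq_comm]
      -- Right multiplication by `e z z` kills `e i j` and so evaluates exactly the two unwanted
      -- terms.
      have h2 := congrArg (· * e z z) h1
      simp only [add_mul, mul_assoc] at h2
      rw [he.off_right (Ne.symm hi) (Ne.symm hj), add_zero] at h2
      have h3 : e i z * e z j = e i z * (e z z * e z j) + e i z * (e z j * e z z) := by
        rw [← mul_add, he.left (Ne.symm hj)]
      have h4 : e z j * e i z = e z j * (e z z * e i z) + e z j * (e i z * e z z) := by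
        rw [← mul_add]
        exact congrArg (e z j * ·) (he.right hi).symm
      have h5 : (if i = j then e z z else 0) * e z z = if i = j then e z z else 0 := by
        split_ifs
        · exact he.sq z
        · exact zero_mul _
      rw [h3, h4] at h1
      rw [h5] at h2
      simp only [mul_assoc]
      rw [← mul_assoc (e z z) (e z z), he.sq, ← mul_assoc (e z z) (e z z), he.sq]
      have h6 : e i j = (e i z * (e z z * e z j) + e i z * (e z j * e z z)
          + (e z j * (e z z * e i z) + e z j * (e i z * e z z)))
          - (e i z * (e z j * e z z) + e z j * (e i z * e z z)) := by
        rw [h1, h2]; abel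
      rw [h6]; abel

end JordanUnits

/-- The linear map on matrices that sends the matrix unit `E i j` to `star (r i) * r j`. -/
def rowMap {n : ℕ} (r : Fin n → R) : Matrix (Fin n) (Fin n) ℂ →ₗ[ℂ] R where
  toFun X := ∑ i, ∑ j, X i j • (star (r i) * r j)
  map_add' X Y := by simp [add_smul, Finset.sum_add_distrib]
  map_smul' c X := by simp [Finset.smul_sum, smul_smul]

theorem rowMap_single {n : ℕ} (r : Fin n → R) (i j : Fin n) :
    rowMap r (Matrix.single i j 1) = star (r i) * r j := by
  simp [rowMap, Matrix.single_apply, ite_and, ite_smul]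

/-- The inner product of two middle rows collapses to `p`, which acts as a left unit on rows. -/
theorem rowMap_mul {n : ℕ} {r : Fin n → R} {p : R}
    (h : ∀ j k, r j * star (r k) = if j = k then p else 0) (hp : ∀ l, p * r l = r l)
    (X Y : Matrix (Fin n) (Fin n) ℂ) : rowMap r (X * Y) = rowMap r X * rowMap r Y := by
  have key : ∀ i j k l, (star (r i) * r j) * (star (r k) * r l) =
      if j = k then star (r i) * r l else 0 := fun i j k l => by
    rw [mul_assoc, ← mul_assoc (r j), h]
    split_ifs
    · rw [hp]
    · simp
  simp only [rowMap, LinearMap.coe_mk, AddHom.coe_mk, Matrix.mul_apply, Finset.sum_smul]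
  rw [Finset.sum_mul]
  refine Finset.sum_congr rfl fun i _ => ?_
  rw [Finset.sum_mul, Finset.sum_comm]
  refine Finset.sum_congr rfl fun j _ => ?_
  simp_rw [Finset.mul_sum, smul_mul_smul_comm, key]
  rw [Finset.sum_comm]
  refine Finset.sum_congr rfl fun l _ => ?_
  simp

theorem rowMap_star [StarModule ℂ R] {n : ℕ} (r : Fin n → R) (X : Matrix (Fin n) (Fin n) ℂ) :
    rowMap r (star X) = star (rowMap r X) := by
  simp only [rowMap, LinearMap.coe_mk, AddHom.coe_mk, star_sum, star_smul, star_mul, star_star,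
    Matrix.star_apply]
  exact Finset.sum_comm

variable [StarModule ℂ R]

/-- A Jordan homomorphism of a matrix algebra is the sum of an antihomomorphism and a
homomorphism. -/
theorem exists_antihom_add_hom {n : ℕ} (π : Matrix (Fin n) (Fin n) ℂ →ₗ[ℂ] R)
    (hj : ∀ X Y, π (X * Y) + π (Y * X) = π X * π Y + π Y * π X) (hs : ∀ X, π (star X) = star (π X))
    (𝒮 : StarSubalgebra ℂ R) (h𝒮 : ∀ X, π X ∈ 𝒮) :
    ∃ α β : Matrix (Fin n) (Fin n) ℂ →ₗ[ℂ] R, (∀ X, π X = α X + β X) ∧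
      (∀ X Y, α (X * Y) = α Y * α X) ∧ (∀ X Y, β (X * Y) = β X * β Y) ∧
      (∀ X, α (star X) = star (α X)) ∧ (∀ X, β (star X) = star (β X)) ∧
      (∀ X, α X ∈ 𝒮) ∧ (∀ X, β X ∈ 𝒮) := by
  -- The rows need two distinct indices. For `n ≤ 1` the matrix algebra is commutative and `π` is
  -- already an antihomomorphism.
  rcases le_or_gt n 1 with hn | hn
  · have : Subsingleton (Fin n) := Fin.subsingleton_iff_le_one.2 hn
    have hc : ∀ X Y : Matrix (Fin n) (Fin n) ℂ, X * Y = Y * X := fun X Y => by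
      ext i k
      rw [Matrix.mul_apply, Matrix.mul_apply]
      refine Finset.sum_congr rfl fun j _ => ?_
      rw [Subsingleton.elim j i, Subsingleton.elim k i, mul_comm]
    have hπ : ∀ X Y, π X * π Y = π Y * π X := fun X Y => by
      rcases isEmpty_or_nonempty (Fin n) with h | ⟨⟨i⟩⟩
      · rw [Subsingleton.elim X Y]
      · have hX : ∀ X : Matrix (Fin n) (Fin n) ℂ, X = X i i • 1 := fun X => by
          ext a b
          rw [Subsingleton.elim a i, Subsingleton.elim b i]; simp
        rw [hX X, hX Y, map_smul, map_smul, smul_mul_smul_comm, smul_mul_smul_comm, mul_comm]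
    refine ⟨π, 0, fun X => by simp, fun X Y => ?_, by simp, hs, by simp, h𝒮, fun X => 𝒮.zero_mem⟩
    have := hj X Y
    rw [hc Y X, hπ X Y] at this
    exact JordanUnits.eq_of_add_self this
  · let z : Fin n := ⟨0, by omega⟩
    let w : Fin n := ⟨1, hn⟩
    have hw : w ≠ z := by simp [w, z]
    set e : Fin n → Fin n → R := fun i j => π (Matrix.single i j 1) with he_def
    have he : JordanUnits e :=
      { jordan := fun i j k l => by
          have key : ∀ i j k l, π (Matrix.single i j (1 : ℂ) * Matrix.single k l 1)
              = if j = k then e i l else 0 := fun i j k l => by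
            split_ifs with h
            · subst h; simp [he_def]
            · rw [Matrix.single_mul_single_of_ne _ _ _ _ h, map_zero]
          have := hj (Matrix.single i j 1) (Matrix.single k l 1)
          rw [key, key] at this
          exact this.symm
        star_eq := fun i j => by
          rw [he_def, ← hs, Matrix.star_eq_conjTranspose]
          simp [Matrix.conjTranspose_single] }
    have hT := he.transpose
    have hrow : ∀ e : Fin n → Fin n → R, (∀ i j, e i j ∈ 𝒮) → ∀ i, row e z w i ∈ 𝒮 :=
      fun e he i => by
        unfold row rowProj
        split_ifs
        · exact mul_mem (mul_mem (he _ _) (he _ _)) (mul_mem (he _ _) (he _ _))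
        · exact mul_mem (he _ _) (he _ _)
    have hmap : ∀ r : Fin n → R, (∀ i, r i ∈ 𝒮) → ∀ X, rowMap r X ∈ 𝒮 := fun r hr X =>
      show ∑ i, ∑ j, X i j • (star (r i) * r j) ∈ 𝒮 from sum_mem fun i _ => sum_mem fun j _ =>
        𝒮.smul_mem (mul_mem (star_mem (hr i)) (hr j)) _
    let T : Matrix (Fin n) (Fin n) ℂ →ₗ[ℂ] Matrix (Fin n) (Fin n) ℂ :=
      (Matrix.transposeLinearEquiv (Fin n) (Fin n) ℂ ℂ).toLinearMap
    have hTX : ∀ X, T X = X.transpose := fun X => rfl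
    -- The antihomomorphic part is the same construction for the transposed units, precomposed with
    -- transposition. Both parts are polynomials in the images of `π`, so they stay in `𝒮`.
    refine ⟨rowMap (row (fun i j => e j i) z w) ∘ₗ T, rowMap (row e z w), fun X => ?_,
      fun X Y => ?_, rowMap_mul (he.row_mul_star_row hw) (he.rowProj_mul_row hw), fun X => ?_,
      rowMap_star _, fun X => hmap _ (hrow _ fun i j => h𝒮 _) _, hmap _ (hrow _ fun i j => h𝒮 _)⟩
    · have : π = rowMap (row (fun i j => e j i) z w) ∘ₗ T + rowMap (row e z w) := by
        refine Matrix.ext_linearMap _ fun i j => ?_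
        ext
        simp only [LinearMap.comp_apply, LinearMap.add_apply, Matrix.singleLinearMap_apply, hTX,
          Matrix.transpose_single, rowMap_single]
        rw [add_comm]
        exact he.eq_row_add_row hw i j
      exact congrArg (· X) this
    · simp only [LinearMap.comp_apply, hTX, Matrix.transpose_mul]
      exact rowMap_mul (hT.row_mul_star_row hw) (hT.rowProj_mul_row hw) _ _
    · simp only [LinearMap.comp_apply, hTX]
      rw [← rowMap_star]
      rfl

end JordanUnits

/-! ### Mirrored operators -/

namespace LocalRep

section Single

variable {N : ℕ} {𝔸 : Fin N → Type*} [∀ j, Ring (𝔸 j)] [∀ j, StarRing (𝔸 j)]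
  [∀ j, Algebra ℂ (𝔸 j)] {H : Type*} [NormedAddCommGroup H] [InnerProductSpace ℂ H]
  [CompleteSpace H] (L : LocalRep 𝔸 H)

/-- The representation of the algebra of one party. -/
def single (j : Fin N) : 𝔸 j →ₗ[ℂ] (H →L[ℂ] H) := L.op.toLinearMap 1 j

theorem single_eq (j : Fin N) (s : 𝔸 j) : L.single j s = L.op (Pi.mulSingle j s) := rfl

theorem single_one (j : Fin N) : L.single j 1 = 1 := by
  rw [single_eq, Pi.mulSingle_one, L.op_one]

theorem single_mul (j : Fin N) (s t : 𝔸 j) : L.single j (s * t) = L.single j s * L.single j t := by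
  rw [single_eq, Pi.mulSingle_mul, L.op_mul]; rfl

theorem single_star (j : Fin N) (s : 𝔸 j) : L.single j (star s) = star (L.single j s) := by
  rw [single_eq, single_eq, ← L.op_star]
  congr 1
  ext1 k
  rcases eq_or_ne k j with rfl | h
  · simp
  · simp [h]

theorem op_mul_apply (S T : ∀ j, 𝔸 j) (v : H) : L.op (S * T) v = L.op S (L.op T v) := by
  rw [L.op_mul]; rfl

theorem inner_op_left (S : ∀ j, 𝔸 j) (v w : H) :
    inner ℂ (L.op S v) w = inner ℂ v (L.op (star S) w) := by
  rw [L.op_star, ContinuousLinearMap.star_eq_adjoint, ContinuousLinearMap.adjoint_inner_right]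

theorem inner_single_left (j : Fin N) (s : 𝔸 j) (v w : H) :
    inner ℂ (L.single j s v) w = inner ℂ v (L.single j (star s) w) := by
  rw [L.single_star, ContinuousLinearMap.star_eq_adjoint, ContinuousLinearMap.adjoint_inner_right]

end Single

section Mirror

variable {N : ℕ} {𝔸 𝔹 : Fin N → Type*} [∀ j, Ring (𝔸 j)] [∀ j, StarRing (𝔸 j)]
  [∀ j, Algebra ℂ (𝔸 j)] [∀ j, Ring (𝔹 j)] [∀ j, StarRing (𝔹 j)] [∀ j, Algebra ℂ (𝔹 j)]
  {H : Type*} [NormedAddCommGroup H] [InnerProductSpace ℂ H] [CompleteSpace H]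

/-- The operators `s` and `t` act in the same way on `Ψ`, and so do their adjoints. -/
structure Mirror (L : LocalRep 𝔸 H) (M : LocalRep 𝔹 H) (Ψ : H) (j : Fin N) (s : 𝔸 j) (t : 𝔹 j) :
    Prop where
  eq : L.single j s Ψ = M.single j t Ψ
  star_eq : L.single j (star s) Ψ = M.single j (star t) Ψ

variable {L : LocalRep 𝔸 H} {M : LocalRep 𝔹 H} (hc : ∀ S T, Commute (L.op S) (M.op T)) {Ψ : H}

include hc in
theorem comm_apply (S : ∀ j, 𝔸 j) (T : ∀ j, 𝔹 j) (v : H) :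
    L.op S (M.op T v) = M.op T (L.op S v) :=
  congrArg (· v) (hc S T).eq

include hc in
theorem single_comm_apply (j k : Fin N) (s : 𝔸 j) (t : 𝔹 k) (v : H) :
    L.single j s (M.single k t v) = M.single k t (L.single j s v) :=
  comm_apply hc _ _ v

-- On `Ψ` the inner operator is traded for its mirror image, which commutes with the outer one. Then
-- the outer one is traded as well, so the order is reversed.
include hc in
theorem mirror_mul {j : Fin N} {s s' : 𝔸 j} {t t' : 𝔹 j}
    (h : L.single j s Ψ = M.single j t Ψ) (h' : L.single j s' Ψ = M.single j t' Ψ) :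
    L.single j (s * s') Ψ = M.single j (t' * t) Ψ := by
  rw [L.single_mul, M.single_mul]
  change L.single j s (L.single j s' Ψ) = M.single j t' (M.single j t Ψ)
  rw [h', single_comm_apply hc, h]

variable (L M Ψ) in
/-- The operators of the `j`-th main party that are mirrored by the `j`-th auxiliary party. -/
def mirrorAlg [∀ j, StarModule ℂ (𝔸 j)] [∀ j, StarModule ℂ (𝔹 j)] (j : Fin N) :
    StarSubalgebra ℂ (𝔸 j) where
  carrier := {s | ∃ t, Mirror L M Ψ j s t}
  mul_mem' := by
    rintro s s' ⟨t, h⟩ ⟨t', h'⟩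
    refine ⟨t' * t, mirror_mul hc h.eq h'.eq, ?_⟩
    rw [star_mul, star_mul]
    exact mirror_mul hc h'.star_eq h.star_eq
  add_mem' := by
    rintro s s' ⟨t, h⟩ ⟨t', h'⟩
    refine ⟨t + t', ?_, ?_⟩
    · rw [map_add, map_add, _root_.add_apply, _root_.add_apply, h.eq, h'.eq]
    · rw [star_add, star_add, map_add, map_add, _root_.add_apply,
        _root_.add_apply, h.star_eq, h'.star_eq]
  algebraMap_mem' c := by
    refine ⟨algebraMap ℂ _ c, ?_, ?_⟩
    · rw [Algebra.algebraMap_eq_smul_one, Algebra.algebraMap_eq_smul_one, map_smul, map_smul,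
        L.single_one, M.single_one]
    · rw [Algebra.algebraMap_eq_smul_one, Algebra.algebraMap_eq_smul_one, star_smul, star_smul,
        star_one, star_one, map_smul, map_smul, L.single_one, M.single_one]
  star_mem' := by
    rintro s ⟨t, h⟩
    refine ⟨star t, h.star_eq, ?_⟩
    rw [star_star, star_star]
    exact h.eq

theorem pi_insert_eq_mul {𝕄 : Fin N → Type*} [∀ j, Monoid (𝕄 j)] (S : ∀ j, 𝕄 j)
    {p : Fin N} {s : Finset (Fin N)} (hp : p ∉ s) :
    (fun j => if j ∈ insert p s then S j else 1) =
        Pi.mulSingle p (S p) * (fun j => if j ∈ s then S j else 1) ∧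
      (fun j => if j ∈ insert p s then S j else 1) =
        (fun j => if j ∈ s then S j else 1) * Pi.mulSingle p (S p) := by
  constructor <;>
  · ext1 q
    rcases eq_or_ne q p with rfl | h
    · simp [hp]
    · simp [h]

theorem single_mul_op {L : LocalRep 𝔸 H} (j : Fin N) (s : 𝔸 j) (S : ∀ j, 𝔸 j) (v : H) :
    L.op (Pi.mulSingle j s * S) v = L.single j s (L.op S v) :=
  L.op_mul_apply _ _ v

theorem op_mul_single {L : LocalRep 𝔸 H} (j : Fin N) (s : 𝔸 j) (S : ∀ j, 𝔸 j) (v : H) :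
    L.op (S * Pi.mulSingle j s) v = L.op S (L.single j s v) :=
  L.op_mul_apply _ _ v

include hc in
theorem op_eq_of_single_eq {S : ∀ j, 𝔸 j} {T : ∀ j, 𝔹 j}
    (h : ∀ j, L.single j (S j) Ψ = M.single j (T j) Ψ) : L.op S Ψ = M.op T Ψ := by
  have key : ∀ s : Finset (Fin N), L.op (fun j => if j ∈ s then S j else 1) Ψ =
      M.op (fun j => if j ∈ s then T j else 1) Ψ := by
    intro s
    induction s using Finset.induction_on with
    | empty => exact (congrArg (· Ψ) L.op_one).trans (congrArg (· Ψ) M.op_one).symm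
    | insert p s hp ih =>
      rw [(pi_insert_eq_mul S hp).1, (pi_insert_eq_mul T hp).2, single_mul_op, op_mul_single, ih, ← h, single_eq,
        comm_apply hc]
  simpa using key Finset.univ

include hc in
/-- Mirrored operators satisfy a trace property. -/
theorem inner_op_mul_op_mul {Q S S' : ∀ j, 𝔸 j} (hQ : star Q * Q = Q)
    (hS : ∀ j, ∃ t, Mirror L M Ψ j (S j) t) :
    inner ℂ (L.op (Q * S) Ψ) (L.op (Q * S') Ψ) = inner ℂ Ψ (L.op (Q * (S' * star S)) Ψ) := by
  choose T hT using hS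
  -- The left factor `S` goes over to the auxiliary side, is moved across the inner product as `star
  -- T`, and comes back as `star S` on the other side of `S'`.
  have h1 : L.op S Ψ = M.op T Ψ := op_eq_of_single_eq hc fun j => (hT j).eq
  have h2 : L.op (star S) Ψ = M.op (star T) Ψ := op_eq_of_single_eq hc fun j => (hT j).star_eq
  rw [op_mul_apply, op_mul_apply, inner_op_left, ← op_mul_apply, ← op_mul_apply, ← mul_assoc, hQ,
    h1, M.inner_op_left, ← comm_apply hc, ← h2, ← op_mul_apply, mul_assoc]

/-- `P` is the projection onto the support of the reduced state of the `j`-th party. -/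
structure IsSupport (L : LocalRep 𝔸 H) (Ψ : H) (j : Fin N) (P : 𝔸 j) : Prop where
  proj : IsStarProjection P
  apply_eq : L.single j P Ψ = Ψ
  mul_eq_zero : ∀ s, L.single j s Ψ = 0 → s * P = 0

theorem IsSupport.mul_eq {j : Fin N} {P : 𝔸 j} (hP : IsSupport L Ψ j P) {s t : 𝔸 j}
    (h : L.single j s Ψ = L.single j t Ψ) : s * P = t * P := by
  rw [← sub_eq_zero, ← sub_mul]
  exact hP.mul_eq_zero _ (by rw [map_sub, _root_.sub_apply, h, sub_self])

theorem IsSupport.single_mul {j : Fin N} {P : 𝔸 j} (hP : IsSupport L Ψ j P) (s : 𝔸 j) :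
    L.single j (s * P) Ψ = L.single j s Ψ := by
  rw [LocalRep.single_mul]
  exact congrArg (L.single j s) hP.apply_eq

-- If `s` acts on `Ψ` like an operator of the auxiliary party, then `s Ψ` is again fixed by `P`, so
-- `P s P = s P`. The same for `star s`, after taking adjoints, gives `P s P = P s`.
include hc in
theorem IsSupport.commute {j : Fin N} {P : 𝔸 j} (hP : IsSupport L Ψ j P) {s : 𝔸 j}
    (hs : ∃ t, Mirror L M Ψ j s t) : s * P = P * s := by
  have key : ∀ s : 𝔸 j, (∃ t, L.single j s Ψ = M.single j t Ψ) → P * s * P = s * P := by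
    rintro s ⟨t, h⟩
    refine hP.mul_eq ?_
    rw [LocalRep.single_mul]
    change L.single j P (L.single j s Ψ) = _
    rw [h, single_comm_apply hc, hP.apply_eq]
  obtain ⟨t, h⟩ := hs
  have h1 := key s ⟨t, h.eq⟩
  have h2 := congrArg star (key (star s) ⟨star t, h.star_eq⟩)
  have hs : star P = P := hP.proj.isSelfAdjoint
  simp only [star_mul, star_star, hs] at h2
  rw [← h1, mul_assoc, h2]

theorem IsSupport.mirror {j : Fin N} {P : 𝔸 j} (hP : IsSupport L Ψ j P) : Mirror L M Ψ j P 1 := by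
  have h : L.single j P Ψ = M.single j 1 Ψ := by
    rw [hP.apply_eq, M.single_one]; rfl
  refine ⟨h, ?_⟩
  rw [star_one]
  rwa [show star P = P from hP.proj.isSelfAdjoint]

end Mirror

end LocalRep

/-! ### The functional equation of the extracted vectors -/

section Equality

/-- The index that agrees with `i` where the flag `g` is `0`, and with `k` elsewhere. -/
def mix {P : Type*} {d : P → Type*} (g : P → Fin 2) (i k : ∀ p, d p) : ∀ p, d p :=
  fun p => if g p = 0 then i p else k p

theorem mix_mix {P : Type*} {d : P → Type*} (g : P → Fin 2) (i k : ∀ p, d p) :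
    mix g (mix g i k) (mix g k i) = i := by
  funext p
  simp only [mix]
  split_ifs <;> rfl

/-- The exchange of the parts of two indices where the flag is `1`. -/
def mixEquiv {P : Type*} {d : P → Type*} (g : P → Fin 2) :
    (∀ p, d p) × (∀ p, d p) ≃ (∀ p, d p) × (∀ p, d p) where
  toFun x := (mix g x.1 x.2, mix g x.2 x.1)
  invFun x := (mix g x.1 x.2, mix g x.2 x.1)
  left_inv x := by simp [mix_mix]
  right_inv x := by simp [mix_mix]

/-- The partial transpose of the projector `|ψ⟩⟨ψ|` for the parties with flag `1`. -/
def partialTranspose {P : Type*} {d : P → Type*} (ψ : (∀ p, d p) → ℂ) (g : P → Fin 2)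
    (i k : ∀ p, d p) : ℂ :=
  ψ (mix g i k) * conj (ψ (mix g k i))

variable {H : Type*} [NormedAddCommGroup H] [InnerProductSpace ℂ H]

/-- The square is expanded, and the term quadratic in `T` is at most `∑ ‖V i‖ ^ 2` by
Cauchy–Schwarz, since the Frobenius norm of `T` is at most one. -/
theorem sum_norm_sub_sq_le {I : Type*} [Fintype I] (T : I → I → ℂ)
    (hT : ∑ i, ∑ k, ‖T i k‖ ^ 2 ≤ 1) (V : I → H) :
    ∑ i, ‖V i - ∑ k, T i k • V k‖ ^ 2 ≤
      2 * ∑ i, ‖V i‖ ^ 2 - 2 * (∑ i, ∑ k, T i k * inner ℂ (V i) (V k)).re := by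
  have h1 : ∀ i, ‖∑ k, T i k • V k‖ ^ 2 ≤ (∑ k, ‖T i k‖ ^ 2) * ∑ k, ‖V k‖ ^ 2 := fun i =>
    calc ‖∑ k, T i k • V k‖ ^ 2 ≤ (∑ k, ‖T i k‖ * ‖V k‖) ^ 2 := by
          gcongr
          exact (norm_sum_le _ _).trans_eq (by simp [norm_smul])
      _ ≤ _ := Finset.sum_mul_sq_le_sq_mul_sq _ _ _
  have h2 : ∑ i, ‖∑ k, T i k • V k‖ ^ 2 ≤ ∑ k, ‖V k‖ ^ 2 :=
    calc _ ≤ ∑ i, (∑ k, ‖T i k‖ ^ 2) * ∑ k, ‖V k‖ ^ 2 := Finset.sum_le_sum fun i _ => h1 i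
      _ = (∑ i, ∑ k, ‖T i k‖ ^ 2) * ∑ k, ‖V k‖ ^ 2 := by rw [Finset.sum_mul]
      _ ≤ _ := mul_le_of_le_one_left (Finset.sum_nonneg fun _ _ => by positivity) hT
  have h3 : ∀ i, ‖V i - ∑ k, T i k • V k‖ ^ 2 =
      ‖V i‖ ^ 2 - 2 * (∑ k, T i k * inner ℂ (V i) (V k)).re + ‖∑ k, T i k • V k‖ ^ 2 := fun i => by
    rw [@norm_sub_sq ℂ, inner_sum]
    simp [inner_smul_right]
  simp_rw [h3, Finset.sum_add_distrib, Finset.sum_sub_distrib, ← Finset.mul_sum, ← Complex.re_sum]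
  linarith

/-- A partial transposition only permutes matrix entries, so the Frobenius norm is that of the
projector onto `ψ`. -/
theorem sum_partialTranspose_norm {P : Type*} {d : P → Type*} [Fintype (∀ p, d p)]
    {ψ : (∀ p, d p) → ℂ} (hψ : ∑ i, ‖ψ i‖ ^ 2 = 1) (g : P → Fin 2) :
    ∑ i, ∑ k, ‖partialTranspose ψ g i k‖ ^ 2 = 1 := by
  rw [← Fintype.sum_prod_type' fun i k => ‖partialTranspose ψ g i k‖ ^ 2]
  calc ∑ x : (∀ p, d p) × (∀ p, d p), ‖partialTranspose ψ g x.1 x.2‖ ^ 2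
      = ∑ x : (∀ p, d p) × (∀ p, d p), ‖ψ x.1‖ ^ 2 * ‖ψ x.2‖ ^ 2 := by
        rw [← (mixEquiv g).sum_comp]
        refine Finset.sum_congr rfl fun x _ => ?_
        simp [mixEquiv, partialTranspose, mix_mix, mul_pow]
    _ = 1 := by
        rw [Fintype.sum_prod_type]
        change ∑ x, ∑ y, ‖ψ x‖ ^ 2 * ‖ψ y‖ ^ 2 = 1
        rw [← Fintype.sum_mul_sum, hψ, one_mul]

/-- Vectors whose Gram matrices sum, after partial transpositions, to the projector onto a unit
vector `ψ`, are fixed by the partial transposes of that projector. -/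
theorem eq_partialTranspose_sum {P : Type*} [Fintype P] [DecidableEq P] {d : P → Type*}
    [∀ p, Fintype (d p)] {ψ : (∀ p, d p) → ℂ}
    (hψ : ∑ i, ‖ψ i‖ ^ 2 = 1) {C : Type*} [Fintype C] (V : (P → Fin 2) → C → (∀ p, d p) → H)
    (hV : ∑ g, ∑ c, ∑ i, ‖V g c i‖ ^ 2 ≤ 1)
    (hG : ∀ i k, ∑ g, ∑ c, inner ℂ (V g c (mix g i k)) (V g c (mix g k i)) = conj (ψ i) * ψ k) :
    (∀ g c i, V g c i = ∑ k, partialTranspose ψ g i k • V g c k) ∧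
      ∑ g, ∑ c, ∑ i, ‖V g c i‖ ^ 2 = 1 := by
  -- Exchanging the indices where the flag is `1` undoes the partial transposes, for all flags at
  -- once, and leaves the sum evaluated by `hG`.
  have h1 : ∑ g, ∑ c, ∑ i, ∑ k, partialTranspose ψ g i k * inner ℂ (V g c i) (V g c k) = 1 := by
    have e : ∀ g c, ∑ i, ∑ k, partialTranspose ψ g i k * inner ℂ (V g c i) (V g c k) =
        ∑ i, ∑ k, ψ i * conj (ψ k) * inner ℂ (V g c (mix g i k)) (V g c (mix g k i)) := by
      intro g c
      rw [← Fintype.sum_prod_type' fun i k => partialTranspose ψ g i k * inner ℂ (V g c i) (V g c k),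
        ← (mixEquiv g).sum_comp, Fintype.sum_prod_type]
      simp [mixEquiv, partialTranspose, mix_mix]
    simp_rw [e]
    calc _ = ∑ i, ∑ k, ψ i * conj (ψ k) *
          ∑ g, ∑ c, inner ℂ (V g c (mix g i k)) (V g c (mix g k i)) := by
          simp_rw [Finset.mul_sum]
          have e2 : ∀ (F : (P → Fin 2) → C → (∀ p, d p) → (∀ p, d p) → ℂ),
              ∑ g, ∑ c, ∑ i, ∑ k, F g c i k = ∑ i, ∑ k, ∑ g, ∑ c, F g c i k := fun F => by
            rw [Finset.sum_congr rfl fun g _ => Finset.sum_comm, Finset.sum_comm]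
            refine Finset.sum_congr rfl fun i _ => ?_
            rw [Finset.sum_congr rfl fun g _ => Finset.sum_comm, Finset.sum_comm]
          exact e2 _
      _ = ∑ i, ∑ k, ((‖ψ i‖ ^ 2 * ‖ψ k‖ ^ 2 : ℝ) : ℂ) := by
          refine Finset.sum_congr rfl fun i _ => Finset.sum_congr rfl fun k _ => ?_
          rw [hG]
          push_cast
          rw [← Complex.mul_conj', ← Complex.mul_conj']
          ring
      _ = 1 := by
          rw [← Complex.ofReal_one]
          simp_rw [← Complex.ofReal_sum]
          rw [← Fintype.sum_mul_sum, hψ, one_mul]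
  have h2 : ∑ g, ∑ c, ∑ i, ‖V g c i - ∑ k, partialTranspose ψ g i k • V g c k‖ ^ 2 ≤
      2 * ∑ g, ∑ c, ∑ i, ‖V g c i‖ ^ 2 - 2 := by
    calc _ ≤ ∑ g, ∑ c, (2 * ∑ i, ‖V g c i‖ ^ 2 -
          2 * (∑ i, ∑ k, partialTranspose ψ g i k * inner ℂ (V g c i) (V g c k)).re) :=
          Finset.sum_le_sum fun g _ => Finset.sum_le_sum fun c _ =>
            sum_norm_sub_sq_le _ (sum_partialTranspose_norm hψ g).le _
      _ = _ := by
          simp_rw [Finset.sum_sub_distrib, ← Finset.mul_sum, ← Complex.re_sum]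
          rw [h1]; simp
  -- The bound in `h2` is nonpositive by `hV`. It also shows that the total squared norm cannot fall
  -- below one.
  have h3 : ∑ g, ∑ c, ∑ i, ‖V g c i - ∑ k, partialTranspose ψ g i k • V g c k‖ ^ 2 = 0 :=
    le_antisymm (by linarith) (by positivity)
  refine ⟨fun g c i => ?_, le_antisymm hV ?_⟩
  · rw [Finset.sum_eq_zero_iff_of_nonneg fun _ _ => by positivity] at h3
    have h4 := h3 g (Finset.mem_univ _)
    rw [Finset.sum_eq_zero_iff_of_nonneg fun _ _ => by positivity] at h4
    have h5 := h4 c (Finset.mem_univ _)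
    rw [Finset.sum_eq_zero_iff_of_nonneg fun _ _ => by positivity] at h5
    have h6 := h5 i (Finset.mem_univ _)
    rw [← sub_eq_zero]
    exact norm_eq_zero.1 (pow_eq_zero_iff two_ne_zero |>.1 h6)
  · linarith

end Equality

/-! ### Kraus operators of the local maps -/

section Kraus

variable {𝔸 : Type*} [Ring 𝔸] [StarRing 𝔸] [Algebra ℂ 𝔸]

/-- The data of one main party: a measurement `M`, correction unitaries `U`, and a real
representation `α + β` of a matrix algebra whose antihomomorphic part is `α` and whose
homomorphic part is `β`. -/
structure TeleportData (𝔸 : Type*) [Ring 𝔸] [StarRing 𝔸] [Algebra ℂ 𝔸] (d n : ℕ) (𝒜 : Type)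
    [Fintype 𝒜] where
  /-- the embedding of the system basis -/
  emb : Fin d → Fin n
  emb_injective : Function.Injective emb
  /-- the measurement -/
  M : 𝒜 → 𝔸
  M_proj : ∀ a, IsStarProjection (M a)
  M_sum : ∑ a, M a = 1
  /-- the correction unitaries -/
  U : 𝒜 → Matrix (Fin n) (Fin n) ℂ
  U_mul_star : ∀ a, U a * star (U a) = 1
  /-- the antihomomorphic part -/
  α : Matrix (Fin n) (Fin n) ℂ →ₗ[ℂ] 𝔸
  /-- the homomorphic part -/
  β : Matrix (Fin n) (Fin n) ℂ →ₗ[ℂ] 𝔸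
  α_mul : ∀ X Y, α (X * Y) = α Y * α X
  β_mul : ∀ X Y, β (X * Y) = β X * β Y
  α_star : ∀ X, α (star X) = star (α X)
  β_star : ∀ X, β (star X) = star (β X)
  proj : IsStarProjection (α 1 + β 1)

namespace TeleportData

variable {d n : ℕ} {𝒜 : Type} [Fintype 𝒜] (D : TeleportData 𝔸 d n 𝒜)

/-- The two parts of the representation, selected by the flag. -/
def part (g : Fin 2) : Matrix (Fin n) (Fin n) ℂ →ₗ[ℂ] 𝔸 := if g = 0 then D.α else D.β

/-- The matrix that is measured jointly with the system. -/
def probe (i : Fin n) (g : Fin 2) (c : 𝒜 × Fin n) : Matrix (Fin n) (Fin n) ℂ :=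
  if g = 0 then Matrix.single c.2 i 1 * star (D.U c.1) else D.U c.1 * Matrix.single i c.2 1

/-- The operator that moves the teleported system into the register. -/
def shift (i : Fin n) (g : Fin 2) (c : 𝒜 × Fin n) : 𝔸 :=
  (((√(n : ℝ))⁻¹ : ℝ) : ℂ) • D.part g (D.probe i g c)

/-- The matrix unit of the reference, conjugated by the correction. -/
def conjUnit (a : 𝒜) (i k : Fin n) : Matrix (Fin n) (Fin n) ℂ :=
  D.U a * Matrix.single i k 1 * star (D.U a)

/-- The Kraus operators. -/
def kraus (i : Fin n) (g : Fin 2) (c : 𝒜 × Fin n) : 𝔸 := D.M c.1 * D.shift i g c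

variable [StarModule ℂ 𝔸]

theorem sqrt_inv_mul_self (n : ℕ) :
    (((√(n : ℝ))⁻¹ : ℝ) : ℂ) * star (((√(n : ℝ))⁻¹ : ℝ) : ℂ) = (n : ℂ)⁻¹ := by
  rw [Complex.star_def, Complex.conj_ofReal, ← Complex.ofReal_mul, ← mul_inv,
    Real.mul_self_sqrt (Nat.cast_nonneg n)]
  simp

omit [StarModule ℂ 𝔸] in
theorem part_mul_star (g : Fin 2) (X Y : Matrix (Fin n) (Fin n) ℂ) :
    D.part g X * star (D.part g Y) = D.part g (if g = 0 then star Y * X else X * star Y) := by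
  unfold part
  split_ifs
  · rw [← D.α_star, D.α_mul]
  · rw [← D.β_star, D.β_mul]

/-- The inner index `l` disappears from each product of matrix units, so `n` equal terms cancel the
normalisation `1 / n`. The antihomomorphic part multiplies in the reverse order, which exchanges `i`
and `k`. -/
theorem sum_shift_mul_star (hn : n ≠ 0) (i k : Fin n) (g : Fin 2) (a : 𝒜) :
    ∑ l, D.shift k g (a, l) * star (D.shift i g (a, l)) =
      D.part g (if g = 0 then D.conjUnit a i k else D.conjUnit a k i) := by
  have h : ∀ l, D.shift k g (a, l) * star (D.shift i g (a, l)) =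
      (n : ℂ)⁻¹ • D.part g (if g = 0 then D.conjUnit a i k else D.conjUnit a k i) := fun l => by
    rw [shift, shift, star_smul, smul_mul_smul_comm, sqrt_inv_mul_self, part_mul_star]
    congr 2
    simp only [probe, conjUnit]
    split_ifs
    · rw [star_mul, star_star, Matrix.star_eq_conjTranspose (Matrix.single _ _ _),
        Matrix.conjTranspose_single, mul_assoc, ← mul_assoc (Matrix.single i l _),
        Matrix.single_mul_single_same]
      simp [mul_assoc]
    · rw [star_mul, Matrix.star_eq_conjTranspose (Matrix.single _ _ _),
        Matrix.conjTranspose_single, mul_assoc, ← mul_assoc (Matrix.single k l _),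
        Matrix.single_mul_single_same]
      simp [mul_assoc]
  simp_rw [h]
  rw [Finset.sum_const, Finset.card_univ, Fintype.card_fin, ← Nat.cast_smul_eq_nsmul ℂ, smul_smul,
    mul_inv_cancel₀ (Nat.cast_ne_zero.2 hn), one_smul]

/-- Conjugating the index of a family by a unitary matrix does not change the sum. -/
theorem sum_unitary_conj {w : Matrix (Fin n) (Fin n) ℂ} (hw : w * star w = 1) (M : 𝔸)
    (Z : Fin n → 𝔸) :
    ∑ i, star (∑ m, w m i • Z m) * M * ∑ m, w m i • Z m = ∑ m, star (Z m) * M * Z m := by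
  have hw' : ∀ m m', ∑ i, star (w m i) * w m' i = if m' = m then 1 else 0 := fun m m' => by
    have := congrArg (fun X => X m' m) hw
    simp only [Matrix.mul_apply, Matrix.star_apply, Matrix.one_apply] at this
    rw [← this]
    exact Finset.sum_congr rfl fun i _ => mul_comm _ _
  simp_rw [star_sum, Finset.sum_mul, Finset.mul_sum, star_smul, smul_mul_assoc, mul_smul_comm,
    smul_smul]
  rw [Finset.sum_comm]
  refine Finset.sum_congr rfl fun m _ => ?_
  rw [Finset.sum_comm]
  simp_rw [← Finset.sum_smul, hw', ite_smul, one_smul, zero_smul]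
  simp

/-- The matrix unit, or its transpose, selected by the flag. -/
def flagUnit (g : Fin 2) (l m : Fin n) : Matrix (Fin n) (Fin n) ℂ :=
  if g = 0 then Matrix.single l m 1 else Matrix.single m l 1

/-- The correction unitary, or its complex conjugate, selected by the flag. -/
def flagUnitary (g : Fin 2) (a : 𝒜) : Matrix (Fin n) (Fin n) ℂ :=
  if g = 0 then (star (D.U a)).transpose else D.U a

omit [StarModule ℂ 𝔸] in
theorem flagUnitary_mul_star (g : Fin 2) (a : 𝒜) :
    D.flagUnitary g a * star (D.flagUnitary g a) = 1 := by
  unfold flagUnitary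
  split_ifs
  · have h : star ((star (D.U a)).transpose) = (D.U a).transpose := by
      ext i j; simp [Matrix.star_apply]
    rw [h, ← Matrix.transpose_mul, D.U_mul_star, Matrix.transpose_one]
  · exact D.U_mul_star a

-- The correction only rotates the index `i` by a unitary matrix, so it drops out of any sum of
-- squares over all `i`.
omit [StarModule ℂ 𝔸] in
theorem probe_eq_sum (i : Fin n) (g : Fin 2) (a : 𝒜) (l : Fin n) :
    D.probe i g (a, l) = ∑ m, D.flagUnitary g a m i • flagUnit g l m := by
  ext x y
  unfold probe flagUnitary flagUnit
  split_ifs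
  · simp [Matrix.mul_apply, Matrix.sum_apply, Matrix.single_apply, ite_and]
  · simp [Matrix.mul_apply, Matrix.sum_apply, Matrix.single_apply, ite_and]

omit [StarModule ℂ 𝔸] in
theorem star_part_flagUnit (g : Fin 2) (l m : Fin n) :
    star (D.part g (flagUnit g l m)) * D.part g (flagUnit g l m) =
      D.part g (Matrix.single l l 1) := by
  unfold part flagUnit
  split_ifs
  · rw [← D.α_star, ← D.α_mul, Matrix.star_eq_conjTranspose, Matrix.conjTranspose_single,
      Matrix.single_mul_single_same]
    simp
  · rw [← D.β_star, ← D.β_mul, Matrix.star_eq_conjTranspose, Matrix.conjTranspose_single,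
      Matrix.single_mul_single_same]
    simp

theorem star_kraus_mul (i : Fin n) (g : Fin 2) (c : 𝒜 × Fin n) :
    star (D.kraus i g c) * D.kraus i g c =
      (n : ℂ)⁻¹ • (star (D.part g (D.probe i g c)) * D.M c.1 * D.part g (D.probe i g c)) := by
  have hM := D.M_proj c.1
  rw [kraus, star_mul, hM.isSelfAdjoint.star_eq, mul_assoc, ← mul_assoc (D.M c.1),
    hM.isIdempotentElem.eq, shift, star_smul, smul_mul_assoc, mul_smul_comm, mul_smul_comm,
    smul_smul, mul_comm (star _), sqrt_inv_mul_self, mul_assoc]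

/-- Summing over `i` removes the correction by `sum_unitary_conj`. The outcome then occurs only in
`M`, whose operators add to one, and what remains is the sum of the diagonal matrix units. -/
theorem sum_kraus (hn : n ≠ 0) (g : Fin 2) :
    ∑ i, ∑ c, star (D.kraus i g c) * D.kraus i g c = D.part g 1 := by
  simp_rw [star_kraus_mul]
  rw [Finset.sum_comm]
  have h1 : ∀ c : 𝒜 × Fin n, ∑ i, (n : ℂ)⁻¹ • (star (D.part g (D.probe i g c)) * D.M c.1 *
      D.part g (D.probe i g c)) = (n : ℂ)⁻¹ • ∑ m, star (D.part g (flagUnit g c.2 m)) *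
        D.M c.1 * D.part g (flagUnit g c.2 m) := fun ⟨a, l⟩ => by
    rw [← Finset.smul_sum]
    simp_rw [probe_eq_sum, map_sum, map_smul]
    exact congrArg _ (sum_unitary_conj (D.flagUnitary_mul_star g a) _ _)
  simp_rw [h1]
  rw [Fintype.sum_prod_type_right, ]
  have h2 : ∀ l : Fin n, ∑ a, (n : ℂ)⁻¹ • ∑ m, star (D.part g (flagUnit g l m)) *
        D.M a * D.part g (flagUnit g l m) = D.part g (Matrix.single l l 1) := fun l => by
    rw [← Finset.smul_sum, Finset.sum_comm]
    simp_rw [← Finset.sum_mul, ← Finset.mul_sum, D.M_sum, mul_one, star_part_flagUnit]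
    rw [Finset.sum_const, Finset.card_univ, Fintype.card_fin, ← Nat.cast_smul_eq_nsmul ℂ, smul_smul,
      inv_mul_cancel₀ (Nat.cast_ne_zero.2 hn), one_smul]
  simp_rw [h2]
  rw [← map_sum]
  congr 1
  ext x y
  simp [Matrix.sum_apply, Matrix.single_apply, Matrix.one_apply, ite_and]

/-- The embedded indices are only some of all `n` indices, and the full sum is the projection `α 1 +
β 1`. Hence an inequality, to be completed to an isometry later. -/
theorem sum_kraus_le [PartialOrder 𝔸] [StarOrderedRing 𝔸] (hn : n ≠ 0) :
    ∑ i : Fin d, ∑ g, ∑ c, star (D.kraus (D.emb i) g c) * D.kraus (D.emb i) g c ≤ 1 := by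
  have h1 : ∑ i, ∑ g, ∑ c, star (D.kraus i g c) * D.kraus i g c = D.α 1 + D.β 1 := by
    rw [Finset.sum_comm, Fin.sum_univ_two, D.sum_kraus hn, D.sum_kraus hn]
    rfl
  have h0 : ∀ i, 0 ≤ ∑ g, ∑ c, star (D.kraus i g c) * D.kraus i g c := fun i =>
    Finset.sum_nonneg fun g _ => Finset.sum_nonneg fun c _ => star_mul_self_nonneg _
  calc _ = ∑ i ∈ Finset.univ.map ⟨D.emb, D.emb_injective⟩,
        ∑ g, ∑ c, star (D.kraus i g c) * D.kraus i g c := by rw [Finset.sum_map]; rfl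
    _ ≤ ∑ i, ∑ g, ∑ c, star (D.kraus i g c) * D.kraus i g c :=
        Finset.sum_le_univ_sum_of_nonneg h0
    _ = D.α 1 + D.β 1 := h1
    _ ≤ 1 := D.proj.le_one

end TeleportData

end Kraus

/-! ### The vectors prepared by the Kraus operators -/

namespace LocalRep

section Vectors

variable {N : ℕ} {𝔸 𝔹 : Fin N → Type*} [∀ j, Ring (𝔸 j)] [∀ j, StarRing (𝔸 j)]
  [∀ j, Algebra ℂ (𝔸 j)] [∀ j, StarModule ℂ (𝔸 j)] [∀ j, Ring (𝔹 j)] [∀ j, StarRing (𝔹 j)]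
  [∀ j, Algebra ℂ (𝔹 j)] [∀ j, StarModule ℂ (𝔹 j)]
  {H : Type*} [NormedAddCommGroup H] [InnerProductSpace ℂ H] [CompleteSpace H]
  {L : LocalRep 𝔸 H} {M : LocalRep 𝔹 H} (hc : ∀ S T, Commute (L.op S) (M.op T)) {Ψ : H}
  {d n : Fin N → ℕ} {𝒜 : Fin N → Type} [∀ j, Fintype (𝒜 j)]
  (D : ∀ j, TeleportData (𝔸 j) (d j) (n j) (𝒜 j))

omit [∀ j, StarModule ℂ (𝔸 j)] in
theorem sum_norm_op_sq {Y : Fin N → Type*} [∀ j, Fintype (Y j)] (F : ∀ j, Y j → 𝔸 j)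
    (hF : ∀ j, ∑ y, star (F j y) * F j y = 1) (v : H) :
    ∑ y : ∀ j, Y j, ‖L.op (fun j => F j (y j)) v‖ ^ 2 = ‖v‖ ^ 2 := by
  have h : ∑ y : ∀ j, Y j, inner ℂ (L.op (fun j => F j (y j)) v) (L.op (fun j => F j (y j)) v) =
      inner ℂ v v := by
    simp_rw [inner_op_left, ← op_mul_apply, ← inner_sum, ← _root_.sum_apply]
    have := L.op.map_sum fun j y => star (F j y) * F j y
    simp_rw [hF] at this
    have h1 : L.op (fun _ => 1) = 1 := L.op_one
    rw [h1] at this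
    exact congrArg (fun T : H →L[ℂ] H => inner ℂ v (T v)) this.symm
  simp_rw [inner_self_eq_norm_sq_to_K] at h
  exact_mod_cast h

/-- The vector prepared by the Kraus operators of all main parties. -/
def krausVec (L : LocalRep 𝔸 H) (Ψ : H) (D : ∀ j, TeleportData (𝔸 j) (d j) (n j) (𝒜 j))
    (g : Fin N → Fin 2) (c : ∀ j, 𝒜 j × Fin (n j)) (i : ∀ j, Fin (d j)) : H :=
  L.op (fun j => (D j).kraus ((D j).emb (i j)) (g j) (c j)) Ψ

-- The trace property turns each inner product into an expectation value of `M` times a product of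
-- two shifts. The shifts with flag `0` and flag `1` exchange indices differently, and `mix`
-- compensates this: both flags contribute the same matrix, and the sum over flags restores `α + β`.
include hc in
theorem sum_inner_krausVec (hn : ∀ j, n j ≠ 0)
    (hα : ∀ j X, (D j).α X ∈ mirrorAlg L M hc Ψ j) (hβ : ∀ j X, (D j).β X ∈ mirrorAlg L M hc Ψ j)
    (i k : ∀ j, Fin (d j)) :
    ∑ g, ∑ c, inner ℂ (krausVec L Ψ D g c (mix g i k)) (krausVec L Ψ D g c (mix g k i)) =
      ∑ a : ∀ j, 𝒜 j, inner ℂ Ψ (L.op (fun j => (D j).M (a j) *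
        ((D j).α ((D j).conjUnit (a j) ((D j).emb (i j)) ((D j).emb (k j))) +
          (D j).β ((D j).conjUnit (a j) ((D j).emb (i j)) ((D j).emb (k j))))) Ψ) := by
  have hpart : ∀ j g X, (D j).part g X ∈ mirrorAlg L M hc Ψ j := fun j g X => by
    unfold TeleportData.part
    split_ifs
    · exact hα j X
    · exact hβ j X
  have hshift : ∀ j i g c, (D j).shift i g c ∈ mirrorAlg L M hc Ψ j := fun j i g c =>
    (mirrorAlg L M hc Ψ j).smul_mem (hpart j g _) _
  have h1 : ∀ g c, inner ℂ (krausVec L Ψ D g c (mix g i k)) (krausVec L Ψ D g c (mix g k i)) =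
      inner ℂ Ψ (L.op (fun j => (D j).M (c j).1 *
        ((D j).shift ((D j).emb (mix g k i j)) (g j) (c j) *
          star ((D j).shift ((D j).emb (mix g i k j)) (g j) (c j)))) Ψ) := fun g c => by
    refine inner_op_mul_op_mul hc (Q := fun j => (D j).M (c j).1)
      (S := fun j => (D j).shift ((D j).emb (mix g i k j)) (g j) (c j))
      (S' := fun j => (D j).shift ((D j).emb (mix g k i j)) (g j) (c j)) ?_
      fun j => hshift j _ _ _
    funext j
    have hM := (D j).M_proj (c j).1
    rw [Pi.mul_apply, Pi.star_apply, hM.isSelfAdjoint.star_eq, hM.isIdempotentElem.eq]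
  simp_rw [h1, ← inner_sum, ← _root_.sum_apply]
  congr 2
  have h2 : ∀ g : Fin N → Fin 2, ∑ c : ∀ j, 𝒜 j × Fin (n j), L.op (fun j => (D j).M (c j).1 *
        ((D j).shift ((D j).emb (mix g k i j)) (g j) (c j) *
          star ((D j).shift ((D j).emb (mix g i k j)) (g j) (c j)))) =
      L.op fun j => ∑ a, (D j).M a *
        (D j).part (g j) ((D j).conjUnit a ((D j).emb (i j)) ((D j).emb (k j))) := fun g => by
    rw [← L.op.map_sum fun j (c : 𝒜 j × Fin (n j)) => (D j).M c.1 *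
        ((D j).shift ((D j).emb (mix g k i j)) (g j) c *
          star ((D j).shift ((D j).emb (mix g i k j)) (g j) c))]
    congr 1
    funext j
    rw [Fintype.sum_prod_type]
    refine Finset.sum_congr rfl fun a _ => ?_
    change ∑ l, (D j).M a * ((D j).shift ((D j).emb (mix g k i j)) (g j) (a, l) *
      star ((D j).shift ((D j).emb (mix g i k j)) (g j) (a, l))) = _
    rw [← Finset.mul_sum, (D j).sum_shift_mul_star (hn j)]
    congr 2
    unfold mix
    split_ifs <;> rfl
  simp_rw [h2]
  rw [← L.op.map_sum fun j (g : Fin 2) => ∑ a, (D j).M a *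
        (D j).part g ((D j).conjUnit a ((D j).emb (i j)) ((D j).emb (k j))),
    ← L.op.map_sum fun j a => (D j).M a *
        ((D j).α ((D j).conjUnit a ((D j).emb (i j)) ((D j).emb (k j))) +
          (D j).β ((D j).conjUnit a ((D j).emb (i j)) ((D j).emb (k j))))]
  congr 1
  funext j
  rw [Fin.sum_univ_two, ← Finset.sum_add_distrib]
  refine Finset.sum_congr rfl fun a _ => ?_
  rw [mul_add]
  rfl

end Vectors

end LocalRep

/-! ### Factors of a vector fixed by a partial transpose -/

section Factor

/-- Equality in Cauchy–Schwarz for the Hilbert–Schmidt product: `T` has norm one and overlap `s =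
‖V‖ ^ 2` with the rank-one matrix of `V`, whose norm is also `s`. So the squared distance between `s
T` and that matrix is `s² - 2 s² + s² = 0`. -/
theorem eq_mul_conj_of_fixed {I : Type*} [Fintype I] {T : I → I → ℂ}
    (hT : ∑ i, ∑ k, ‖T i k‖ ^ 2 = 1) {V : I → ℂ} (hV : ∀ i, V i = ∑ k, T i k * V k)
    (i k : I) : T i k * (∑ l, ‖V l‖ ^ 2 : ℝ) = V i * conj (V k) := by
  set s : ℝ := ∑ l, ‖V l‖ ^ 2 with hs
  have h1 : ∑ i, ∑ k, T i k * conj (V i) * V k = (s : ℂ) := by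
    calc _ = ∑ i, conj (V i) * V i := by
          refine Finset.sum_congr rfl fun i _ => ?_
          conv_rhs => rw [hV i]
          rw [Finset.mul_sum]
          conv_rhs => rw [← hV i]
          exact Finset.sum_congr rfl fun k _ => by ring
      _ = (s : ℂ) := by simp [hs, Complex.conj_mul']
  have h2 : ∑ i, ∑ k, ‖T i k * s - V i * conj (V k)‖ ^ 2 = 0 := by
    have e : ∀ i k, ‖T i k * s - V i * conj (V k)‖ ^ 2 =
        s ^ 2 * ‖T i k‖ ^ 2 - 2 * s * (T i k * conj (V i) * V k).re + ‖V i‖ ^ 2 * ‖V k‖ ^ 2 := by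
      intro i k
      rw [← Complex.normSq_eq_norm_sq, Complex.normSq_sub]
      simp only [Complex.normSq_eq_norm_sq, Complex.norm_real,
        Complex.norm_conj, map_mul, Complex.conj_conj, Real.norm_eq_abs, sq_abs]
      have : T i k * (s : ℂ) * (conj (V i) * V k) = ((s : ℝ) : ℂ) * (T i k * conj (V i) * V k) := by
        ring
      rw [this, Complex.re_ofReal_mul]
      ring
    simp_rw [e, Finset.sum_add_distrib, Finset.sum_sub_distrib, ← Finset.mul_sum, ← Finset.sum_mul,
      ← Complex.re_sum]
    rw [h1, hT, ← hs, Complex.ofReal_re]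
    ring
  rw [Finset.sum_eq_zero_iff_of_nonneg fun _ _ => by positivity] at h2
  have h3 := h2 i (Finset.mem_univ _)
  rw [Finset.sum_eq_zero_iff_of_nonneg fun _ _ => by positivity] at h3
  have h4 := h3 k (Finset.mem_univ _)
  rw [← sub_eq_zero]
  exact norm_eq_zero.1 (pow_eq_zero_iff two_ne_zero |>.1 h4)

/-- A partial transpose of `|ψ⟩⟨ψ|` has eigenvalue `1` only if `ψ` is a product. -/
theorem mul_eq_mul_mix_of_fixed {P : Type*} {d : P → Type*} [Fintype (∀ p, d p)]
    {ψ : (∀ p, d p) → ℂ} (hψ : ∑ i, ‖ψ i‖ ^ 2 = 1) (g : P → Fin 2) {V : (∀ p, d p) → ℂ}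
    (hV : ∀ i, V i = ∑ k, partialTranspose ψ g i k * V k) (hV0 : ∃ i, V i ≠ 0)
    (i k : ∀ p, d p) : ψ i * ψ k = ψ (mix g i k) * ψ (mix g k i) := by
  have key := eq_mul_conj_of_fixed (sum_partialTranspose_norm hψ g) hV
  set s : ℝ := ∑ l, ‖V l‖ ^ 2
  have hs : (s : ℂ) ≠ 0 := by
    obtain ⟨i, hi⟩ := hV0
    rw [Complex.ofReal_ne_zero]
    refine ne_of_gt (Finset.sum_pos' (fun _ _ => by positivity) ⟨i, Finset.mem_univ _, ?_⟩)
    positivity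
  obtain ⟨l, hl⟩ : ∃ l, ψ l ≠ 0 := by
    by_contra! h
    simp [h] at hψ
  -- Two rows and two columns of a rank-one matrix have vanishing minor. Padding with `l` makes the
  -- conjugated factor `ψ l` in all four entries, so it can be cancelled.
  have h1 := key (mix g i l) (mix g l i)
  have h2 := key (mix g k l) (mix g l k)
  have h3 := key (mix g i l) (mix g l k)
  have h4 := key (mix g k l) (mix g l i)
  have e1 : ∀ a b c e : ∀ p, d p, mix g (mix g a b) (mix g c e) = mix g a e := fun a b c e => by
    funext p
    simp only [mix]
    split_ifs <;> rfl
  have e2 : ∀ a : ∀ p, d p, mix g a a = a := fun a => by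
    funext p
    simp [mix]
  simp only [partialTranspose, e1, e2] at h1 h2 h3 h4
  have hl' : conj (ψ l) ≠ 0 := by simpa using hl
  refine mul_right_cancel₀ (mul_ne_zero (mul_ne_zero hl' hl') (mul_ne_zero hs hs)) ?_
  calc ψ i * ψ k * (conj (ψ l) * conj (ψ l) * (s * s))
      = (ψ i * conj (ψ l) * s) * (ψ k * conj (ψ l) * s) := by ring
    _ = (ψ (mix g i k) * conj (ψ l) * s) * (ψ (mix g k i) * conj (ψ l) * s) := by
        rw [h1, h2, h3, h4]; ring
    _ = _ := by ring

/-- Taking `x₀` as second argument of the exchange identity separates the two groups of coordinates;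
division by `χ x₀` normalises the second factor. -/
theorem exists_isTensor_of_mul_eq {P : Type} {d : P → ℕ} {χ : (∀ p, Fin (d p)) → ℂ}
    {x₀ : ∀ p, Fin (d p)} (h0 : χ x₀ ≠ 0) (g : P → Fin 2)
    (h : ∀ x y, χ x * χ y = χ (mix g x y) * χ (mix g y x)) :
    ∃ u v, IsTensor χ {p | g p = 0} u v := by
  classical
  refine ⟨fun f => χ fun p => if hp : g p = 0 then f ⟨p, hp⟩ else x₀ p,
    fun f => χ (fun p => if hp : g p = 0 then x₀ p else f ⟨p, hp⟩) / χ x₀, fun x => ?_⟩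
  have e1 : (fun p => if _ : g p = 0 then x p else x₀ p) = mix g x x₀ := by
    funext p; simp [mix]
  have e2 : (fun p => if _ : g p = 0 then x₀ p else x p) = mix g x₀ x := by
    funext p; simp [mix]
  simp only [e1, e2]
  rw [mul_div_assoc', ← h, mul_div_cancel_right₀ _ h0]

end Factor

/-! ### Heralded extraction of the factors -/

section Heralded

variable {N : ℕ} {d : Fin N → ℕ} {κ : Fin N → Type u} {B : Type u}

/-- The registers other than the system and flag registers of the parties in `S`. -/
abbrev RestIndex (d : Fin N → ℕ) (κ : Fin N → Type u) (B : Type u) (S : Finset (Fin N)) : Type u :=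
  (∀ p : {j // j ∉ S}, Fin (d p) × Fin 2) × (∀ j, κ j) × B

/-- The system and flag registers of the parties in `S`, split off. -/
def splitEquiv (d : Fin N → ℕ) (κ : Fin N → Type u) (B : Type u) (S : Finset (Fin N)) :
    (∀ j, Fin (d j) × Fin 2 × κ j) × B ≃
      RestIndex d κ B S × ((∀ p : {j // j ∈ S}, Fin (d p)) × ({j // j ∈ S} → Fin 2)) where
  toFun y := ((fun p => ((y.1 p).1, (y.1 p).2.1), fun j => (y.1 j).2.2, y.2),
    (fun p => (y.1 p).1, fun p => (y.1 p).2.1))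
  invFun z := (fun j => if h : j ∈ S then (z.2.1 ⟨j, h⟩, z.2.2 ⟨j, h⟩, z.1.2.1 j)
    else ((z.1.1 ⟨j, h⟩).1, (z.1.1 ⟨j, h⟩).2, z.1.2.1 j), z.1.2.2)
  left_inv y := by
    refine Prod.ext (funext fun j => ?_) rfl
    by_cases h : j ∈ S <;> simp [h]
  right_inv z := by
    obtain ⟨⟨r, c, b⟩, x, g⟩ := z
    refine Prod.ext (Prod.ext (funext fun p => ?_) (Prod.ext (funext fun j => ?_) rfl))
      (Prod.ext (funext fun p => ?_) (funext fun p => ?_))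
    · simp [p.2]
    · by_cases h : j ∈ S <;> simp [h]
    · simp [p.2]
    · simp [p.2]

/-- The index that is `x` on `S` and `r` elsewhere. -/
def joinIndex {S : Finset (Fin N)} {δ : Fin N → Type*} (x : ∀ p : {j // j ∈ S}, δ p)
    (r : ∀ p : {j // j ∉ S}, δ p) (j : Fin N) : δ j :=
  if h : j ∈ S then x ⟨j, h⟩ else r ⟨j, h⟩

theorem joinIndex_left {S : Finset (Fin N)} {δ : Fin N → Type*} (x : ∀ p : {j // j ∈ S}, δ p)
    (r : ∀ p : {j // j ∉ S}, δ p) : (fun p : {j // j ∈ S} => joinIndex x r p) = x := by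
  funext p; simp [joinIndex, p.2]

theorem joinIndex_right {S : Finset (Fin N)} {δ : Fin N → Type*} (x : ∀ p : {j // j ∈ S}, δ p)
    (r : ∀ p : {j // j ∉ S}, δ p) : (fun p : {j // j ∉ S} => joinIndex x r p) = r := by
  funext p; simp [joinIndex, p.2]

theorem splitEquiv_symm_apply {S : Finset (Fin N)} (r : ∀ p : {j // j ∉ S}, Fin (d p) × Fin 2)
    (c : ∀ j, κ j) (b : B) (x : ∀ p : {j // j ∈ S}, Fin (d p)) (g : {j // j ∈ S} → Fin 2) :
    (splitEquiv d κ B S).symm ((r, c, b), (x, g)) =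
      (fun j => (joinIndex (δ := fun j => Fin (d j)) x (fun p => (r p).1) j,
        joinIndex (δ := fun _ => Fin 2) g (fun p => (r p).2) j, c j), b) := by
  refine Prod.ext (funext fun j => ?_) rfl
  by_cases h : j ∈ S <;> simp [h, splitEquiv, joinIndex]

/-- The extracted vector is fixed by the partial transposes of `|ψ⟩⟨ψ|` given by its flags. -/
def IsFixed (ψ : (∀ j, Fin (d j)) → ℂ) (Ω : Hil ((∀ j, Fin (d j) × Fin 2 × κ j) × B)) : Prop :=
  ∀ (g : Fin N → Fin 2) (c : ∀ j, κ j) (b : B) (i : ∀ j, Fin (d j)),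
    Ω (fun j => (i j, g j, c j), b) =
      ∑ k, partialTranspose ψ g i k * Ω (fun j => (k j, g j, c j), b)

variable {ψ : (∀ j, Fin (d j)) → ℂ} {Ω : Hil ((∀ j, Fin (d j) × Fin 2 × κ j) × B)}
  {S : Finset (Fin N)} {χ : (∀ p : {j // j ∈ S}, Fin (d p)) → ℂ}

theorem mix_restrict {P : Type*} {Q : P → Prop} {δ : P → Type*} (g : P → Fin 2) (i k : ∀ p, δ p) :
    (fun p : {p // Q p} => mix g i k p) =
      mix (fun p : {p // Q p} => g p) (fun p => i p) (fun p => k p) := rfl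

/-- With all flags of `S` equal to `0`, the partial transpose acts on `S` as the projector onto `χ`,
so its range is proportional to `χ` there. Cross-multiplication expresses this without dividing. -/
theorem IsFixed.cross_zero (hΩ : IsFixed ψ Ω)
    {φ : (∀ p : {j // j ∉ S}, Fin (d p)) → ℂ}
    (hφ : ∀ i : ∀ j, Fin (d j), ψ i = χ (fun p => i p) * φ (fun p => i p))
    (r : RestIndex d κ B S) (x y : ∀ p : {j // j ∈ S}, Fin (d p)) :
    χ y * Ω ((splitEquiv d κ B S).symm (r, (x, fun _ => 0))) =
      χ x * Ω ((splitEquiv d κ B S).symm (r, (y, fun _ => 0))) := by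
  obtain ⟨r, c, b⟩ := r
  rw [splitEquiv_symm_apply, splitEquiv_symm_apply, hΩ, hΩ _ _ _ (joinIndex y _), Finset.mul_sum,
    Finset.mul_sum]
  refine Finset.sum_congr rfl fun k _ => ?_
  have e : ∀ a b : ∀ p : {j // j ∈ S}, Fin (d p), mix (fun _ => 0) a b = a := fun a b => by
    funext p; simp [mix]
  simp only [partialTranspose, hφ, mix_restrict, joinIndex_left, joinIndex_right, e]
  ring

/-- With all flags of `S` equal to `1`, the projector onto `χ` is fully transposed on `S`, and
becomes the projector onto `χ*`. -/
theorem IsFixed.cross_one (hΩ : IsFixed ψ Ω)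
    {φ : (∀ p : {j // j ∉ S}, Fin (d p)) → ℂ}
    (hφ : ∀ i : ∀ j, Fin (d j), ψ i = χ (fun p => i p) * φ (fun p => i p))
    (r : RestIndex d κ B S) (x y : ∀ p : {j // j ∈ S}, Fin (d p)) :
    conj (χ y) * Ω ((splitEquiv d κ B S).symm (r, (x, fun _ => 1))) =
      conj (χ x) * Ω ((splitEquiv d κ B S).symm (r, (y, fun _ => 1))) := by
  obtain ⟨r, c, b⟩ := r
  rw [splitEquiv_symm_apply, splitEquiv_symm_apply, hΩ, hΩ _ _ _ (joinIndex y _), Finset.mul_sum,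
    Finset.mul_sum]
  refine Finset.sum_congr rfl fun k _ => ?_
  have e : ∀ a b : ∀ p : {j // j ∈ S}, Fin (d p), mix (fun _ => 1) a b = b := fun a b => by
    funext p; simp [mix]
  simp only [partialTranspose, hφ, mix_restrict, joinIndex_left, joinIndex_right, e, map_mul]
  ring

/-- A nonzero component would make `ψ` invariant under the exchange given by its flags. Freezing the
coordinates outside `S` at a nonzero entry of `ψ` passes this on to `χ`, which would then be a
product of the parties with flag `0` and the others. -/
theorem IsFixed.eq_zero_of_mixed (hΩ : IsFixed ψ Ω) (hψ : IsUnitVector ψ) (hχ : IsGMEFactor ψ S χ)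
    (r : RestIndex d κ B S) (x : ∀ p : {j // j ∈ S}, Fin (d p)) {g : {j // j ∈ S} → Fin 2}
    (h0 : ∃ p, g p = 0) (h1 : ∃ p, g p ≠ 0) :
    Ω ((splitEquiv d κ B S).symm (r, (x, g))) = 0 := by
  by_contra hne
  obtain ⟨hχ1, hGME, φ, hφ⟩ := hχ
  obtain ⟨r, c, b⟩ := r
  rw [splitEquiv_symm_apply] at hne
  set G : Fin N → Fin 2 := joinIndex (δ := fun _ => Fin 2) g (fun p => (r p).2) with hG
  have hGS : (fun p : {j // j ∈ S} => G p) = g := joinIndex_left (δ := fun _ => Fin 2) g _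
  have key := mul_eq_mul_mix_of_fixed hψ G (hΩ G c b) ⟨_, hne⟩
  obtain ⟨l, hl⟩ : ∃ l, ψ l ≠ 0 := by
    by_contra! h
    simp [IsUnitVector, h] at hψ
  rw [hφ] at hl
  have hmul : ∀ x y, χ x * χ y = χ (mix g x y) * χ (mix g y x) := fun x y => by
    have h := key (joinIndex (δ := fun j => Fin (d j)) x fun p => l p)
      (joinIndex (δ := fun j => Fin (d j)) y fun p => l p)
    have e : ∀ (g : {j // j ∉ S} → Fin 2) (a : ∀ p : {j // j ∉ S}, Fin (d p)), mix g a a = a :=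
      fun g a => by funext p; simp [mix]
    simp only [hφ, mix_restrict, joinIndex_left, joinIndex_right, e, hGS] at h
    have hl' := right_ne_zero_of_mul hl
    refine mul_right_cancel₀ (mul_ne_zero hl' hl') ?_
    linear_combination h
  refine hGME {p | g p = 0} h0 h1 ?_
  exact exists_isTensor_of_mul_eq (left_ne_zero_of_mul hl) g hmul

theorem exists_unit_smul {I : Type*} [Nonempty I] (w : Hil I) :
    ∃ ζ : Hil I, ‖ζ‖ = 1 ∧ w = ((‖w‖ : ℝ) : ℂ) • ζ := by
  by_cases hw : w = 0
  -- A branch of weight zero still needs a unit vector; any will do.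
  · exact ⟨ket (Classical.arbitrary I), norm_ket _, by simp [hw]⟩
  · have h : ‖w‖ ≠ 0 := norm_ne_zero_iff.2 hw
    refine ⟨((‖w‖⁻¹ : ℝ) : ℂ) • w, ?_, ?_⟩
    · rw [norm_smul, Complex.norm_real, norm_inv, norm_norm, inv_mul_cancel₀ h]
    · rw [smul_smul, ← Complex.ofReal_mul, mul_inv_cancel₀ h, Complex.ofReal_one, one_smul]

theorem IsFixed.exists_heralded (hΩ : IsFixed ψ Ω) (hΩ1 : ‖Ω‖ = 1) (hψ : IsUnitVector ψ)
    (hχ : IsGMEFactor ψ S χ) :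
    ∃ α ∈ Set.Icc (0 : ℝ) 1,
      ∃ ζ₀ ζ₁ : Hil (RestIndex d κ B S), ‖ζ₀‖ = 1 ∧ ‖ζ₁‖ = 1 ∧
        ∀ y : (∀ j, Fin (d j) × Fin 2 × κ j) × B,
          Ω y =
            (√α : ℂ) * heralded χ 0 (fun p => (y.1 p).1) (fun p => (y.1 p).2.1) *
                ζ₀ (fun p => ((y.1 p).1, (y.1 p).2.1), fun j => (y.1 j).2.2, y.2) +
              (√(1 - α) : ℂ) *
                heralded (conjVec χ) 1 (fun p => (y.1 p).1) (fun p => (y.1 p).2.1) *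
                ζ₁ (fun p => ((y.1 p).1, (y.1 p).2.1), fun j => (y.1 j).2.2, y.2) := by
  obtain ⟨hχ1, -, φ, hφ⟩ := id hχ
  set e := splitEquiv d κ B S with he
  have hχ1' : ∑ x, conj (χ x) * χ x = 1 := by
    have : ∑ x, conj (χ x) * χ x = ((∑ x, ‖χ x‖ ^ 2 : ℝ) : ℂ) := by
      simp [Complex.conj_mul']
    rw [this, hχ1, Complex.ofReal_one]
  -- The contractions of the two unmixed branches with `χ` and with `χ*`; their norms will be `√α`
  -- and `√(1 - α)`.
  set w₀ : Hil (RestIndex d κ B S) := ∑ x, conj (χ x) • slice e Ω (x, fun _ => 0) with hw₀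
  set w₁ : Hil (RestIndex d κ B S) := ∑ x, χ x • slice e Ω (x, fun _ => 1) with hw₁
  have s₀ : ∀ x, slice e Ω (x, fun _ => 0) = χ x • w₀ := fun x => by
    calc slice e Ω (x, fun _ => 0)
        = (∑ y, conj (χ y) * χ y) • slice e Ω (x, fun _ => 0) := by rw [hχ1', one_smul]
      _ = ∑ y, conj (χ y) • χ y • slice e Ω (x, fun _ => 0) := by
          rw [Finset.sum_smul]; simp_rw [mul_smul]
      _ = ∑ y, conj (χ y) • χ x • slice e Ω (y, fun _ => 0) := by
          refine Finset.sum_congr rfl fun y _ => ?_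
          congr 1
          ext r
          exact hΩ.cross_zero hφ r x y
      _ = χ x • w₀ := by
          rw [hw₀, Finset.smul_sum]
          exact Finset.sum_congr rfl fun y _ => smul_comm _ _ _
  have s₁ : ∀ x, slice e Ω (x, fun _ => 1) = conj (χ x) • w₁ := fun x => by
    calc slice e Ω (x, fun _ => 1)
        = (∑ y, conj (χ y) * χ y) • slice e Ω (x, fun _ => 1) := by rw [hχ1', one_smul]
      _ = ∑ y, χ y • conj (χ y) • slice e Ω (x, fun _ => 1) := by
          rw [Finset.sum_smul]; simp_rw [mul_comm (conj _), mul_smul]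
      _ = ∑ y, χ y • conj (χ x) • slice e Ω (y, fun _ => 1) := by
          refine Finset.sum_congr rfl fun y _ => ?_
          congr 1
          ext r
          exact hΩ.cross_one hφ r x y
      _ = conj (χ x) • w₁ := by
          rw [hw₁, Finset.smul_sum]
          exact Finset.sum_congr rfl fun y _ => smul_comm _ _ _
  have hslice : ∀ y : (∀ j, Fin (d j) × Fin 2 × κ j) × B,
      Ω y = slice e Ω (fun p => (y.1 p).1, fun p => (y.1 p).2.1)
        (fun p => ((y.1 p).1, (y.1 p).2.1), fun j => (y.1 j).2.2, y.2) := fun y => by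
    rw [slice_apply]
    exact congrArg Ω (e.symm_apply_apply y).symm
  have hne : Nonempty (RestIndex d κ B S) := by
    by_contra h
    rw [not_nonempty_iff] at h
    have : Ω = 0 := by
      ext y
      exact h.elim (e y).1
    rw [this, norm_zero] at hΩ1
    exact zero_ne_one hΩ1
  obtain ⟨ζ₀, hζ₀, hwζ₀⟩ := exists_unit_smul w₀
  obtain ⟨ζ₁, hζ₁, hwζ₁⟩ := exists_unit_smul w₁
  have hnorm : ∑ z : (∀ p : {j // j ∈ S}, Fin (d p)) × ({j // j ∈ S} → Fin 2),
      ‖slice e Ω z‖ ^ 2 = 1 := by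
    have h := hasSum_slice_norm e Ω
    rw [hΩ1, one_pow] at h
    exact (hasSum_fintype _).unique h
  have hsum₀ : ∑ x, ‖slice e Ω (x, fun _ => 0)‖ ^ 2 = ‖w₀‖ ^ 2 := by
    simp_rw [s₀, norm_smul, mul_pow]
    rw [← Finset.sum_mul, hχ1, one_mul]
  have hsum₁ : ∑ x, ‖slice e Ω (x, fun _ => 1)‖ ^ 2 = ‖w₁‖ ^ 2 := by
    simp_rw [s₁, norm_smul, mul_pow, Complex.norm_conj]
    rw [← Finset.sum_mul, hχ1, one_mul]
  rw [Fintype.sum_prod_type_right] at hnorm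
  -- For empty `S` the patterns of all zeros and all ones coincide, so the whole vector is assigned
  -- to the first branch, with `α = 1`.
  rcases isEmpty_or_nonempty {j // j ∈ S} with hS | hS
  · refine ⟨1, by simp, ζ₀, ζ₀, hζ₀, hζ₀, fun y => ?_⟩
    have hw1 : ‖w₀‖ = 1 := by
      rw [Fintype.sum_subsingleton _ fun _ => 0, hsum₀] at hnorm
      exact (pow_eq_one_iff_of_nonneg (norm_nonneg _) two_ne_zero).1 hnorm
    rw [hw1, Complex.ofReal_one, one_smul] at hwζ₀
    have h0 : (fun p : {j // j ∈ S} => (y.1 p).2.1) = fun _ => 0 := Subsingleton.elim _ _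
    rw [hslice y, h0, s₀, ← hwζ₀]
    simp [heralded]
  · have h01 : (fun _ : {j // j ∈ S} => (0 : Fin 2)) ≠ fun _ => 1 := fun h => by
      simpa using congrFun h (Classical.arbitrary _)
    have hmixed : ∀ (x : ∀ p : {j // j ∈ S}, Fin (d p)) (g : {j // j ∈ S} → Fin 2),
        g ≠ (fun _ => 0) → g ≠ (fun _ => 1) → slice e Ω (x, g) = 0 := fun x g h0 h1 => by
      ext r
      refine hΩ.eq_zero_of_mixed hψ hχ r x ?_ ?_
      · by_contra! h
        exact h1 (funext fun p => by have := h p; omega)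
      · by_contra! h
        exact h0 (funext h)
    have htot : ‖w₀‖ ^ 2 + ‖w₁‖ ^ 2 = 1 := by
      rw [← hnorm, ← hsum₀, ← hsum₁, ← Finset.sum_pair h01
        (f := fun g => ∑ x, ‖slice e Ω (x, g)‖ ^ 2)]
      refine Finset.sum_subset (Finset.subset_univ _) fun g _ hg => ?_
      simp only [Finset.mem_insert, Finset.mem_singleton, not_or] at hg
      exact Finset.sum_eq_zero fun x _ => by rw [hmixed x g hg.1 hg.2]; simp
    refine ⟨‖w₀‖ ^ 2, ⟨by positivity, by nlinarith [sq_nonneg ‖w₁‖]⟩, ζ₀, ζ₁, hζ₀, hζ₁,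
      fun y => ?_⟩
    have hr₀ : √(‖w₀‖ ^ 2) = ‖w₀‖ := Real.sqrt_sq (norm_nonneg _)
    have hr₁ : √(1 - ‖w₀‖ ^ 2) = ‖w₁‖ := by
      rw [← htot, add_sub_cancel_left, Real.sqrt_sq (norm_nonneg _)]
    rw [hr₀, hr₁, hslice y]
    set g : {j // j ∈ S} → Fin 2 := fun p => (y.1 p).2.1 with hg
    have hall : ∀ c : Fin 2, (∀ p, g p = c) ↔ g = fun _ => c := fun c => funext_iff.symm
    simp only [heralded, conjVec, hall]
    by_cases h0 : g = fun _ => 0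
    · rw [h0, s₀, if_pos rfl, if_neg h01]
      nth_rewrite 1 [hwζ₀]
      simp only [lp.coeFn_smul, Pi.smul_apply, smul_eq_mul]
      ring
    · by_cases h1 : g = fun _ => 1
      · rw [h1, s₁, if_neg h01.symm, if_pos rfl]
        nth_rewrite 1 [hwζ₁]
        simp only [lp.coeFn_smul, Pi.smul_apply, smul_eq_mul]
        ring
      · rw [hmixed _ g h0 h1, if_neg h0, if_neg h1]
        simp

end Heralded

/-! ### Support projections -/

/-- The support is the closed span of the slices of `Ψ`: an operator `S ⊗ 1` fixes or annihilates
`Ψ` exactly if `S` does so with every slice. -/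
theorem exists_siteOp_support {I ι R : Type*} (e : I ≃ ι × R) (Ψ : Hil I) :
    ∃ P : Hil ι →L[ℂ] Hil ι, IsStarProjection P ∧ siteOp e P Ψ = Ψ ∧
      ∀ S : Hil ι →L[ℂ] Hil ι, siteOp e S Ψ = 0 → S * P = 0 := by
  set K : Submodule ℂ (Hil ι) := (Submodule.span ℂ (Set.range (slice e Ψ))).topologicalClosure
  have hKc : IsClosed (K : Set (Hil ι)) := Submodule.isClosed_topologicalClosure _
  have : CompleteSpace K := hKc.completeSpace_coe
  have hmem : ∀ r, slice e Ψ r ∈ K := fun r =>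
    Submodule.le_topologicalClosure _ (Submodule.subset_span ⟨r, rfl⟩)
  refine ⟨K.starProjection, isStarProjection_starProjection, slice_ext e fun r => ?_,
    fun S hS => ?_⟩
  · rw [slice_siteOp, Submodule.starProjection_eq_self_iff.2 (hmem r)]
  · have hker : K ≤ LinearMap.ker S.toLinearMap := by
      refine Submodule.topologicalClosure_minimal _ ?_ S.isClosed_ker
      rw [Submodule.span_le]
      rintro _ ⟨r, rfl⟩
      have h := congrArg (fun v => slice e v r) hS
      simp only [slice_siteOp] at h
      refine h.trans ?_
      ext x
      simp
    ext1 v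
    exact hker (K.starProjection_apply_mem v)

section Parties

variable {N : ℕ} {ιA ιB : Fin N → Type u}

theorem mainRep_single (j : Fin N) (s : Hil (ιA j) →L[ℂ] Hil (ιA j)) :
    (mainRep ιA ιB).single j s =
      atSite (ι := Sites ιA ιB) (Sum.inl j) (mainOp s) := by
  rw [← prodOp_mulSingle]
  have h := congrArg prodOp (bothOps_update_left (ιA := ιA) (ιB := ιB) 1 1 j s)
  rw [bothOps_one] at h
  exact h

theorem exists_isSupport (Ψ : Joint ιA ιB) (j : Fin N) :
    ∃ P, LocalRep.IsSupport (mainRep ιA ιB) Ψ j P := by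
  obtain ⟨P, hP, h1, h2⟩ := exists_siteOp_support (Equiv.piSplitAt (Sum.inl j) (Sites ιA ιB)) Ψ
  exact ⟨P, hP, (congrArg (fun T => T Ψ) (mainRep_single j P)).trans h1,
    fun s hs => h2 s ((congrArg (fun T => T Ψ) (mainRep_single j s)).symm.trans hs)⟩

end Parties

/-! ### The local isometries -/

section Isometry

theorem exists_star_mul_self_of_nonneg {E : Type*} [NormedAddCommGroup E] [InnerProductSpace ℂ E]
    [CompleteSpace E] (a : E →L[ℂ] E) (h : 0 ≤ a) : ∃ b, a = star b * b :=
  CStarAlgebra.nonneg_iff_eq_star_mul_self.1 h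

theorem sum_norm_kraus_sq {E : Type*} [NormedAddCommGroup E] [InnerProductSpace ℂ E]
    [CompleteSpace E] {Y : Type*} [Fintype Y] {F : Y → E →L[ℂ] E} (hF : ∑ y, star (F y) * F y = 1)
    (v : E) : ∑ y, ‖F y v‖ ^ 2 = ‖v‖ ^ 2 := by
  have h : ∑ y, inner ℂ (F y v) (F y v) = inner ℂ v v := by
    have h1 : ∀ y, inner ℂ (F y v) (F y v) = inner ℂ v ((star (F y) * F y) v) := fun y => by
      rw [mul_apply_eq_comp, ContinuousLinearMap.star_eq_adjoint,
        ContinuousLinearMap.adjoint_inner_right]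
    simp_rw [h1]
    rw [← inner_sum, ← _root_.sum_apply, hF]
    rfl
  simp_rw [inner_self_eq_norm_sq_to_K] at h
  exact_mod_cast h

variable {ι X : Type*} {d : ℕ} {C : Type*} [Fintype C]

/-- The index of a register system, its flag, a record and a remaining system. -/
def recordEquiv (d : ℕ) (C ι : Type*) :
    Fin d × Fin 2 × (C × ι) ≃ ι × (Fin d × Fin 2 × C) where
  toFun y := (y.2.2.2, (y.1, y.2.1, y.2.2.1))
  invFun z := (z.2.1, z.2.2.1, (z.2.2.2, z.1))
  left_inv _ := rfl
  right_inv _ := rfl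

theorem summable_krausFun (F : Fin d × Fin 2 × C → Hil ι →L[ℂ] Hil ι) (v : Hil ι) :
    Summable fun y : Fin d × Fin 2 × (C × ι) => ‖F (y.1, y.2.1, y.2.2.1) v y.2.2.2‖ ^ 2 := by
  have h : Summable fun p : (Fin d × Fin 2 × C) × ι => ‖F p.1 v p.2‖ ^ 2 := by
    rw [summable_prod_of_nonneg (fun _ => by positivity)]
    exact ⟨fun y => hil_summable (F y v), Summable.of_finite⟩
  exact (Equiv.summable_iff ((recordEquiv d C ι).trans (Equiv.prodComm _ _))
    (f := fun p : (Fin d × Fin 2 × C) × ι => ‖F p.1 v p.2‖ ^ 2)).2 h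

/-- The isometry with given Kraus operators. -/
def krausIsometry (F : Fin d × Fin 2 × C → Hil ι →L[ℂ] Hil ι)
    (hF : ∑ y, star (F y) * F y = 1) : Hil ι →ₗᵢ[ℂ] Hil (Fin d × Fin 2 × (C × ι)) where
  toFun v := hilMk (fun y => F (y.1, y.2.1, y.2.2.1) v y.2.2.2) (summable_krausFun F v)
  map_add' v w := by
    ext y
    rw [lp.coeFn_add, Pi.add_apply, hilMk_apply, hilMk_apply, hilMk_apply, map_add, lp.coeFn_add,
      Pi.add_apply]
  map_smul' c v := by
    ext y
    simp
  norm_map' v := by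
    rw [← sq_eq_sq₀ (norm_nonneg _) (norm_nonneg _), ← sum_norm_kraus_sq hF]
    have h := hasSum_slice_norm (recordEquiv d C ι)
      (hilMk (fun y => F (y.1, y.2.1, y.2.2.1) v y.2.2.2) (summable_krausFun F v))
    refine h.unique ?_
    have e : ∀ r, slice (recordEquiv d C ι) (hilMk (fun y => F (y.1, y.2.1, y.2.2.1) v y.2.2.2)
      (summable_krausFun F v)) r = F r v := fun r => by ext x; rfl
    simp_rw [e]
    exact hasSum_fintype _

end Isometry

/-! ### From teleportation data to the extracted state. -/

section Extraction

variable {N : ℕ} {ιA ιB : Fin N → Type u} {d n : Fin N → ℕ} {𝒜 : Fin N → Type}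
  [∀ j, Fintype (𝒜 j)]

theorem localApply_krausIsometry {C : Fin N → Type*} [∀ j, Fintype (C j)]
    (F : ∀ j, Fin (d j) × Fin 2 × C j → Hil (ιA j) →L[ℂ] Hil (ιA j))
    (hF : ∀ j, ∑ y, star (F j y) * F j y = 1) (Ψ : Hil ((∀ j, ιA j) × (∀ j, ιB j)))
    (y : (∀ j, Fin (d j) × Fin 2 × (C j × ιA j)) × (∀ j, ιB j)) :
    localApply (fun j => (krausIsometry (F j) (hF j)).toContinuousLinearMap) (fun _ => 1) Ψ y =
      (mainRep ιA ιB).op (fun j => F j ((y.1 j).1, (y.1 j).2.1, (y.1 j).2.2.1)) (jointVec Ψ)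
        ((jointEquiv ιA ιB).symm (fun j => (y.1 j).2.2.2, y.2)) := by
  have h := localApply_eq (fun j => F j ((y.1 j).1, (y.1 j).2.1, (y.1 j).2.2.1)) 1 Ψ
    (fun j => (y.1 j).2.2.2, y.2)
  rw [(auxRep ιA ιB).op_one, one_apply_eq_self] at h
  rw [← h]
  rfl

theorem hil_sum_apply {ι Y : Type*} (t : Finset Y) (f : Y → Hil ι) (x : ι) :
    (∑ y ∈ t, f y) x = ∑ y ∈ t, f y x := by
  rw [lp.coeFn_sum, Finset.sum_apply]

/-- Separates the indices of the local maps from the indices of the parties. -/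
def recordsEquiv (d : Fin N → ℕ) (C : Fin N → Type*) (ιA ιB : Fin N → Type u) :
    ((∀ j, Fin (d j) × Fin 2 × (C j × ιA j)) × (∀ j, ιB j)) ≃
      (∀ j, Fin (d j) × Fin 2 × C j) × ((∀ j, ιA j) × (∀ j, ιB j)) where
  toFun y := (fun j => ((y.1 j).1, (y.1 j).2.1, (y.1 j).2.2.1), (fun j => (y.1 j).2.2.2, y.2))
  invFun z := (fun j => ((z.1 j).1, (z.1 j).2.1, ((z.1 j).2.2, z.2.1 j)), z.2.2)
  left_inv _ := rfl
  right_inv _ := rfl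

theorem hasSum_comp_equiv {I J : Type*} (e : I ≃ J) (F : J → ℝ) {c : ℝ} (h : HasSum F c) :
    HasSum (fun i => F (e i)) c :=
  e.hasSum_iff.2 h

theorem hasSum_norm_records {I J Y X : Type*} [Finite Y] (e : I ≃ Y × J) (f : J ≃ X)
    (V : Y → Hil X) {c : ℝ} (hc : HasSum (fun y => ‖V y‖ ^ 2) c) :
    HasSum (fun i => ‖V (e i).1 (f (e i).2)‖ ^ 2) c := by
  have hfib : ∀ y, HasSum (fun j => ‖V y (f j)‖ ^ 2) (‖V y‖ ^ 2) := fun y =>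
    f.hasSum_iff (f := fun x => ‖V y x‖ ^ 2) |>.2 (hil_hasSum_norm_sq _)
  have hs : Summable fun z : Y × J => ‖V z.1 (f z.2)‖ ^ 2 := by
    rw [summable_prod_of_nonneg (fun _ => by positivity)]
    exact ⟨fun y => (hfib y).summable, Summable.of_finite⟩
  have h := (hs.hasSum.prod_fiberwise hfib).unique hc
  exact hasSum_comp_equiv e _ (h ▸ hs.hasSum)

theorem sum_le_sum_of_injective {X Y : Type*} [Fintype X] [Fintype Y] {f : Y → ℝ}
    (hf : ∀ y, 0 ≤ f y) {φ : X → Y} (hφ : Function.Injective φ) :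
    ∑ x, f (φ x) ≤ ∑ y, f y := by
  calc _ = ∑ y ∈ Finset.univ.map ⟨φ, hφ⟩, f y := by rw [Finset.sum_map]; rfl
    _ ≤ _ := Finset.sum_le_univ_sum_of_nonneg hf

theorem eq_zero_of_sum_eq {X Y : Type*} [Fintype X] [Fintype Y] {f : Y → ℝ}
    (hf : ∀ y, 0 ≤ f y) {φ : X → Y} (hφ : Function.Injective φ)
    (h : ∑ x, f (φ x) = ∑ y, f y) {y : Y} (hy : y ∉ Set.range φ) : f y = 0 := by
  classical
  have h1 : ∑ x, f (φ x) = ∑ y ∈ Finset.univ.map ⟨φ, hφ⟩, f y := by rw [Finset.sum_map]; rfl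
  have h2 := Finset.sum_sdiff (f := f) (Finset.subset_univ (Finset.univ.map ⟨φ, hφ⟩))
  rw [← h1, h] at h2
  have h3 : ∑ y ∈ Finset.univ \ Finset.univ.map ⟨φ, hφ⟩, f y = 0 := by linarith
  rw [Finset.sum_eq_zero_iff_of_nonneg fun y _ => hf y] at h3
  refine h3 y ?_
  simpa using hy

/-- The index of a Kraus operator of each party. -/
def krausIndex {C : Fin N → Type*} (z : (Fin N → Fin 2) × (∀ j, C j) × (∀ j, Fin (d j))) (j : Fin N) :
    Fin (d j) × Fin 2 × Option (C j) :=
  (z.2.2 j, z.1 j, some (z.2.1 j))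

theorem krausIndex_injective {C : Fin N → Type*} :
    Function.Injective (krausIndex (N := N) (d := d) (C := C)) := by
  rintro ⟨g, c, i⟩ ⟨g', c', i'⟩ h
  have h' : ∀ j, i j = i' j ∧ g j = g' j ∧ c j = c' j := fun j => by
    simpa [krausIndex] using congrFun h j
  exact Prod.ext (funext fun j => (h' j).2.1)
    (Prod.ext (funext fun j => (h' j).2.2) (funext fun j => (h' j).1))

/-- Teleportation data that reproduce the tomography of `ψ` yield local maps that extract `ψ` up
to heralded conjugations. -/
theorem extractsHeralded_of_teleportData (Ψ : Hil ((∀ j, ιA j) × (∀ j, ιB j))) (hΨ : ‖Ψ‖ = 1)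
    {ψ : (∀ j, Fin (d j)) → ℂ} (hψ : IsUnitVector ψ)
    (D : ∀ j, TeleportData (Hil (ιA j) →L[ℂ] Hil (ιA j)) (d j) (n j) (𝒜 j)) (hn : ∀ j, n j ≠ 0)
    (hα : ∀ j X, (D j).α X ∈
      LocalRep.mirrorAlg (mainRep ιA ιB) (auxRep ιA ιB) mainRep_commute_auxRep (jointVec Ψ) j)
    (hβ : ∀ j X, (D j).β X ∈
      LocalRep.mirrorAlg (mainRep ιA ιB) (auxRep ιA ιB) mainRep_commute_auxRep (jointVec Ψ) j)
    (h : ∀ i k : ∀ j, Fin (d j), ∑ a : ∀ j, 𝒜 j, inner ℂ (jointVec Ψ)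
      ((mainRep ιA ιB).op (fun j => (D j).M (a j) *
        ((D j).α ((D j).conjUnit (a j) ((D j).emb (i j)) ((D j).emb (k j))) +
          (D j).β ((D j).conjUnit (a j) ((D j).emb (i j)) ((D j).emb (k j))))) (jointVec Ψ)) =
      conj (ψ i) * ψ k) :
    ExtractsHeralded Ψ ψ := by
  classical
  obtain ⟨i₀, -⟩ : ∃ l, ψ l ≠ 0 := by
    by_contra! h
    simp [IsUnitVector, h] at hψ
  -- A square root of the defect completes the Kraus operators to an isometry.
  have hR : ∀ j, ∃ R : Hil (ιA j) →L[ℂ] Hil (ιA j), 1 - ∑ i : Fin (d j), ∑ g, ∑ c,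
      star ((D j).kraus ((D j).emb i) g c) * (D j).kraus ((D j).emb i) g c = star R * R := fun j =>
    exists_star_mul_self_of_nonneg _ (sub_nonneg.2 ((D j).sum_kraus_le (hn j)))
  choose R hR using hR
  -- The extra record `none` is filed under register value `i₀` and flag `0`. The choice is
  -- immaterial, since these branches turn out to vanish on the state.
  let F : ∀ j, Fin (d j) × Fin 2 × Option (𝒜 j × Fin (n j)) → Hil (ιA j) →L[ℂ] Hil (ιA j) :=
    fun j y => y.2.2.elim (if y.1 = i₀ j ∧ y.2.1 = 0 then R j else 0)
      fun c => (D j).kraus ((D j).emb y.1) y.2.1 c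
  have hF : ∀ j, ∑ y, star (F j y) * F j y = 1 := fun j => by
    simp_rw [Fintype.sum_prod_type, Fintype.sum_option, Finset.sum_add_distrib]
    have h1 : ∑ i, ∑ g, star (F j (i, g, none)) * F j (i, g, none) = star (R j) * R j := by
      have e : ∀ i g, star (F j (i, g, none)) * F j (i, g, none) =
          if i = i₀ j then (if g = 0 then star (R j) * R j else 0) else 0 := fun i g => by
        by_cases h1 : i = i₀ j <;> by_cases h2 : g = 0 <;> simp [F, h1, h2]
      simp_rw [e]
      simp
    rw [h1, ← hR]
    exact sub_add_cancel _ _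
  have hnorm : ∑ y : ∀ j, Fin (d j) × Fin 2 × Option (𝒜 j × Fin (n j)),
      ‖(mainRep ιA ιB).op (fun j => F j (y j)) (jointVec Ψ)‖ ^ 2 = 1 := by
    rw [LocalRep.sum_norm_op_sq F hF, norm_jointVec, hΨ, one_pow]
  have hsome : ∀ g c i, (mainRep ιA ιB).op (fun j => F j (krausIndex (g, c, i) j)) (jointVec Ψ) =
      LocalRep.krausVec (mainRep ιA ιB) (jointVec Ψ) D g c i := fun g c i => rfl
  have hle : ∑ g, ∑ c, ∑ i,
      ‖LocalRep.krausVec (mainRep ιA ιB) (jointVec Ψ) D g c i‖ ^ 2 ≤ 1 := by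
    have := sum_le_sum_of_injective
      (f := fun y => ‖(mainRep ιA ιB).op (fun j => F j (y j)) (jointVec Ψ)‖ ^ 2)
      (fun y => by positivity) (krausIndex_injective (d := d) (C := fun j => 𝒜 j × Fin (n j)))
    rw [hnorm] at this
    simp_rw [Fintype.sum_prod_type, hsome] at this
    exact this
  obtain ⟨hfix, htot⟩ := eq_partialTranspose_sum hψ
    (LocalRep.krausVec (mainRep ιA ιB) (jointVec Ψ) D) hle fun i k => by
      rw [LocalRep.sum_inner_krausVec mainRep_commute_auxRep D hn hα hβ, h]
  -- The proper branches already have total squared norm one, so nothing is left for branches in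
  -- which some party records `none`.
  have hnone : ∀ y, y ∉ Set.range (krausIndex (d := d) (C := fun j => 𝒜 j × Fin (n j))) →
      (mainRep ιA ιB).op (fun j => F j (y j)) (jointVec Ψ) = 0 := fun y hy => by
    have := eq_zero_of_sum_eq
      (f := fun y => ‖(mainRep ιA ιB).op (fun j => F j (y j)) (jointVec Ψ)‖ ^ 2)
      (fun y => by positivity) (krausIndex_injective (d := d) (C := fun j => 𝒜 j × Fin (n j)))
      (by
        rw [hnorm]
        simp_rw [Fintype.sum_prod_type, hsome]
        exact htot) hy
    exact norm_eq_zero.1 (pow_eq_zero_iff two_ne_zero |>.1 this)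
  have hfix' : ∀ (g : Fin N → Fin 2) (c : ∀ j, Option (𝒜 j × Fin (n j))) (i : ∀ j, Fin (d j)),
      (mainRep ιA ιB).op (fun j => F j (i j, g j, c j)) (jointVec Ψ) =
        ∑ k, partialTranspose ψ g i k •
          (mainRep ιA ιB).op (fun j => F j (k j, g j, c j)) (jointVec Ψ) := fun g c i => by
    by_cases hc : ∃ c' : ∀ j, 𝒜 j × Fin (n j), ∀ j, c j = some (c' j)
    · obtain ⟨c', hc'⟩ := hc
      obtain rfl : c = fun j => some (c' j) := funext hc'
      exact hfix g c' i
    · have h0 : ∀ i : ∀ j, Fin (d j),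
          (mainRep ιA ιB).op (fun j => F j (i j, g j, c j)) (jointVec Ψ) = 0 := fun i => by
        refine hnone (fun j => (i j, g j, c j)) ?_
        rintro ⟨⟨g', c', i'⟩, hz⟩
        refine hc ⟨c', fun j => ?_⟩
        have := congrFun hz j
        simp only [krausIndex, Prod.mk.injEq] at this
        exact this.2.2.symm
      simp [h0]
  have hsum := hasSum_norm_records (recordsEquiv d (fun j => Option (𝒜 j × Fin (n j))) ιA ιB)
    (jointEquiv ιA ιB).symm (fun y => (mainRep ιA ιB).op (fun j => F j (y j)) (jointVec Ψ))
    (hnorm ▸ hasSum_fintype _)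
  have hΩ := localApply_krausIsometry F hF Ψ
  set Ω := hilMk _ hsum.summable with hΩdef
  have hΩ1 : ‖Ω‖ = 1 := by
    rw [← sq_eq_sq₀ (norm_nonneg _) zero_le_one, hΩdef, norm_hilMk_sq, hsum.tsum_eq, one_pow]
  have hΩf : IsFixed ψ Ω := fun g c b i => by
    have h1 := congrArg (fun v => v ((jointEquiv ιA ιB).symm (fun j => (c j).2, b)))
      (hfix' g (fun j => (c j).1) i)
    exact h1.trans (by rw [hil_sum_apply]; rfl)
  refine ⟨fun j => Option (𝒜 j × Fin (n j)) × ιA j,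
    fun j => (krausIsometry (F j) (hF j)).toContinuousLinearMap,
    fun j v => (krausIsometry (F j) (hF j)).norm_map v, fun S χ hχ => ?_⟩
  obtain ⟨α, hα01, ζ₀, ζ₁, h0, h1, hy⟩ := hΩf.exists_heralded hΩ1 hψ hχ
  exact ⟨α, hα01, ζ₀, ζ₁, h0, h1, fun y => (hΩ y).trans (hy y)⟩

end Extraction

/-! ### Extraction from tomography -/

section Tomography

theorem MultilinearMap.ext_of_span {ι : Type*} [Fintype ι] [DecidableEq ι] {V : ι → Type*}
    [∀ j, AddCommGroup (V j)] [∀ j, Module ℂ (V j)] {W : Type*} [AddCommGroup W] [Module ℂ W]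
    {𝒬 : ι → Type*} [∀ j, Fintype (𝒬 j)] {Q : ∀ j, 𝒬 j → V j}
    (hQ : ∀ j, Submodule.span ℂ (Set.range (Q j)) = ⊤) {f g : MultilinearMap ℂ V W}
    (h : ∀ q : ∀ j, 𝒬 j, f (fun j => Q j (q j)) = g (fun j => Q j (q j))) : f = g := by
  ext X
  have hX : ∀ j, ∃ c : 𝒬 j → ℂ, ∑ q, c q • Q j q = X j := fun j =>
    (Submodule.mem_span_range_iff_exists_fun ℂ).1 (hQ j ▸ Submodule.mem_top)
  choose c hc using hX
  obtain rfl : (fun j => ∑ q, c j q • Q j q) = X := funext hc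
  rw [f.map_sum fun j q => c j q • Q j q, g.map_sum fun j q => c j q • Q j q]
  refine Finset.sum_congr rfl fun q _ => ?_
  rw [f.map_smul_univ, g.map_smul_univ, h]

variable {N : ℕ} {d n : Fin N → ℕ}

/-- `⟨ψ| ⨂ⱼ Xⱼ |ψ⟩`, for a vector `ψ` embedded into a larger space. -/
def tensorExpect (emb : ∀ j, Fin (d j) → Fin (n j)) (ψ : (∀ j, Fin (d j)) → ℂ) :
    MultilinearMap ℂ (fun j => Matrix (Fin (n j)) (Fin (n j)) ℂ) ℂ :=
  ∑ i, ∑ k, (conj (ψ i) * ψ k) • (MultilinearMap.mkPiAlgebra ℂ (Fin N) ℂ).compLinearMap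
    fun j => Matrix.entryLinearMap ℂ ℂ (emb j (i j)) (emb j (k j))

theorem tensorExpect_apply (emb : ∀ j, Fin (d j) → Fin (n j)) (ψ : (∀ j, Fin (d j)) → ℂ)
    (X : ∀ j, Matrix (Fin (n j)) (Fin (n j)) ℂ) :
    tensorExpect emb ψ X =
      ∑ i, ∑ k, conj (ψ i) * (∏ j, X j (emb j (i j)) (emb j (k j))) * ψ k := by
  simp only [tensorExpect, _root_.sum_apply, _root_.smul_apply,
    MultilinearMap.compLinearMap_apply, MultilinearMap.mkPiAlgebra_apply,
    Matrix.entryLinearMap_apply, smul_eq_mul]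
  exact Finset.sum_congr rfl fun i _ => Finset.sum_congr rfl fun k _ => by ring

theorem tensorExpect_single {emb : ∀ j, Fin (d j) → Fin (n j)}
    (hemb : ∀ j, Function.Injective (emb j)) (ψ : (∀ j, Fin (d j)) → ℂ) (i k : ∀ j, Fin (d j)) :
    tensorExpect emb ψ (fun j => Matrix.single (emb j (i j)) (emb j (k j)) 1) =
      conj (ψ i) * ψ k := by
  have h : ∀ i' k' : ∀ j, Fin (d j), ∏ j, (Matrix.single (emb j (i j)) (emb j (k j)) (1 : ℂ) :
      Matrix (Fin (n j)) (Fin (n j)) ℂ) (emb j (i' j)) (emb j (k' j)) =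
      if i = i' ∧ k = k' then 1 else 0 := fun i' k' => by
    simp only [Matrix.single_apply, (hemb _).eq_iff]
    rw [Finset.prod_ite_zero]
    simp [funext_iff, forall_and]
  simp_rw [tensorExpect_apply, h]
  rw [Finset.sum_eq_single i, Finset.sum_eq_single k]
  · simp
  · intro b _ hb
    simp [hb.symm]
  · simp
  · intro b _ hb
    simp [hb.symm]
  · simp

/-- Conjugation of a matrix by a fixed matrix. -/
def conjMap {m : ℕ} (U : Matrix (Fin m) (Fin m) ℂ) :
    Matrix (Fin m) (Fin m) ℂ →ₗ[ℂ] Matrix (Fin m) (Fin m) ℂ :=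
  LinearMap.mulRight ℂ U ∘ₗ LinearMap.mulLeft ℂ (star U)

variable {ιA ιB : Fin N → Type u} {𝒜 𝒬 : Fin N → Type} [∀ j, Fintype (𝒜 j)]
  [∀ j, Nonempty (𝒜 j)] [∀ j, Fintype (𝒬 j)]

/-- If real representations of the local matrix algebras are mirrored by the auxiliary parties, and
the joint statistics are those of the tomography of the teleported state `ψ`, then local maps
extract `ψ` up to heralded conjugations. -/
theorem extractsHeralded_of_jordan (Ψ : Hil ((∀ j, ιA j) × (∀ j, ιB j))) (hΨ : ‖Ψ‖ = 1)
    {ψ : (∀ j, Fin (d j)) → ℂ} (hψ : IsUnitVector ψ) (hn : ∀ j, n j ≠ 0)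
    (emb : ∀ j, Fin (d j) → Fin (n j)) (hemb : ∀ j, Function.Injective (emb j))
    (E : ∀ j, 𝒜 j → Hil (ιA j) →L[ℂ] Hil (ιA j)) (hE : ∀ j a, IsStarProjection (E j a))
    (hE1 : ∀ j, ∑ a, E j a = 1) (U : ∀ j, 𝒜 j → Matrix (Fin (n j)) (Fin (n j)) ℂ)
    (hU : ∀ j a, U j a * star (U j a) = 1)
    (π : ∀ j, Matrix (Fin (n j)) (Fin (n j)) ℂ →ₗ[ℂ] Hil (ιA j) →L[ℂ] Hil (ιA j))
    (hπ1 : ∀ j, IsStarProjection (π j 1))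
    (hπj : ∀ j X Y, π j (X * Y) + π j (Y * X) = π j X * π j Y + π j Y * π j X)
    (hπs : ∀ j X, π j (star X) = star (π j X))
    (Q : ∀ j, 𝒬 j → Matrix (Fin (n j)) (Fin (n j)) ℂ)
    (hQ : ∀ j, Submodule.span ℂ (Set.range (Q j)) = ⊤)
    (B : ∀ j, 𝒬 j → Hil (ιB j) →L[ℂ] Hil (ιB j))
    (hB : ∀ j q, LocalRep.Mirror (mainRep ιA ιB) (auxRep ιA ιB) (jointVec Ψ) j (π j (Q j q)) (B j q))
    (h : ∀ (a : ∀ j, 𝒜 j) (q : ∀ j, 𝒬 j),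
      expect Ψ (fun j => E j (a j)) (fun j => B j (q j)) =
        (∏ j, (Fintype.card (𝒜 j) : ℂ)⁻¹) *
          tensorExpect emb ψ (fun j => star (U j (a j)) * Q j (q j) * U j (a j))) :
    ExtractsHeralded Ψ ψ := by
  classical
  have hmem : ∀ j X, π j X ∈
      LocalRep.mirrorAlg (mainRep ιA ιB) (auxRep ιA ιB) mainRep_commute_auxRep (jointVec Ψ) j :=
    fun j X => by
      obtain ⟨c, rfl⟩ := (Submodule.mem_span_range_iff_exists_fun ℂ).1 (hQ j ▸ Submodule.mem_top (x := X))
      rw [map_sum]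
      have hq : ∀ q, π j (Q j q) ∈ LocalRep.mirrorAlg (mainRep ιA ιB) (auxRep ιA ιB)
        mainRep_commute_auxRep (jointVec Ψ) j := fun q => ⟨B j q, hB j q⟩
      refine sum_mem fun q _ => ?_
      rw [map_smul]
      exact StarSubalgebra.smul_mem _ (hq q) _
  -- Taking the mirrored operators as the subalgebra `𝒮` ensures that both parts of `π` are mirrored
  -- too.
  choose α β hsum hα hβ hαs hβs hαm hβm using fun j =>
    exists_antihom_add_hom (π j) (hπj j) (hπs j) _ (hmem j)
  have key : ∀ (a : ∀ j, 𝒜 j) (X : ∀ j, Matrix (Fin (n j)) (Fin (n j)) ℂ),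
      inner ℂ (jointVec Ψ) ((mainRep ιA ιB).op (fun j => E j (a j) * π j (X j)) (jointVec Ψ)) =
        (∏ j, (Fintype.card (𝒜 j) : ℂ)⁻¹) *
          tensorExpect emb ψ (fun j => star (U j (a j)) * X j * U j (a j)) := fun a X => by
    -- Both sides are multilinear in `X`, so it suffices to compare them on the spanning families
    -- `Q`, where the mirror images turn `f` into the observed statistics.
    let f : MultilinearMap ℂ (fun j => Matrix (Fin (n j)) (Fin (n j)) ℂ) ℂ :=
      ((innerSL ℂ (jointVec Ψ)).toLinearMap ∘ₗ
        (ContinuousLinearMap.apply ℂ _ (jointVec Ψ)).toLinearMap).compMultilinearMap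
        ((mainRep ιA ιB).op.compLinearMap fun j => LinearMap.mulLeft ℂ (E j (a j)) ∘ₗ π j)
    let g : MultilinearMap ℂ (fun j => Matrix (Fin (n j)) (Fin (n j)) ℂ) ℂ :=
      (∏ j, (Fintype.card (𝒜 j) : ℂ)⁻¹) •
        (tensorExpect emb ψ).compLinearMap fun j => conjMap (U j (a j))
    have hfg : f = g := MultilinearMap.ext_of_span hQ fun q => by
      refine Eq.trans ?_ (h a q)
      rw [expect_eq]
      change inner ℂ (jointVec Ψ) ((mainRep ιA ιB).op ((fun j => E j (a j)) * (fun j => π j (Q j (q j))))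
        (jointVec Ψ)) = _
      rw [LocalRep.op_mul_apply, LocalRep.op_eq_of_single_eq mainRep_commute_auxRep
        fun j => (hB j (q j)).eq]
    exact congrArg (fun F => F X) hfg
  let D : ∀ j, TeleportData (Hil (ιA j) →L[ℂ] Hil (ιA j)) (d j) (n j) (𝒜 j) := fun j =>
    { emb := emb j
      emb_injective := hemb j
      M := E j
      M_proj := hE j
      M_sum := hE1 j
      U := U j
      U_mul_star := hU j
      α := α j
      β := β j
      α_mul := hα j
      β_mul := hβ j
      α_star := hαs j
      β_star := hβs j
      proj := hsum j 1 ▸ hπ1 j }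
  refine extractsHeralded_of_teleportData Ψ hΨ hψ D hn hαm hβm fun i k => ?_
  -- The statistics for outcome `a` undo the conjugation in `conjUnit`, so all outcomes contribute
  -- equally; their number cancels the normalisation.
  have h1 : ∀ a : ∀ j, 𝒜 j, inner ℂ (jointVec Ψ)
      ((mainRep ιA ιB).op (fun j => (D j).M (a j) *
        ((D j).α ((D j).conjUnit (a j) ((D j).emb (i j)) ((D j).emb (k j))) +
          (D j).β ((D j).conjUnit (a j) ((D j).emb (i j)) ((D j).emb (k j))))) (jointVec Ψ)) =
      (∏ j, (Fintype.card (𝒜 j) : ℂ)⁻¹) * (conj (ψ i) * ψ k) := fun a => by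
    rw [← tensorExpect_single hemb]
    have e : ∀ j, star (U j (a j)) * (D j).conjUnit (a j) (emb j (i j)) (emb j (k j)) *
        U j (a j) = Matrix.single (emb j (i j)) (emb j (k j)) 1 := fun j => by
      have hu : star (U j (a j)) * U j (a j) = 1 := mul_eq_one_comm.1 (hU j (a j))
      simp only [TeleportData.conjUnit, D]
      rw [mul_assoc, mul_assoc, hu, mul_one, ← mul_assoc, hu, one_mul]
    have := key a fun j => (D j).conjUnit (a j) (emb j (i j)) (emb j (k j))
    simp_rw [e] at this
    rw [← this]
    simp_rw [hsum]
    rfl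
  simp_rw [h1]
  rw [Finset.sum_const, Finset.card_univ, Fintype.card_pi, nsmul_eq_mul, ← mul_assoc, Nat.cast_prod,
    ← Finset.prod_mul_distrib, Finset.prod_eq_one, one_mul]
  intro j _
  exact mul_inv_cancel₀ (Nat.cast_ne_zero.2 Fintype.card_ne_zero)

end Tomography

/-! ### Jordan homomorphisms from finite families of hermitian matrices -/

section JordanFamilies

/-- A linear section of the map from coefficients to combinations of `h` yields `π`; the relations
make its value at `h t` independent of the section. -/
theorem exists_linearMap_of_relations {T V W : Type*} [Fintype T] [AddCommGroup V] [Module ℂ V]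
    [AddCommGroup W] [Module ℂ W] {h : T → V} (hspan : Submodule.span ℂ (Set.range h) = ⊤)
    {e : T → W} (hrel : ∀ c : T → ℂ, ∑ t, c t • h t = 0 → ∑ t, c t • e t = 0) :
    ∃ π : V →ₗ[ℂ] W, ∀ t, π (h t) = e t := by
  classical
  have hsurj : Function.Surjective (Fintype.linearCombination ℂ h) := by
    rw [← LinearMap.range_eq_top, Fintype.range_linearCombination, hspan]
  obtain ⟨r, hr⟩ := (Fintype.linearCombination ℂ h).exists_rightInverse_of_surjective
    (LinearMap.range_eq_top.2 hsurj)
  refine ⟨Fintype.linearCombination ℂ e ∘ₗ r, fun t => ?_⟩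
  have h1 : Fintype.linearCombination ℂ h (r (h t) - Pi.single t 1) = 0 := by
    rw [map_sub, Fintype.linearCombination_apply_single, one_smul]
    exact sub_eq_zero.2 (LinearMap.congr_fun hr (h t))
  have h2 : Fintype.linearCombination ℂ e (r (h t) - Pi.single t 1) = 0 := hrel _ h1
  rw [map_sub, Fintype.linearCombination_apply_single, one_smul, sub_eq_zero] at h2
  exact h2

variable {𝔸 : Type*} [Ring 𝔸] [Algebra ℂ 𝔸] {n : ℕ}

theorem jordan_of_span {T : Type*} [Fintype T] {h : T → Matrix (Fin n) (Fin n) ℂ}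
    (hspan : Submodule.span ℂ (Set.range h) = ⊤) {π : Matrix (Fin n) (Fin n) ℂ →ₗ[ℂ] 𝔸}
    (hj : ∀ s t, π (h s * h t) + π (h t * h s) = π (h s) * π (h t) + π (h t) * π (h s))
    (X Y : Matrix (Fin n) (Fin n) ℂ) : π (X * Y) + π (Y * X) = π X * π Y + π Y * π X := by
  have hX : ∀ X : Matrix (Fin n) (Fin n) ℂ, ∃ c : T → ℂ, ∑ t, c t • h t = X := fun X =>
    (Submodule.mem_span_range_iff_exists_fun ℂ).1 (hspan ▸ Submodule.mem_top)
  obtain ⟨c, rfl⟩ := hX X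
  obtain ⟨c', rfl⟩ := hX Y
  have e : ∀ (c c' : T → ℂ), π ((∑ t, c t • h t) * ∑ t, c' t • h t) =
      ∑ s, ∑ t, (c s * c' t) • π (h s * h t) := fun c c' => by
    simp_rw [Finset.sum_mul_sum, smul_mul_smul_comm, map_sum, map_smul]
  have e' : ∀ (c c' : T → ℂ), π (∑ t, c t • h t) * π (∑ t, c' t • h t) =
      ∑ s, ∑ t, (c s * c' t) • (π (h s) * π (h t)) := fun c c' => by
    simp_rw [map_sum, map_smul, Finset.sum_mul_sum, smul_mul_smul_comm]
  rw [e, e, e', e', Finset.sum_comm (f := fun s t => (c' s * c t) • π (h s * h t)),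
    Finset.sum_comm (f := fun s t => (c' s * c t) • (π (h s) * π (h t))),
    ← Finset.sum_add_distrib, ← Finset.sum_add_distrib]
  refine Finset.sum_congr rfl fun s _ => ?_
  rw [← Finset.sum_add_distrib, ← Finset.sum_add_distrib]
  refine Finset.sum_congr rfl fun t _ => ?_
  rw [mul_comm (c' t), ← smul_add, ← smul_add, hj]

theorem map_star_of_span [StarRing 𝔸] [StarModule ℂ 𝔸] {T : Type*} [Fintype T] {h : T → Matrix (Fin n) (Fin n) ℂ}
    (hspan : Submodule.span ℂ (Set.range h) = ⊤) (hh : ∀ t, star (h t) = h t)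
    {π : Matrix (Fin n) (Fin n) ℂ →ₗ[ℂ] 𝔸} (hs : ∀ t, star (π (h t)) = π (h t))
    (X : Matrix (Fin n) (Fin n) ℂ) : π (star X) = star (π X) := by
  obtain ⟨c, rfl⟩ := (Submodule.mem_span_range_iff_exists_fun ℂ).1 (hspan ▸ Submodule.mem_top (x := X))
  simp_rw [map_sum, star_sum, star_smul, hh, map_sum, map_smul, star_smul, hs]

end JordanFamilies

/-! ### Pauli matrices -/

section Pauli

theorem star_pauli (k : Fin 3) : star (pauli k) = pauli k := by
  fin_cases k <;> ext i j <;> fin_cases i <;> fin_cases j <;> simp [pauli, Matrix.star_apply]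

theorem pauli_mul_self (k : Fin 3) : pauli k * pauli k = 1 := by
  fin_cases k <;> ext i j <;> fin_cases i <;> fin_cases j <;>
    simp [pauli]

theorem pauli_anticomm {k l : Fin 3} (h : k ≠ l) : pauli k * pauli l + pauli l * pauli k = 0 := by
  fin_cases k <;> fin_cases l <;> first | exact absurd rfl h | skip
  all_goals
    ext i j
    fin_cases i <;> fin_cases j <;> simp [pauli]

/-- The identity and the Pauli matrices. -/
def pauliFamily : Option (Fin 3) → Matrix (Fin 2) (Fin 2) ℂ
  | none => 1
  | some k => pauli k

theorem pauliFamily_coeff (X : Matrix (Fin 2) (Fin 2) ℂ) :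
    ((X 0 0 + X 1 1) / 2) • (1 : Matrix (Fin 2) (Fin 2) ℂ) + (((X 0 0 - X 1 1) / 2) • pauli 0 +
      ((X 0 1 + X 1 0) / 2) • pauli 1 + ((X 0 1 - X 1 0) / 2 * Complex.I) • pauli 2) = X := by
  have hI : ∀ z : ℂ, z * Complex.I * Complex.I = -z := fun z => by
    rw [mul_assoc, Complex.I_mul_I, mul_neg_one]
  ext i j
  fin_cases i <;> fin_cases j <;> simp [pauli, hI] <;> ring

theorem span_pauliFamily : Submodule.span ℂ (Set.range pauliFamily) = ⊤ := by
  rw [eq_top_iff]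
  rintro X -
  have h : ∀ t, pauliFamily t ∈ Submodule.span ℂ (Set.range pauliFamily) := fun t =>
    Submodule.subset_span ⟨t, rfl⟩
  rw [← pauliFamily_coeff X]
  exact add_mem (Submodule.smul_mem _ _ (h none)) (add_mem (add_mem
    (Submodule.smul_mem _ _ (h (some 0))) (Submodule.smul_mem _ _ (h (some 1))))
    (Submodule.smul_mem _ _ (h (some 2))))

theorem pauliFamily_independent (c : Option (Fin 3) → ℂ) (hc : ∑ t, c t • pauliFamily t = 0) :
    c = 0 := by
  rw [Fintype.sum_option, Fin.sum_univ_three] at hc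
  have h := fun i j => congrFun (congrFun hc i) j
  have h00 := h 0 0
  have h01 := h 0 1
  have h10 := h 1 0
  have h11 := h 1 1
  simp [pauliFamily, pauli] at h00 h01 h10 h11
  have hI := Complex.I_mul_I
  funext t
  rcases t with _ | k
  · show c none = 0
    linear_combination (h00 + h11) / 2
  · fin_cases k
    · show c (some 0) = 0
      linear_combination (h00 - h11) / 2
    · show c (some 1) = 0
      linear_combination (h01 + h10) / 2
    · show c (some 2) = 0
      linear_combination (h01 - h10) / 2 * Complex.I + c (some 2) * hI

theorem pauliProj_span :
    Submodule.span ℂ (Set.range fun q : Fin 3 × Fin 2 => pauliProj q.1 q.2) = ⊤ := by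
  rw [eq_top_iff, ← span_pauliFamily, Submodule.span_le]
  have h : ∀ y b, pauliProj y b ∈
      Submodule.span ℂ (Set.range fun q : Fin 3 × Fin 2 => pauliProj q.1 q.2) := fun y b =>
    Submodule.subset_span ⟨(y, b), rfl⟩
  rintro _ ⟨_ | k, rfl⟩
  · have : pauliFamily none = pauliProj 0 0 + pauliProj 0 1 := by
      simp only [pauliFamily, pauliProj, Fin.val_zero, Fin.val_one, pow_zero, pow_one]
      module
    rw [this]
    exact add_mem (h _ _) (h _ _)
  · have : pauliFamily (some k) = pauliProj k 0 - pauliProj k 1 := by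
      simp only [pauliFamily, pauliProj, Fin.val_zero, Fin.val_one, pow_zero, pow_one]
      module
    rw [this]
    exact sub_mem (h _ _) (h _ _)

theorem correction_mul_star (a : Fin 2 × Fin 2) : correction a * star (correction a) = 1 := by
  obtain ⟨i, j⟩ := a
  fin_cases i <;> fin_cases j <;>
    simp [correction, star_mul, star_pauli, pauli_mul_self, mul_assoc,
      ← mul_assoc (pauli 1) (pauli 1)]

/-- Anticommuting reflections of a corner yield a Jordan homomorphism of the matrices of order
two. -/
theorem exists_jordan_pauli {𝔸 : Type*} [Ring 𝔸] [StarRing 𝔸] [Algebra ℂ 𝔸] [StarModule ℂ 𝔸]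
    {P : 𝔸} (hP : IsStarProjection P) {T : Fin 3 → 𝔸} (hT : ∀ k, star (T k) = T k)
    (hPT : ∀ k, P * T k = T k) (hTT : ∀ k, T k * T k = P)
    (hanti : ∀ k l, k ≠ l → T k * T l + T l * T k = 0) :
    ∃ π : Matrix (Fin 2) (Fin 2) ℂ →ₗ[ℂ] 𝔸, π 1 = P ∧ (∀ k, π (pauli k) = T k) ∧
      (∀ X Y, π (X * Y) + π (Y * X) = π X * π Y + π Y * π X) ∧
      ∀ X, π (star X) = star (π X) := by
  have hTP : ∀ k, T k * P = T k := fun k => by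
    have := congrArg star (hPT k)
    rwa [star_mul, hT, hP.isSelfAdjoint.star_eq] at this
  obtain ⟨π, hπ⟩ := exists_linearMap_of_relations span_pauliFamily
    (e := fun t => t.elim P T) fun c hc => by simp [pauliFamily_independent c hc]
  have h1 : π 1 = P := hπ none
  have hk : ∀ k, π (pauli k) = T k := fun k => hπ (some k)
  refine ⟨π, h1, hk, jordan_of_span span_pauliFamily fun s t => ?_,
    map_star_of_span span_pauliFamily (fun t => ?_) fun t => ?_⟩
  · rcases s with _ | k <;> rcases t with _ | l <;> simp only [pauliFamily, hk, h1, one_mul, mul_one,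
      hPT, hTP, hP.isIdempotentElem.eq]
    rcases eq_or_ne k l with rfl | h
    · rw [pauli_mul_self, h1, hTT]
    · rw [← map_add, pauli_anticomm h, map_zero, hanti k l h]
  · rcases t with _ | k
    · exact star_one _
    · exact star_pauli k
  · rw [hπ]
    rcases t with _ | k
    · exact hP.isSelfAdjoint.star_eq
    · exact hT k

end Pauli

/-! ### Self-testing of the Pauli observables -/

section CHSH

theorem sqrt_two_sq : ((√2 : ℝ) : ℂ) * ((√2 : ℝ) : ℂ) = 2 := by
  rw [← Complex.ofReal_mul, Real.mul_self_sqrt (by norm_num)]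
  norm_num

theorem inv_sqrt_two_mul : (((√2 : ℝ) : ℂ))⁻¹ * ((√2 : ℝ) : ℂ) = 1 :=
  inv_mul_cancel₀ fun h => by
    have := sqrt_two_sq
    rw [h] at this
    norm_num at this

/-! ### The CHSH inequality for unit vectors. -/

section Vectors

variable {H : Type*} [NormedAddCommGroup H] [InnerProductSpace ℂ H] {u₀ u₁ v₀ v₁ : H}

/-- In the expansion, the overlap of `v₀` and `v₁` cancels by the parallelogram law, and the
remaining cross terms form the CHSH expression. Bound and rigidity are read off from this identity.
-/
theorem chsh_sum_of_squares (hu₀ : ‖u₀‖ = 1) (hu₁ : ‖u₁‖ = 1) (hv₀ : ‖v₀‖ = 1) (hv₁ : ‖v₁‖ = 1) :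
    ‖((√2 : ℝ) : ℂ) • u₀ - (v₀ + v₁)‖ ^ 2 + ‖((√2 : ℝ) : ℂ) • u₁ - (v₀ - v₁)‖ ^ 2 =
      8 - 2 * √2 * (inner ℂ u₀ v₀ + inner ℂ u₀ v₁ + inner ℂ u₁ v₀ - inner ℂ u₁ v₁ : ℂ).re := by
  have h2 : √2 ^ 2 = (2 : ℝ) := Real.sq_sqrt (by norm_num)
  rw [@norm_sub_sq ℂ, @norm_sub_sq ℂ _ _ _ _ (_ • u₁), @norm_sub_sq ℂ _ _ _ _ v₀,
    @norm_add_sq ℂ, norm_smul, norm_smul, hu₀, hu₁, hv₀, hv₁, inner_smul_left, inner_smul_left,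
    inner_add_right, inner_sub_right, Complex.conj_ofReal]
  simp only [RCLike.re_to_complex, Complex.re_ofReal_mul, Complex.add_re, Complex.sub_re,
    Complex.norm_real, Real.norm_eq_abs, abs_of_nonneg (Real.sqrt_nonneg 2)]
  linear_combination 2 * h2

theorem chsh_le (hu₀ : ‖u₀‖ = 1) (hu₁ : ‖u₁‖ = 1) (hv₀ : ‖v₀‖ = 1) (hv₁ : ‖v₁‖ = 1) :
    (inner ℂ u₀ v₀ + inner ℂ u₀ v₁ + inner ℂ u₁ v₀ - inner ℂ u₁ v₁ : ℂ).re ≤ 2 * √2 := by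
  have h2 : √2 * √2 = (2 : ℝ) := Real.mul_self_sqrt (by norm_num)
  have h0 : 0 < √2 := by positivity
  have h := chsh_sum_of_squares hu₀ hu₁ hv₀ hv₁
  have h' : 0 ≤ 8 - 2 * √2 *
      (inner ℂ u₀ v₀ + inner ℂ u₀ v₁ + inner ℂ u₁ v₀ - inner ℂ u₁ v₁ : ℂ).re := by
    rw [← h]
    positivity
  refine le_of_mul_le_mul_left ?_ h0
  linarith

theorem eq_of_chsh_eq (hu₀ : ‖u₀‖ = 1) (hu₁ : ‖u₁‖ = 1) (hv₀ : ‖v₀‖ = 1) (hv₁ : ‖v₁‖ = 1)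
    (h : (inner ℂ u₀ v₀ + inner ℂ u₀ v₁ + inner ℂ u₁ v₀ - inner ℂ u₁ v₁ : ℂ).re = 2 * √2) :
    ((√2 : ℝ) : ℂ) • u₀ = v₀ + v₁ ∧ ((√2 : ℝ) : ℂ) • u₁ = v₀ - v₁ := by
  have h2 : √2 * √2 = (2 : ℝ) := Real.mul_self_sqrt (by norm_num)
  have hs := chsh_sum_of_squares hu₀ hu₁ hv₀ hv₁
  rw [h] at hs
  have h0 : ‖((√2 : ℝ) : ℂ) • u₀ - (v₀ + v₁)‖ ^ 2 = 0 := by nlinarith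
  have h1 : ‖((√2 : ℝ) : ℂ) • u₁ - (v₀ - v₁)‖ ^ 2 = 0 := by nlinarith
  exact ⟨sub_eq_zero.1 (norm_eq_zero.1 (pow_eq_zero_iff two_ne_zero |>.1 h0)),
    sub_eq_zero.1 (norm_eq_zero.1 (pow_eq_zero_iff two_ne_zero |>.1 h1))⟩

end Vectors

theorem star_sub_of_projections {R : Type*} [Ring R] [StarRing R] {p q : R}
    (hp : IsStarProjection p) (hq : IsStarProjection q) : star (p - q) = p - q := by
  rw [star_sub, hp.isSelfAdjoint.star_eq, hq.isSelfAdjoint.star_eq]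

theorem sub_mul_sub_of_projections {R : Type*} [Ring R] [StarRing R] {p q : R}
    (hp : IsStarProjection p) (h : p + q = 1) : (p - q) * (p - q) = 1 := by
  obtain rfl : q = 1 - p := by rw [← h]; abel
  have := hp.isIdempotentElem.eq
  simp only [sub_mul, mul_sub, this, one_mul, mul_one]
  abel

namespace LocalRep

variable {N : ℕ} {𝔸 𝔹 : Fin N → Type*} [∀ j, Ring (𝔸 j)] [∀ j, StarRing (𝔸 j)]
  [∀ j, Algebra ℂ (𝔸 j)] [∀ j, Ring (𝔹 j)] [∀ j, StarRing (𝔹 j)] [∀ j, Algebra ℂ (𝔹 j)]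
  {H : Type*} [NormedAddCommGroup H] [InnerProductSpace ℂ H] [CompleteSpace H]
  {L : LocalRep 𝔸 H} {M : LocalRep 𝔹 H} {Ψ : H}

theorem norm_single_apply (L : LocalRep 𝔸 H) {j : Fin N} {s : 𝔸 j} (hs : star s = s)
    (h : s * s = 1) (v : H) : ‖L.single j s v‖ = ‖v‖ := by
  have h1 : inner ℂ (L.single j s v) (L.single j s v) = inner ℂ v v := by
    rw [inner_single_left, hs, ← mul_apply_eq_comp, ← LocalRep.single_mul, h, single_one]
    rfl
  simp_rw [inner_self_eq_norm_sq_to_K] at h1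
  exact (pow_left_inj₀ (norm_nonneg _) (norm_nonneg _) two_ne_zero).1 (by exact_mod_cast h1)

/-- Since `√2 a` is mirrored by `b + b'`, so are the squares. The first is `2`, the second is `2`
plus the anticommutator. -/
theorem anticomm_apply (hc : ∀ S T, Commute (L.op S) (M.op T)) {j : Fin N} {a : 𝔸 j} {b b' : 𝔹 j}
    (ha : a * a = 1) (hb : b * b = 1) (hb' : b' * b' = 1)
    (h : ((√2 : ℝ) : ℂ) • L.single j a Ψ = M.single j b Ψ + M.single j b' Ψ) :
    M.single j (b * b' + b' * b) Ψ = 0 := by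
  have h1 : L.single j (((√2 : ℝ) : ℂ) • a) Ψ = M.single j (b + b') Ψ := by
    rw [map_smul, map_add]
    exact h
  have h2 := mirror_mul hc h1 h1
  rw [smul_mul_smul_comm, sqrt_two_sq, ha, map_smul, single_one] at h2
  have h3 : (b + b') * (b + b') = (2 : ℂ) • (1 : 𝔹 j) + (b * b' + b' * b) := by
    simp only [add_mul, mul_add, hb, hb']
    rw [two_smul]
    abel
  rw [h3, map_add, map_smul, single_one] at h2
  exact left_eq_add.1 h2

theorem Mirror.add {j : Fin N} {s s' : 𝔸 j} {t t' : 𝔹 j} (h : Mirror L M Ψ j s t)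
    (h' : Mirror L M Ψ j s' t') : Mirror L M Ψ j (s + s') (t + t') := by
  refine ⟨?_, ?_⟩
  · rw [map_add, map_add, _root_.add_apply, _root_.add_apply, h.eq, h'.eq]
  · rw [star_add, star_add, map_add, map_add, _root_.add_apply, _root_.add_apply, h.star_eq,
      h'.star_eq]

theorem Mirror.smul [∀ j, StarModule ℂ (𝔸 j)] [∀ j, StarModule ℂ (𝔹 j)] {j : Fin N} {s : 𝔸 j} {t : 𝔹 j} (h : Mirror L M Ψ j s t) (c : ℂ) :
    Mirror L M Ψ j (c • s) (c • t) := by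
  refine ⟨?_, ?_⟩
  · rw [map_smul, map_smul, _root_.smul_apply, _root_.smul_apply, h.eq]
  · rw [star_smul, star_smul, map_smul, map_smul, _root_.smul_apply, _root_.smul_apply, h.star_eq]

/-- If three CHSH inequalities between a main and an auxiliary party are violated maximally, then
a real representation of the matrices of order two is mirrored by the observables of the auxiliary
party. -/
theorem exists_jordan_of_chsh [∀ j, StarModule ℂ (𝔸 j)]
    (hc : ∀ S T, Commute (L.op S) (M.op T)) (hΨ : ‖Ψ‖ = 1) {j : Fin N}
    {P : 𝔸 j} (hP : IsSupport L Ψ j P) {A : Fin 6 → 𝔸 j} {B : Fin 3 → 𝔹 j}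
    (hA : ∀ x, star (A x) = A x) (hAA : ∀ x, A x * A x = 1) (hB : ∀ y, star (B y) = B y)
    (hBB : ∀ y, B y * B y = 1) {c : Fin 6 → Fin 3 → ℂ}
    (hcorr : ∀ x y, c x y = inner ℂ Ψ (L.single j (A x) (M.single j (B y) Ψ)))
    (h : (c 0 0 + c 0 1 + c 1 0 - c 1 1) + (c 2 0 + c 2 2 + c 3 0 - c 3 2) +
      (c 4 1 + c 4 2 + c 5 1 - c 5 2) = 6 * (√2 : ℂ)) :
    ∃ π : Matrix (Fin 2) (Fin 2) ℂ →ₗ[ℂ] 𝔸 j, π 1 = P ∧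
      (∀ k, Mirror L M Ψ j (π (pauli k)) (B k)) ∧
      (∀ X Y, π (X * Y) + π (Y * X) = π X * π Y + π Y * π X) ∧
      ∀ X, π (star X) = star (π X) := by
  have hc' : ∀ x y, c x y = inner ℂ (L.single j (A x) Ψ) (M.single j (B y) Ψ) := fun x y => by
    rw [hcorr, inner_single_left, hA]
  have hu : ∀ x, ‖L.single j (A x) Ψ‖ = 1 := fun x => by
    rw [norm_single_apply L (hA x) (hAA x), hΨ]
  have hv : ∀ y, ‖M.single j (B y) Ψ‖ = 1 := fun y => by
    rw [norm_single_apply M (hB y) (hBB y), hΨ]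
  have hle : ∀ x₀ x₁ y₀ y₁, (c x₀ y₀ + c x₀ y₁ + c x₁ y₀ - c x₁ y₁).re ≤ 2 * √2 :=
    fun x₀ x₁ y₀ y₁ => by
      simp_rw [hc']
      exact chsh_le (hu _) (hu _) (hv _) (hv _)
  have hre := congrArg Complex.re h
  have h6 : (6 * (√2 : ℂ)).re = 6 * √2 := by simp
  rw [h6, Complex.add_re, Complex.add_re] at hre
  have heq : ∀ x₀ x₁ y₀ y₁, (c x₀ y₀ + c x₀ y₁ + c x₁ y₀ - c x₁ y₁).re = 2 * √2 →
      ((√2 : ℝ) : ℂ) • L.single j (A x₀) Ψ = M.single j (B y₀) Ψ + M.single j (B y₁) Ψ ∧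
        ((√2 : ℝ) : ℂ) • L.single j (A x₁) Ψ = M.single j (B y₀) Ψ - M.single j (B y₁) Ψ :=
    fun x₀ x₁ y₀ y₁ he => by
      simp_rw [hc'] at he
      exact eq_of_chsh_eq (hu _) (hu _) (hv _) (hv _) he
  have l0 := hle 0 1 0 1
  have l1 := hle 2 3 0 2
  have l2 := hle 4 5 1 2
  -- Three values bounded by `2√2` with sum `6√2` are all maximal.
  obtain ⟨e0, e1⟩ := heq 0 1 0 1 (by linarith)
  obtain ⟨e2, e3⟩ := heq 2 3 0 2 (by linarith)
  obtain ⟨e4, e5⟩ := heq 4 5 1 2 (by linarith)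
  have a01 := anticomm_apply hc (hAA 0) (hBB 0) (hBB 1) e0
  have a02 := anticomm_apply hc (hAA 2) (hBB 0) (hBB 2) e2
  have a12 := anticomm_apply hc (hAA 4) (hBB 1) (hBB 2) e4
  have hanti : ∀ k l, k ≠ l → M.single j (B k * B l + B l * B k) Ψ = 0 := fun k l hkl => by
    fin_cases k <;> fin_cases l <;> first
      | exact absurd rfl hkl
      | assumption
      | (rw [add_comm]; assumption)
  set r : ℂ := (((√2 : ℝ) : ℂ))⁻¹
  have hr : r * ((√2 : ℝ) : ℂ) = 1 := inv_sqrt_two_mul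
  have hrr : r * r * 2 = 1 := by
    linear_combination (r * ((√2 : ℝ) : ℂ) + 1) * hr - r * r * sqrt_two_sq
  have hrs : star r = r := by
    simp [r]
  -- Inverting the relations of the first two CHSH pairs gives operators that mirror all three `B
  -- k`. The third pair is needed only for the anticommutator of `B 1` and `B 2`.
  let S : Fin 3 → 𝔸 j := ![r • (A 0 + A 1), r • (A 0 - A 1), r • (A 2 - A 3)]
  have hSs : ∀ k, star (S k) = S k := fun k => by
    fin_cases k <;> simp only [S] <;> simp [star_smul, hA, hrs]
  have hdiv : ∀ {u v : H}, ((√2 : ℝ) : ℂ) • u = v → u = r • v := by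
    rintro u _ rfl
    rw [smul_smul, hr, one_smul]
  have hS : ∀ k, L.single j (S k) Ψ = M.single j (B k) Ψ := fun k => by
    fin_cases k
    · change L.single j (r • (A 0 + A 1)) Ψ = M.single j (B 0) Ψ
      rw [map_smul, map_add, _root_.smul_apply, _root_.add_apply, hdiv e0, hdiv e1]
      linear_combination (norm := module) hrr • M.single j (B 0) Ψ
    · change L.single j (r • (A 0 - A 1)) Ψ = M.single j (B 1) Ψ
      rw [map_smul, map_sub, _root_.smul_apply, _root_.sub_apply, hdiv e0, hdiv e1]
      linear_combination (norm := module) hrr • M.single j (B 1) Ψ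
    · change L.single j (r • (A 2 - A 3)) Ψ = M.single j (B 2) Ψ
      rw [map_smul, map_sub, _root_.smul_apply, _root_.sub_apply, hdiv e2, hdiv e3]
      linear_combination (norm := module) hrr • M.single j (B 2) Ψ
  have hmir : ∀ k, Mirror L M Ψ j (S k) (B k) := fun k =>
    ⟨hS k, by rw [hSs, hB]; exact hS k⟩
  have hcomm : ∀ k, S k * P = P * S k := fun k => hP.commute hc ⟨_, hmir k⟩
  have hprod : ∀ k l, (S k * P) * (S l * P) = (S k * S l) * P := fun k l => by
    rw [hcomm l, mul_assoc, ← mul_assoc P, hP.proj.isIdempotentElem.eq, ← hcomm l, mul_assoc]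
  -- Products of the `S k` satisfy the Pauli relations only on `Ψ`. Multiplied by the support
  -- projection, with which the `S k` commute, they satisfy them as operators.
  obtain ⟨π, h1, hk, hj, hs⟩ := exists_jordan_pauli hP.proj (T := fun k => S k * P)
    (fun k => by rw [star_mul, hSs, hP.proj.isSelfAdjoint.star_eq, hcomm])
    (fun k => by rw [hcomm, ← mul_assoc, hP.proj.isIdempotentElem.eq])
    (fun k => by
      rw [hprod]
      have := hP.mul_eq (s := S k * S k) (t := 1) (by
        rw [mirror_mul hc (hS k) (hS k), hBB, single_one, single_one])
      rw [this, one_mul])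
    (fun k l hkl => by
      rw [hprod, hprod, ← add_mul]
      refine hP.mul_eq_zero _ ?_
      rw [map_add, _root_.add_apply, mirror_mul hc (hS k) (hS l), mirror_mul hc (hS l) (hS k),
        ← _root_.add_apply, ← map_add]
      exact hanti l k hkl.symm)
  refine ⟨π, h1, fun k => ?_, hj, hs⟩
  rw [hk]
  refine ⟨by rw [hP.single_mul, hS], ?_⟩
  rw [star_mul, hSs, hP.proj.isSelfAdjoint.star_eq, ← hcomm, hP.single_mul, hS, hB]

end LocalRep

theorem LocalRep.single_eq_update {N : ℕ} {𝔸 : Fin N → Type*} [∀ j, Ring (𝔸 j)]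
    [∀ j, StarRing (𝔸 j)] [∀ j, Algebra ℂ (𝔸 j)] {H : Type*} [NormedAddCommGroup H]
    [InnerProductSpace ℂ H] [CompleteSpace H] (L : LocalRep 𝔸 H) (j : Fin N) (s : 𝔸 j) :
    L.single j s = L.op (Function.update (fun _ => 1) j s) := rfl

theorem vec_eq_half_smul {E : Type*} [Ring E] [Algebra ℂ E] {p q : E} (h : p + q = 1)
    (b : Fin 2) : ![p, q] b = (1 / 2 : ℂ) • (1 + (-1 : ℂ) ^ (b : ℕ) • (p - q)) := by
  rw [← h]
  fin_cases b
  · simp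
    module
  · simp
    module

/-- Every realisation of the reference correlations for the `N`-qubit state `ψ` allows the
extraction of `ψ` up to heralded conjugations. -/
theorem extractsHeralded_of_isReference {N : ℕ} {ψ : (Fin N → Fin 2) → ℂ} (hψ : IsUnitVector ψ)
    {ιA ιB : Fin N → Type u} (R : QubitExperiment ιA ιB) (hproj : R.IsProjective)
    (hR : R.IsReference ψ) : ExtractsHeralded R.state ψ := by
  classical
  have hΨ : ‖jointVec R.state‖ = 1 := by rw [norm_jointVec, R.norm_state]
  choose P hP using exists_isSupport (ιB := ιB) (jointVec R.state)
  have hA1 : ∀ j x, R.A j (.chsh x) (0 : Fin 2) + R.A j (.chsh x) (1 : Fin 2) = 1 := fun j x =>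
    (Fin.sum_univ_two (f := R.A j (.chsh x))).symm.trans (R.A_sum j (.chsh x))
  have hB1 : ∀ j y, R.B j y 0 + R.B j y 1 = 1 := fun j y =>
    (Fin.sum_univ_two (f := R.B j y)).symm.trans (R.B_sum j y)
  have hπ := fun j => LocalRep.exists_jordan_of_chsh (L := mainRep ιA ιB) (M := auxRep ιA ιB)
    mainRep_commute_auxRep hΨ (hP j) (A := R.obsA j) (B := R.obsB j)
    (fun x => star_sub_of_projections (hproj.1 _ _ _) (hproj.1 _ _ _))
    (fun x => sub_mul_sub_of_projections (hproj.1 _ _ _) (hA1 j x))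
    (fun y => star_sub_of_projections (hproj.2 _ _ _) (hproj.2 _ _ _))
    (fun y => sub_mul_sub_of_projections (hproj.2 _ _ _) (hB1 j y))
    (c := R.correlator j) (fun x y => by
      rw [QubitExperiment.correlator, expect_eq, LocalRep.single_eq_update,
        LocalRep.single_eq_update]) (hR.1 j)
  choose π h1 hmir hj hs using hπ
  refine extractsHeralded_of_jordan R.state R.norm_state hψ (n := fun _ => 2) (fun _ => two_ne_zero)
    (fun _ => id) (fun _ => Function.injective_id) (𝒜 := fun _ => Fin 2 × Fin 2)
    (fun j a => R.A j .diamond a) (fun j a => hproj.1 _ _ _) (fun j => R.A_sum j .diamond)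
    (fun _ => correction) (fun _ => correction_mul_star) π (fun j => (h1 j).symm ▸ (hP j).proj)
    hj hs (𝒬 := fun _ => Fin 3 × Fin 2) (fun _ q => pauliProj q.1 q.2) (fun _ => pauliProj_span)
    (fun j q => R.B j q.1 q.2) (fun j q => ?_) fun a q => ?_
  · obtain ⟨y, b⟩ := q
    have hmem1 : LocalRep.Mirror (mainRep ιA ιB) (auxRep ιA ιB) (jointVec R.state) j (π j 1) 1 :=
      (h1 j).symm ▸ (hP j).mirror
    have hBy : R.B j y b = (1 / 2 : ℂ) • (1 + (-1 : ℂ) ^ (b : ℕ) • R.obsB j y) := by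
      rw [QubitExperiment.obsB, ← vec_eq_half_smul (hB1 j y)]
      fin_cases b <;> rfl
    have h2 := (hmem1.add ((hmir j y).smul ((-1 : ℂ) ^ (b : ℕ)))).smul (1 / 2)
    rw [← hBy, ← map_smul, ← map_add, ← map_smul] at h2
    exact h2
  · refine (hR.2 a (fun j => (q j).1) (fun j => (q j).2)).trans ?_
    rw [tensorExpect_apply]
    have e : (1 / 4 ^ N : ℂ) = ∏ _j : Fin N, (Fintype.card (Fin 2 × Fin 2) : ℂ)⁻¹ := by
      simp
    rw [e]
    rfl

end CHSH

/-! ### Operators given by finite matrices -/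

section MatrixOperators

theorem isPositive_star_mul_self {E : Type*} [NormedAddCommGroup E] [InnerProductSpace ℂ E]
    [CompleteSpace E] (T : E →L[ℂ] E) : (star T * T).IsPositive :=
  (ContinuousLinearMap.nonneg_iff_isPositive _).1 (star_mul_self_nonneg T)

variable {ι : Type*} [Fintype ι] [DecidableEq ι]

/-- The operator with a given finite matrix. -/
def matOp : Matrix ι ι ℂ ≃⋆ₐ[ℂ] (Hil ι →L[ℂ] Hil ι) :=
  Matrix.toEuclideanCLM.trans (lpPiLpₗᵢ (p := 2) (fun _ : ι => ℂ) ℂ).symm.conjStarAlgEquiv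

theorem matOp_apply (M : Matrix ι ι ℂ) (v : Hil ι) (y : ι) :
    matOp M v y = ∑ x, M y x * v x := rfl

theorem entry_matOp (M : Matrix ι ι ℂ) (y x : ι) : entry (matOp M) y x = M y x := by
  rw [entry_eq, matOp_apply, Finset.sum_eq_single x]
  · rw [ket_apply, if_pos rfl, mul_one]
  · intro z _ hz
    rw [ket_apply, if_neg hz, mul_zero]
  · simp

theorem matOp_isPositive {M : Matrix ι ι ℂ} (h : ∃ B : Matrix ι ι ℂ, M = star B * B) :
    (matOp M).IsPositive := by
  obtain ⟨B, rfl⟩ := h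
  rw [map_mul, map_star]
  exact isPositive_star_mul_self _

theorem isStarProjection_matOp {M : Matrix ι ι ℂ} (h : IsStarProjection M) :
    IsStarProjection (matOp M) := h.map matOp

end MatrixOperators

/-! ### Expectation values in network states. -/

section Network

variable {N : ℕ} {d n : Fin N → ℕ}

/-- The matrix of a joint observable of the two systems of a main party and of the auxiliary
party, reduced to the first system of the main party. -/
def reduced {d n : ℕ} (S : Matrix (Fin d × Fin n) (Fin d × Fin n) ℂ)
    (T : Matrix (Fin n) (Fin n) ℂ) : Matrix (Fin d) (Fin d) ℂ :=
  Matrix.of fun i k => (n : ℂ)⁻¹ * ∑ m, ∑ l, S (i, m) (k, l) * T m l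

/-- Separates the register indices from the indices of the entangled pairs. -/
def networkEquiv (d n : Fin N → ℕ) :
    ((∀ j, Fin (d j)) × (∀ j, Fin (d j))) ×
        (∀ j, (Fin (n j) × Fin (n j)) × (Fin (n j) × Fin (n j))) ≃
      ((∀ j, Fin (d j) × Fin (n j)) × (∀ j, Fin (n j))) ×
        ((∀ j, Fin (d j) × Fin (n j)) × (∀ j, Fin (n j))) where
  toFun z := ((fun j => (z.1.1 j, (z.2 j).1.1), fun j => (z.2 j).1.2),
    (fun j => (z.1.2 j, (z.2 j).2.1), fun j => (z.2 j).2.2))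
  invFun w := ((fun j => (w.1.1 j).1, fun j => (w.2.1 j).1),
    fun j => (((w.1.1 j).2, w.1.2 j), ((w.2.1 j).2, w.2.2 j)))
  left_inv _ := rfl
  right_inv _ := rfl

theorem reduced_eq_sum {d n : ℕ} (S : Matrix (Fin d × Fin n) (Fin d × Fin n) ℂ)
    (T : Matrix (Fin n) (Fin n) ℂ) (i k : Fin d) :
    reduced S T i k = ∑ q : (Fin n × Fin n) × (Fin n × Fin n),
      (if q.1.1 = q.1.2 then (((√(n : ℝ))⁻¹ : ℝ) : ℂ) else 0) *
        (S (i, q.1.1) (k, q.2.1) * T q.1.2 q.2.2) *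
        (if q.2.1 = q.2.2 then (((√(n : ℝ))⁻¹ : ℝ) : ℂ) else 0) := by
  simp only [Fintype.sum_prod_type, mul_ite, ite_mul, zero_mul, mul_zero, Finset.sum_ite_eq,
    Finset.mem_univ, if_true]
  have h : ∀ x y : Fin n, (∑ m : Fin n, if x = m then (((√(n : ℝ))⁻¹ : ℝ) : ℂ) *
      (S (i, x) (k, y) * T m y) * (((√(n : ℝ))⁻¹ : ℝ) : ℂ) else 0) =
      (n : ℂ)⁻¹ * (S (i, x) (k, y) * T x y) := fun x y => by
    have := TeleportData.sqrt_inv_mul_self n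
    rw [Complex.star_def, Complex.conj_ofReal] at this
    rw [Finset.sum_ite_eq, if_pos (Finset.mem_univ _), ← this]
    ring
  rw [reduced, Matrix.of_apply, Finset.mul_sum]
  refine Finset.sum_congr rfl fun x _ => ?_
  rw [Finset.sum_comm, Finset.mul_sum]
  exact Finset.sum_congr rfl fun y _ => (h x y).symm

theorem conj_ite_ofReal (p : Prop) [Decidable p] (r : ℝ) :
    conj (if p then (r : ℂ) else 0) = if p then (r : ℂ) else 0 := by
  split_ifs
  · exact Complex.conj_ofReal _
  · exact map_zero _

theorem conj_netState (Θ : (∀ j, Fin (d j)) → ℂ) (x) :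
    conj (netState n Θ x) = conj (Θ fun j => (x.1 j).1) *
      ∏ j, if (x.1 j).2 = x.2 j then (((√(n j : ℝ))⁻¹ : ℝ) : ℂ) else 0 := by
  simp only [netState, map_mul, map_prod, conj_ite_ofReal]

/-- Expectation values in a network state. -/
theorem expect_netState (Θ : (∀ j, Fin (d j)) → ℂ)
    (S : ∀ j, Matrix (Fin (d j) × Fin (n j)) (Fin (d j) × Fin (n j)) ℂ)
    (T : ∀ j, Matrix (Fin (n j)) (Fin (n j)) ℂ) :
    expect (netState n Θ) (fun j => matOp (S j)) (fun j => matOp (T j)) =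
      ∑ i, ∑ k, conj (Θ i) * (∏ j, reduced (S j) (T j) (i j) (k j)) * Θ k := by
  have h1 : expect (netState n Θ) (fun j => matOp (S j)) (fun j => matOp (T j)) =
      ∑ w : ((∀ j, Fin (d j) × Fin (n j)) × (∀ j, Fin (n j))) ×
        ((∀ j, Fin (d j) × Fin (n j)) × (∀ j, Fin (n j))),
        conj (netState n Θ w.1) * (((∏ j, S j (w.1.1 j) (w.2.1 j)) * ∏ j, T j (w.1.2 j) (w.2.2 j)) *
          netState n Θ w.2) := by
    rw [Fintype.sum_prod_type, expect, tsum_fintype]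
    refine Finset.sum_congr rfl fun y _ => ?_
    rw [localApply, tsum_fintype, Finset.mul_sum]
    simp_rw [entry_matOp]
  rw [h1, ← (networkEquiv d n).sum_comp, Fintype.sum_prod_type, Fintype.sum_prod_type]
  refine Finset.sum_congr rfl fun i _ => Finset.sum_congr rfl fun k _ => ?_
  simp_rw [reduced_eq_sum]
  rw [Finset.prod_univ_sum, Fintype.piFinset_univ, Finset.mul_sum, Finset.sum_mul]
  refine Finset.sum_congr rfl fun q _ => ?_
  rw [conj_netState, Finset.prod_mul_distrib, Finset.prod_mul_distrib, Finset.prod_mul_distrib]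
  change conj (Θ i) * (∏ j, if (q j).1.1 = (q j).1.2 then (((√(n j : ℝ))⁻¹ : ℝ) : ℂ) else 0) *
    (((∏ j, S j (i j, (q j).1.1) (k j, (q j).2.1)) * ∏ j, T j (q j).1.2 (q j).2.2) *
      (Θ k * ∏ j, if (q j).2.1 = (q j).2.2 then (((√(n j : ℝ))⁻¹ : ℝ) : ℂ) else 0)) = _
  ring

/-- On a maximally entangled state an operator moves to the other side as its transpose. This is why
the reference observables of the main parties are transposed. -/
theorem reduced_kronecker {d n : ℕ} (s t : Matrix (Fin n) (Fin n) ℂ) :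
    reduced (Matrix.kroneckerMap (· * ·) (1 : Matrix (Fin d) (Fin d) ℂ) s) t =
      ((n : ℂ)⁻¹ * (s.transpose * t).trace) • 1 := by
  ext i k
  rw [reduced, Matrix.of_apply, Matrix.smul_apply, Matrix.trace, smul_eq_mul, mul_assoc]
  congr 1
  simp only [Matrix.diag_apply, Matrix.mul_apply, Matrix.kroneckerMap_apply,
    Matrix.transpose_apply, Finset.sum_mul]
  rw [Finset.sum_comm]
  refine Finset.sum_congr rfl fun x _ => Finset.sum_congr rfl fun y _ => ?_
  ring

theorem reduced_one {d n : ℕ} (hn : n ≠ 0) :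
    reduced (1 : Matrix (Fin d × Fin n) (Fin d × Fin n) ℂ) 1 = 1 := by
  rw [← Matrix.one_kronecker_one]
  refine (reduced_kronecker _ _).trans ?_
  rw [Matrix.transpose_one, mul_one, Matrix.trace_one, Fintype.card_fin,
    inv_mul_cancel₀ (Nat.cast_ne_zero.2 hn), one_smul]

/-- Expectation values of observables that do not act on the shared state. -/
theorem expect_netState_of_scalar {Θ : (∀ j, Fin (d j)) → ℂ} (hΘ : IsUnitVector Θ)
    {S : ∀ j, Matrix (Fin (d j) × Fin (n j)) (Fin (d j) × Fin (n j)) ℂ}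
    {T : ∀ j, Matrix (Fin (n j)) (Fin (n j)) ℂ} {c : Fin N → ℂ}
    (h : ∀ j, reduced (S j) (T j) = c j • 1) :
    expect (netState n Θ) (fun j => matOp (S j)) (fun j => matOp (T j)) = ∏ j, c j := by
  rw [expect_netState]
  have h1 : ∀ i k : ∀ j, Fin (d j), ∏ j, reduced (S j) (T j) (i j) (k j) =
      if i = k then ∏ j, c j else 0 := fun i k => by
    simp_rw [h, Matrix.smul_apply, Matrix.one_apply, smul_eq_mul, mul_ite, mul_one, mul_zero]
    rw [Finset.prod_ite_zero]
    simp [funext_iff]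
  simp_rw [h1, mul_ite, ite_mul, mul_zero, zero_mul]
  simp only [Finset.sum_ite_eq, Finset.mem_univ, if_true]
  have h2 : ∑ i, conj (Θ i) * Θ i = 1 := by
    have : ((∑ i, ‖Θ i‖ ^ 2 : ℝ) : ℂ) = 1 := by
      rw [hΘ]
      norm_num
    rw [← this]
    push_cast
    exact Finset.sum_congr rfl fun i _ => Complex.conj_mul' (Θ i)
  calc _ = (∑ i, conj (Θ i) * Θ i) * ∏ j, c j := by
        rw [Finset.sum_mul]
        exact Finset.sum_congr rfl fun i _ => by ring
    _ = _ := by rw [h2, one_mul]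

/-! ### Teleportation measurements -/

variable {𝒜 : Type*} [Fintype 𝒜]

/-- The vector of a maximally entangled state, rotated by a unitary and restricted to a
subspace. -/
def bellVec {d n : ℕ} (emb : Fin d → Fin n) (U : Matrix (Fin n) (Fin n) ℂ) :
    Fin d × Fin n → ℂ :=
  fun x => (((√(n : ℝ))⁻¹ : ℝ) : ℂ) * conj (U x.2 (emb x.1))

/-- The operator of a teleportation measurement. -/
def bellOp {d n : ℕ} (emb : Fin d → Fin n) (U : Matrix (Fin n) (Fin n) ℂ) :
    Matrix (Fin d × Fin n) (Fin d × Fin n) ℂ :=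
  Matrix.vecMulVec (bellVec emb U) (star (bellVec emb U))

theorem bellOp_apply {d n : ℕ} (emb : Fin d → Fin n) (U : Matrix (Fin n) (Fin n) ℂ)
    (x y : Fin d × Fin n) :
    bellOp emb U x y = (n : ℂ)⁻¹ * (conj (U x.2 (emb x.1)) * U y.2 (emb y.1)) := by
  have := TeleportData.sqrt_inv_mul_self n
  rw [Complex.star_def, Complex.conj_ofReal] at this
  rw [bellOp, Matrix.vecMulVec_apply, Pi.star_apply, bellVec, bellVec, Complex.star_def, map_mul,
    Complex.conj_ofReal, Complex.conj_conj, ← this]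
  ring

/-- The teleportation identity: the outcome belonging to `U` occurs with weight `1 / n²` and has the
effect of evaluating `T` on the input rotated by `U`. -/
theorem reduced_bellOp {d n : ℕ} (emb : Fin d → Fin n) (U T : Matrix (Fin n) (Fin n) ℂ) :
    reduced (bellOp emb U) T =
      ((n : ℂ)⁻¹ * (n : ℂ)⁻¹) • (star U * T * U).submatrix emb emb := by
  ext i k
  rw [reduced, Matrix.of_apply, Matrix.smul_apply, Matrix.submatrix_apply, smul_eq_mul, mul_assoc]
  congr 1
  simp_rw [Matrix.mul_apply, Finset.sum_mul, Finset.mul_sum, bellOp_apply, Matrix.star_apply]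
  rw [Finset.sum_comm]
  refine Finset.sum_congr rfl fun x _ => Finset.sum_congr rfl fun y _ => ?_
  rw [Complex.star_def]
  ring

/-- Positivity of a rank-one operator. When `emb` is not onto, the rotated vector is cut down to a
subspace and `bellOp` need not be a projection, so only positivity is claimed. -/
theorem exists_bellOp_eq {d n : ℕ} (emb : Fin d → Fin n) (U : Matrix (Fin n) (Fin n) ℂ) :
    ∃ B, bellOp emb U = star B * B := by
  rcases isEmpty_or_nonempty (Fin d × Fin n) with h | ⟨⟨x⟩⟩
  · exact ⟨0, Subsingleton.elim _ _⟩
  · refine ⟨Matrix.vecMulVec (Pi.single x 1) (star (bellVec emb U)), ?_⟩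
    rw [Matrix.star_eq_conjTranspose, Matrix.conjTranspose_vecMulVec,
      Matrix.vecMulVec_mul_vecMulVec, star_star, bellOp]
    simp

/-- The hypothesis `hU` is the completeness relation of a unitary operator basis; it survives the
restriction to the embedded indices. -/
theorem sum_bellOp {d n : ℕ} (hn : n ≠ 0) {emb : Fin d → Fin n} (hemb : Function.Injective emb)
    {U : 𝒜 → Matrix (Fin n) (Fin n) ℂ}
    (hU : ∀ m i l k, ∑ a, conj (U a m i) * U a l k = if m = l ∧ i = k then (n : ℂ) else 0) :
    ∑ a, bellOp emb (U a) = 1 := by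
  ext ⟨i, m⟩ ⟨k, l⟩
  simp_rw [Matrix.sum_apply, bellOp_apply]
  rw [← Finset.mul_sum, hU, Matrix.one_apply]
  by_cases h : m = l ∧ emb i = emb k
  · obtain ⟨rfl, h⟩ := h
    obtain rfl := hemb h
    simp [hn]
  · rw [if_neg h, if_neg, mul_zero]
    rintro ⟨rfl, rfl⟩
    exact h ⟨rfl, rfl⟩

/-- Without restriction to a subspace, the columns of the unitary have norm one and so does the
rotated maximally entangled vector. -/
theorem isStarProjection_bellOp {n : ℕ} (hn : n ≠ 0) {U : Matrix (Fin n) (Fin n) ℂ}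
    (hU : U * star U = 1) : IsStarProjection (bellOp id U) := by
  have hU' : star U * U = 1 := mul_eq_one_comm.1 hU
  have hdot : star (bellVec id U) ⬝ᵥ bellVec id U = 1 := by
    have h1 : ∀ i, ∑ m, conj (U m i) * U m i = 1 := fun i => by
      have := congrFun (congrFun hU' i) i
      simpa [Matrix.mul_apply, Matrix.star_apply] using this
    have := TeleportData.sqrt_inv_mul_self n
    rw [Complex.star_def, Complex.conj_ofReal] at this
    have e : ∀ i m, star (bellVec id U (i, m)) * bellVec id U (i, m) =
        (n : ℂ)⁻¹ * (conj (U m i) * U m i) := fun i m => by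
      rw [bellVec, Complex.star_def, map_mul, Complex.conj_ofReal, Complex.conj_conj, ← this]
      simp only [id]
      ring
    rw [dotProduct, Fintype.sum_prod_type]
    simp_rw [Pi.star_apply, e, ← Finset.mul_sum, h1]
    simp [hn]
  refine ⟨?_, ?_⟩
  · rw [IsIdempotentElem, bellOp, Matrix.vecMulVec_mul_vecMulVec, hdot]
    simp
  · rw [IsSelfAdjoint, bellOp, Matrix.star_eq_conjTranspose, Matrix.conjTranspose_vecMulVec, star_star]

end Network

section NetworkVector

variable {N : ℕ} {d n : Fin N → ℕ}

/-- The network state as a vector of the joint Hilbert space. -/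
def netVec (n : Fin N → ℕ) (Θ : (∀ j, Fin (d j)) → ℂ) :
    Hil ((∀ j, Fin (d j) × Fin (n j)) × (∀ j, Fin (n j))) :=
  hilMk (netState n Θ) Summable.of_finite

theorem netVec_apply (Θ : (∀ j, Fin (d j)) → ℂ) (x) : netVec n Θ x = netState n Θ x :=
  hilMk_apply _ _ _

theorem coe_netVec (Θ : (∀ j, Fin (d j)) → ℂ) :
    (netVec n Θ : (∀ j, Fin (d j) × Fin (n j)) × (∀ j, Fin (n j)) → ℂ) = netState n Θ := funext fun x => netVec_apply Θ x

theorem norm_netVec (hn : ∀ j, n j ≠ 0) {Θ : (∀ j, Fin (d j)) → ℂ} (hΘ : IsUnitVector Θ) :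
    ‖netVec n Θ‖ = 1 := by
  have h := expect_netState_of_scalar (n := n) hΘ (S := fun _ => 1) (T := fun _ => 1)
    (c := fun _ => 1) fun j => by rw [reduced_one (hn j), one_smul]
  simp_rw [map_one] at h
  rw [← coe_netVec, expect_eq, Finset.prod_const_one] at h
  have h1 : (mainRep (fun j => Fin (d j) × Fin (n j)) (fun j => Fin (n j))).op (fun _ => 1) = 1 :=
    LocalRep.op_one _
  have h2 : (auxRep (fun j => Fin (d j) × Fin (n j)) (fun j => Fin (n j))).op (fun _ => 1) = 1 :=
    LocalRep.op_one _
  rw [h1, h2] at h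
  change inner ℂ (jointVec (netVec n Θ)) (jointVec (netVec n Θ)) = 1 at h
  rw [inner_self_eq_norm_sq_to_K, norm_jointVec] at h
  have h3 : ‖netVec n Θ‖ ^ 2 = 1 := Complex.ofReal_injective (by simpa using h)
  exact (pow_eq_one_iff_of_nonneg (norm_nonneg _) two_ne_zero).1 h3

theorem matOp_update {ι : Fin N → Type*} [∀ j, Fintype (ι j)] [∀ j, DecidableEq (ι j)] (j : Fin N)
    (S : Matrix (ι j) (ι j) ℂ) :
    Function.update (fun j => (1 : Hil (ι j) →L[ℂ] Hil (ι j))) j (matOp S) =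
      fun k => matOp (Function.update (fun k => (1 : Matrix (ι k) (ι k) ℂ)) j S k) := by
  funext k
  rcases eq_or_ne k j with rfl | h
  · simp
  · simp [h]

/-- Expectation values of observables of a single main party and its auxiliary party that do not
act on the shared state. -/
theorem expect_netState_single (hn : ∀ j, n j ≠ 0) {Θ : (∀ j, Fin (d j)) → ℂ}
    (hΘ : IsUnitVector Θ) (j : Fin N) {S : Matrix (Fin (d j) × Fin (n j)) (Fin (d j) × Fin (n j)) ℂ}
    {T : Matrix (Fin (n j)) (Fin (n j)) ℂ} {c : ℂ} (h : reduced S T = c • 1) :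
    expect (netState n Θ) (Function.update (fun _ => 1) j (matOp S))
      (Function.update (fun _ => 1) j (matOp T)) = c := by
  rw [matOp_update, matOp_update,
    expect_netState_of_scalar hΘ (c := Function.update (fun _ => 1) j c) fun k => ?_]
  · rw [Finset.prod_update_of_mem (Finset.mem_univ j)]
    simp
  · rcases eq_or_ne k j with rfl | hk
    · simpa using h
    · simp only [Function.update_of_ne hk]
      rw [reduced_one (hn k), one_smul]

theorem isStarProjection_kronecker {d n : ℕ} {p : Matrix (Fin n) (Fin n) ℂ}
    (hp : IsStarProjection p) :
    IsStarProjection (Matrix.kroneckerMap (· * ·) (1 : Matrix (Fin d) (Fin d) ℂ) p) := by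
  refine ⟨?_, ?_⟩
  · rw [IsIdempotentElem, ← Matrix.mul_kronecker_mul, one_mul, hp.isIdempotentElem.eq]
  · rw [IsSelfAdjoint, Matrix.star_eq_conjTranspose, Matrix.conjTranspose_kronecker,
      Matrix.conjTranspose_one]
    congr 1
    exact hp.isSelfAdjoint

theorem isPositive_of_isStarProjection {E : Type*} [NormedAddCommGroup E] [InnerProductSpace ℂ E]
    [CompleteSpace E] {p : E →L[ℂ] E} (hp : IsStarProjection p) : p.IsPositive :=
  (ContinuousLinearMap.nonneg_iff_isPositive p).1 hp.nonneg

end NetworkVector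

/-! ### The reference experiment for qubits -/

section QubitReference

/-- The spectral projection of a reflection. -/
def reflProj (O : Matrix (Fin 2) (Fin 2) ℂ) (b : Fin 2) : Matrix (Fin 2) (Fin 2) ℂ :=
  (1 / 2 : ℂ) • (1 + (-1 : ℂ) ^ (b : ℕ) • O)

theorem isStarProjection_reflProj {O : Matrix (Fin 2) (Fin 2) ℂ} (hO : star O = O)
    (hOO : O * O = 1) (b : Fin 2) : IsStarProjection (reflProj O b) := by
  refine ⟨?_, ?_⟩
  · rw [IsIdempotentElem, reflProj, smul_mul_smul_comm]
    have h : (-1 : ℂ) ^ (b : ℕ) * (-1 : ℂ) ^ (b : ℕ) = 1 := by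
      fin_cases b <;> simp
    simp only [add_mul, mul_add, one_mul, mul_one, smul_mul_smul_comm, hOO, h]
    module
  · rw [IsSelfAdjoint, reflProj, star_smul, star_add, star_one, star_smul, hO]
    simp

theorem reflProj_zero_add_one (O : Matrix (Fin 2) (Fin 2) ℂ) :
    reflProj O 0 + reflProj O 1 = 1 := by
  simp only [reflProj, Fin.val_zero, Fin.val_one, pow_zero, pow_one]
  module

theorem reflProj_zero_sub_one (O : Matrix (Fin 2) (Fin 2) ℂ) :
    reflProj O 0 - reflProj O 1 = O := by
  simp only [reflProj, Fin.val_zero, Fin.val_one, pow_zero, pow_one]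
  module

/-- The optimal observables of the main parties for the three CHSH inequalities. -/
def chshObs (x : Fin 6) : Matrix (Fin 2) (Fin 2) ℂ :=
  (((√2 : ℝ) : ℂ)⁻¹ • ![pauli 0 + pauli 1, pauli 0 - pauli 1, pauli 0 + pauli 2,
    pauli 0 - pauli 2, pauli 1 + pauli 2, pauli 1 - pauli 2] x).transpose

theorem star_chshObs (x : Fin 6) : star (chshObs x) = chshObs x := by
  have h : ∀ X : Matrix (Fin 2) (Fin 2) ℂ, star X.transpose = (star X).transpose := fun X => rfl
  rw [chshObs, h, star_smul]
  fin_cases x <;> simp [star_pauli]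

theorem chshObs_mul_self (x : Fin 6) : chshObs x * chshObs x = 1 := by
  have hr : (((√2 : ℝ) : ℂ)⁻¹ * ((√2 : ℝ) : ℂ)⁻¹) * 2 = 1 := by
    linear_combination (((√2 : ℝ) : ℂ)⁻¹ * ((√2 : ℝ) : ℂ) + 1) * inv_sqrt_two_mul -
      ((√2 : ℝ) : ℂ)⁻¹ * ((√2 : ℝ) : ℂ)⁻¹ * sqrt_two_sq
  have h : ∀ {k l : Fin 3}, k ≠ l → (pauli k + pauli l) * (pauli k + pauli l) = (2 : ℂ) • 1 ∧
      (pauli k - pauli l) * (pauli k - pauli l) = (2 : ℂ) • 1 := fun {k l} hkl => by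
    have ha := pauli_anticomm hkl
    rw [two_smul]
    constructor
    · simp only [add_mul, mul_add, pauli_mul_self]
      linear_combination (norm := abel) ha
    · simp only [sub_mul, mul_sub, pauli_mul_self]
      linear_combination (norm := abel) -ha
  rw [chshObs, ← Matrix.transpose_mul, smul_mul_smul_comm, ← Matrix.transpose_one]
  congr 1
  fin_cases x
  · exact (congrArg _ (h (k := 0) (l := 1) (by decide)).1).trans (by rw [smul_smul, hr, one_smul])
  · exact (congrArg _ (h (k := 0) (l := 1) (by decide)).2).trans (by rw [smul_smul, hr, one_smul])
  · exact (congrArg _ (h (k := 0) (l := 2) (by decide)).1).trans (by rw [smul_smul, hr, one_smul])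
  · exact (congrArg _ (h (k := 0) (l := 2) (by decide)).2).trans (by rw [smul_smul, hr, one_smul])
  · exact (congrArg _ (h (k := 1) (l := 2) (by decide)).1).trans (by rw [smul_smul, hr, one_smul])
  · exact (congrArg _ (h (k := 1) (l := 2) (by decide)).2).trans (by rw [smul_smul, hr, one_smul])

theorem trace_pauli_mul (k l : Fin 3) : (pauli k * pauli l).trace = if k = l then 2 else 0 := by
  fin_cases k <;> fin_cases l <;> simp [pauli, Matrix.trace_fin_two, one_add_one_eq_two]

theorem sum_correction (m i l k : Fin 2) :
    ∑ a, conj (correction a m i) * correction a l k =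
      if m = l ∧ i = k then ((2 : ℕ) : ℂ) else 0 := by
  rw [Fintype.sum_prod_type]
  simp only [Fin.sum_univ_two]
  fin_cases m <;> fin_cases i <;> fin_cases l <;> fin_cases k <;>
    simp [correction, pauli, Matrix.mul_apply, Fin.sum_univ_two, one_add_one_eq_two]

variable {N : ℕ}

/-- The measurement operators of a main party of the reference experiment. -/
def referenceMain : ∀ x : MainInput, MainOutput x →
    Matrix (Fin 2 × Fin 2) (Fin 2 × Fin 2) ℂ
  | .chsh x => fun a : Fin 2 =>
      Matrix.kroneckerMap (· * ·) (1 : Matrix (Fin 2) (Fin 2) ℂ) (reflProj (chshObs x) a)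
  | .diamond => fun a : Fin 2 × Fin 2 => bellOp id (correction a)

theorem isStarProjection_referenceMain (x : MainInput) (a : MainOutput x) :
    IsStarProjection (referenceMain x a) := by
  rcases x with x | _
  · exact isStarProjection_kronecker
      (isStarProjection_reflProj (star_chshObs x) (chshObs_mul_self x) a)
  · exact isStarProjection_bellOp two_ne_zero (correction_mul_star a)

theorem sum_referenceMain (x : MainInput) : ∑ a, referenceMain x a = 1 := by
  rcases x with x | _
  · refine (Fin.sum_univ_two (f := fun a : Fin 2 => Matrix.kroneckerMap (· * ·)
      (1 : Matrix (Fin 2) (Fin 2) ℂ) (reflProj (chshObs x) a))).trans ?_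
    rw [← Matrix.kronecker_add, reflProj_zero_add_one, Matrix.one_kronecker_one]
  · exact sum_bellOp two_ne_zero Function.injective_id sum_correction

/-- The reference experiment for an `N`-qubit state. -/
def qubitReference {ψ : (Fin N → Fin 2) → ℂ} (hψ : IsUnitVector ψ) :
    QubitExperiment (fun _ : Fin N => Fin 2 × Fin 2) (fun _ : Fin N => Fin 2) where
  state := netVec (fun _ => 2) ψ
  norm_state := norm_netVec (fun _ => two_ne_zero) hψ
  A _ x a := matOp (referenceMain x a)
  B _ y b := matOp (pauliProj y b)
  A_pos _ x a := isPositive_of_isStarProjection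
    (isStarProjection_matOp (isStarProjection_referenceMain x a))
  A_sum _ x := by rw [← map_sum, sum_referenceMain, map_one]
  B_pos _ y b := isPositive_of_isStarProjection
    (isStarProjection_matOp (isStarProjection_reflProj (star_pauli y) (pauli_mul_self y) b))
  B_sum _ y := by
    rw [← map_sum, Fin.sum_univ_two]
    exact (congrArg matOp (reflProj_zero_add_one (pauli y))).trans (map_one _)

theorem correlator_qubitReference {ψ : (Fin N → Fin 2) → ℂ} (hψ : IsUnitVector ψ) (j : Fin N)
    (x : Fin 6) (y : Fin 3) : (qubitReference hψ).correlator j x y =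
      2⁻¹ * ((chshObs x).transpose * pauli y).trace := by
  have hA : (qubitReference hψ).obsA j x =
      matOp (Matrix.kroneckerMap (· * ·) (1 : Matrix (Fin 2) (Fin 2) ℂ) (chshObs x)) := by
    refine (map_sub matOp _ _).symm.trans (congrArg matOp ?_)
    refine Eq.trans ?_ (congrArg _ (reflProj_zero_sub_one (chshObs x)))
    ext a b
    simp [referenceMain, Matrix.kroneckerMap_apply, mul_sub]
  have hB : (qubitReference hψ).obsB j y = matOp (pauli y) :=
    (map_sub matOp _ _).symm.trans (congrArg matOp (reflProj_zero_sub_one (pauli y)))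
  rw [QubitExperiment.correlator, hA, hB]
  change expect (netVec (fun _ => 2) ψ) _ _ = _
  rw [coe_netVec]
  exact expect_netState_single (fun _ => two_ne_zero) hψ j (reduced_kronecker _ _)

theorem isReference_qubitReference {ψ : (Fin N → Fin 2) → ℂ} (hψ : IsUnitVector ψ) :
    (qubitReference hψ).IsReference ψ := by
  refine ⟨fun j => ?_, fun a y b => ?_⟩
  · have h2 : ((√2 : ℝ) : ℂ)⁻¹ = ((√2 : ℝ) : ℂ) / 2 := by
      linear_combination (-((√2 : ℝ) : ℂ)⁻¹ / 2) * sqrt_two_sq +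
        ((√2 : ℝ) : ℂ) / 2 * inv_sqrt_two_mul
    simp [QubitExperiment.chsh, correlator_qubitReference, chshObs, add_mul, sub_mul,
      trace_pauli_mul, Matrix.trace_add, Matrix.trace_sub, h2]
    ring
  · change expect (netVec (fun _ => 2) ψ) (fun j => matOp (bellOp id (correction (a j))))
      (fun j => matOp (pauliProj (y j) (b j))) = _
    rw [coe_netVec, expect_netState, qubitExpect, Finset.mul_sum]
    refine Finset.sum_congr rfl fun i _ => ?_
    rw [Finset.mul_sum]
    refine Finset.sum_congr rfl fun k _ => ?_
    simp_rw [reduced_bellOp]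
    have h : (1 / 4 ^ N : ℂ) = ∏ _j : Fin N, (((2 : ℕ) : ℂ)⁻¹ * ((2 : ℕ) : ℂ)⁻¹) := by
      rw [Finset.prod_const, Finset.card_univ, Fintype.card_fin, one_div, ← inv_pow]
      norm_num
    simp only [Matrix.smul_apply, Matrix.submatrix_apply, smul_eq_mul, Finset.prod_mul_distrib]
    rw [h, Finset.prod_mul_distrib]
    simp only [id, Matrix.star_eq_conjTranspose]
    ring

end QubitReference

/-! ### Coarse graining of measurements -/

section CoarseGraining

/-- For a vector in the range of `p o'`, the squared norms of all components add up to its own,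
which the component `o'` already exhausts. -/
theorem mul_eq_zero_of_sum_eq_one {E : Type*} [NormedAddCommGroup E] [InnerProductSpace ℂ E]
    [CompleteSpace E] {O : Type*} [Fintype O] {p : O → E →L[ℂ] E} (hp : ∀ o, IsStarProjection (p o))
    (h1 : ∑ o, p o = 1) {o o' : O} (ho : o ≠ o') : p o * p o' = 0 := by
  classical
  have hF : ∑ o, star (p o) * p o = 1 := by
    rw [← h1]
    exact Finset.sum_congr rfl fun o _ => by
      rw [(hp o).isSelfAdjoint.star_eq, (hp o).isIdempotentElem.eq]
  ext1 w
  have h := sum_norm_kraus_sq hF (p o' w)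
  have e : p o' (p o' w) = p o' w := by
    rw [← mul_apply_eq_comp, (hp o').isIdempotentElem.eq]
  rw [← Finset.add_sum_erase _ _ (Finset.mem_univ o'), e, add_eq_left,
    Finset.sum_eq_zero_iff_of_nonneg fun _ _ => by positivity] at h
  have := h o (Finset.mem_erase.2 ⟨ho, Finset.mem_univ _⟩)
  exact norm_eq_zero.1 (pow_eq_zero_iff two_ne_zero |>.1 this)

theorem isStarProjection_sum {E : Type*} [NormedAddCommGroup E] [InnerProductSpace ℂ E]
    [CompleteSpace E] {O : Type*} [Fintype O] {p : O → E →L[ℂ] E} (hp : ∀ o, IsStarProjection (p o))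
    (h1 : ∑ o, p o = 1) (s : Finset O) : IsStarProjection (∑ o ∈ s, p o) := by
  classical
  refine ⟨?_, ?_⟩
  · rw [IsIdempotentElem, Finset.sum_mul_sum]
    refine Finset.sum_congr rfl fun o ho => ?_
    rw [Finset.sum_eq_single o, (hp o).isIdempotentElem.eq]
    · exact fun o' _ h => mul_eq_zero_of_sum_eq_one hp h1 h.symm
    · exact fun h => absurd ho h
  · rw [IsSelfAdjoint, star_sum]
    exact Finset.sum_congr rfl fun o _ => (hp o).isSelfAdjoint.star_eq

theorem isPositive_sum {E : Type*} [NormedAddCommGroup E] [InnerProductSpace ℂ E]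
    [CompleteSpace E] {O : Type*} {p : O → E →L[ℂ] E} (s : Finset O) (hp : ∀ o, (p o).IsPositive) :
    (∑ o ∈ s, p o).IsPositive :=
  (ContinuousLinearMap.nonneg_iff_isPositive _).1
    (Finset.sum_nonneg fun o _ => (ContinuousLinearMap.nonneg_iff_isPositive _).2 (hp o))

variable {N : ℕ} {ιA ιB : Fin N → Type u}

theorem expect_sum (Ψ : Hil ((∀ j, ιA j) × (∀ j, ιB j))) {OA OB : Fin N → Type}
    (s : ∀ j, Finset (OA j)) (t : ∀ j, Finset (OB j))
    (A : ∀ j, OA j → Hil (ιA j) →L[ℂ] Hil (ιA j)) (B : ∀ j, OB j → Hil (ιB j) →L[ℂ] Hil (ιB j)) :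
    expect Ψ (fun j => ∑ a ∈ s j, A j a) (fun j => ∑ b ∈ t j, B j b) =
      ∑ a ∈ Fintype.piFinset s, ∑ b ∈ Fintype.piFinset t,
        expect Ψ (fun j => A j (a j)) (fun j => B j (b j)) := by
  classical
  simp_rw [expect_eq]
  rw [(mainRep ιA ιB).op.map_sum_finset, (auxRep ιA ιB).op.map_sum_finset, _root_.sum_apply,
    inner_sum]
  refine Finset.sum_congr rfl fun a _ => ?_
  rw [_root_.sum_apply, map_sum, inner_sum]

/-- Labels outside the image of `enc` carry an empty sum, so grouping by `dec` returns the original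
value. -/
theorem sum_filter_enc {R X O : Type*} [Fintype X] [Fintype R] [DecidableEq R] [DecidableEq X]
    [AddCommMonoid O] {enc : X → R} {dec : R → X} (h : Function.LeftInverse dec enc) (f : X → O)
    (x : X) : ∑ r with dec r = x, ∑ y with enc y = r, f y = f x := by
  rw [Finset.sum_comm' (t' := {x}) (s' := fun y => {enc y})]
  · simp
  · intro r y
    simp only [Finset.mem_filter, Finset.mem_univ, true_and, Finset.mem_singleton]
    constructor
    · rintro ⟨rfl, rfl⟩
      exact ⟨rfl, (h y).symm⟩
    · rintro ⟨rfl, rfl⟩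
      exact ⟨h y, rfl⟩

theorem exists_encoding (X : Fin N → Type) [∀ j, Fintype (X j)] [∀ j, Nonempty (X j)] {m : ℕ}
    (hm : ∀ j, Fintype.card (X j) ≤ m) :
    ∃ (enc : ∀ j, X j → Fin m) (dec : ∀ j, Fin m → X j),
      ∀ j, Function.LeftInverse (dec j) (enc j) := by
  have h : ∀ j, Nonempty (X j ↪ Fin m) := fun j =>
    Function.Embedding.nonempty_of_card_le (by simpa using hm j)
  let e : ∀ j, X j ↪ Fin m := fun j => (h j).some
  exact ⟨fun j => e j, fun j => Function.invFun (e j), fun j => Function.leftInverse_invFun (e j).2⟩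

/-- A network experiment whose alphabets depend on the parties can be replaced by one with uniform
alphabets, each realisation of which contains a realisation of the given experiment. -/
theorem exists_networkExperiment {D : Fin N → ℕ} {Θ : (∀ j, Fin (D j)) → ℂ} (hΘ : IsUnitVector Θ)
    (X Y O : Fin N → Type) [∀ j, Fintype (X j)] [∀ j, Fintype (Y j)] [∀ j, Fintype (O j)]
    [∀ j, Nonempty (X j)] [∀ j, Nonempty (Y j)] [∀ j, Nonempty (O j)]
    (A : ∀ j, X j → O j →
      Matrix (Fin (D j) × Fin (auxDim (D j))) (Fin (D j) × Fin (auxDim (D j))) ℂ)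
    (B : ∀ j, Y j → O j → Matrix (Fin (auxDim (D j))) (Fin (auxDim (D j))) ℂ)
    (hA : ∀ j x o, ∃ C : Matrix _ _ ℂ, A j x o = star C * C)
    (hB : ∀ j y o, ∃ C : Matrix _ _ ℂ, B j y o = star C * C)
    (hA1 : ∀ j x, ∑ o, A j x o = 1) (hB1 : ∀ j y, ∑ o, B j y o = 1) :
    ∃ (m r : ℕ) (E : NetworkExperiment Θ m r), ∀ (ιA ιB : Fin N → Type u)
      (R : UniformExperiment ιA ιB m r), R.IsProjective → R.corr = E.corr →
      ∃ (A' : ∀ j, X j → O j → Hil (ιA j) →L[ℂ] Hil (ιA j))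
        (B' : ∀ j, Y j → O j → Hil (ιB j) →L[ℂ] Hil (ιB j)),
        (∀ j x o, IsStarProjection (A' j x o)) ∧ (∀ j y o, IsStarProjection (B' j y o)) ∧
        (∀ j x, ∑ o, A' j x o = 1) ∧ (∀ j y, ∑ o, B' j y o = 1) ∧
        ∀ (x : ∀ j, X j) (y : ∀ j, Y j) (a b : ∀ j, O j),
          expect R.state (fun j => A' j (x j) (a j)) (fun j => B' j (y j) (b j)) =
            expect (netState (fun j => auxDim (D j)) Θ) (fun j => matOp (A j (x j) (a j)))
              (fun j => matOp (B j (y j) (b j))) := by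
  classical
  obtain ⟨encX, decX, hX⟩ := exists_encoding X
    (m := ∑ j, Fintype.card (X j) + ∑ j, Fintype.card (Y j)) fun j =>
      le_add_right (Finset.single_le_sum (f := fun j => Fintype.card (X j)) (fun _ _ => Nat.zero_le _)
        (Finset.mem_univ j))
  obtain ⟨encY, decY, hY⟩ := exists_encoding Y
    (m := ∑ j, Fintype.card (X j) + ∑ j, Fintype.card (Y j)) fun j =>
      le_add_left (Finset.single_le_sum (f := fun j => Fintype.card (Y j)) (fun _ _ => Nat.zero_le _)
        (Finset.mem_univ j))
  obtain ⟨encO, decO, hO⟩ := exists_encoding O (m := ∑ j, Fintype.card (O j)) fun j =>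
      Finset.single_le_sum (f := fun j => Fintype.card (O j)) (fun _ _ => Nat.zero_le _)
        (Finset.mem_univ j)
  -- Superfluous inputs repeat existing measurements through `decX` and `decY`; superfluous outputs
  -- get the zero operator.
  let E : NetworkExperiment Θ _ _ :=
    { state := netVec _ Θ
      norm_state := norm_netVec (fun j => by simp [auxDim]) hΘ
      A := fun j x r => ∑ o with encO j o = r, matOp (A j (decX j x) o)
      B := fun j y r => ∑ o with encO j o = r, matOp (B j (decY j y) o)
      A_pos := fun j x r => isPositive_sum _ fun o => matOp_isPositive (hA _ _ _)
      B_pos := fun j y r => isPositive_sum _ fun o => matOp_isPositive (hB _ _ _)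
      A_sum := fun j x => by
        rw [Finset.sum_fiberwise, ← map_sum, hA1, map_one]
      B_sum := fun j y => by
        rw [Finset.sum_fiberwise, ← map_sum, hB1, map_one]
      state_eq := netVec_apply Θ }
  -- In a realisation the outputs are grouped by `decO`. Grouping the outcomes of a projective
  -- measurement keeps it projective.
  refine ⟨_, _, E, fun ιA ιB R hR hRE => ⟨fun j x o => ∑ r with decO j r = o, R.A j (encX j x) r,
    fun j y o => ∑ r with decO j r = o, R.B j (encY j y) r,
    fun j x o => isStarProjection_sum (hR.1 j _) (R.A_sum j _) _,
    fun j y o => isStarProjection_sum (hR.2 j _) (R.B_sum j _) _, fun j x => ?_, fun j y => ?_,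
    fun x y a b => ?_⟩⟩
  · exact (Finset.sum_fiberwise _ _ _).trans (R.A_sum _ _)
  · exact (Finset.sum_fiberwise _ _ _).trans (R.B_sum _ _)
  · have h1 := expect_sum R.state (fun j => Finset.univ.filter fun r => decO j r = a j)
      (fun j => Finset.univ.filter fun r => decO j r = b j)
      (fun j r => R.A j (encX j (x j)) r) (fun j r => R.B j (encY j (y j)) r)
    have h2 := expect_sum E.state (fun j => Finset.univ.filter fun r => decO j r = a j)
      (fun j => Finset.univ.filter fun r => decO j r = b j)
      (fun j r => E.A j (encX j (x j)) r) (fun j r => E.B j (encY j (y j)) r)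
    have h3 : ∀ j, ∑ r with decO j r = a j, E.A j (encX j (x j)) r = matOp (A j (x j) (a j)) :=
      fun j => by
        simp only [E, hX j (x j)]
        exact sum_filter_enc (hO j) (fun o => matOp (A j (x j) o)) (a j)
    have h4 : ∀ j, ∑ r with decO j r = b j, E.B j (encY j (y j)) r = matOp (B j (y j) (b j)) :=
      fun j => by
        simp only [E, hY j (y j)]
        exact sum_filter_enc (hO j) (fun o => matOp (B j (y j) o)) (b j)
    simp_rw [h3, h4] at h2
    rw [← coe_netVec]
    refine h1.trans (Eq.trans ?_ h2.symm)
    refine Finset.sum_congr rfl fun a' _ => Finset.sum_congr rfl fun b' _ => ?_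
    exact congrFun (congrFun (congrFun (congrFun hRE _) _) a') b'

end CoarseGraining

/-! ### Self-testing of a tomographically complete family of measurements -/

section Frames

/-- Projective measurements, indexed by pairs of elements of a family of hermitian matrices that
spans, that measure the sums of these pairs. -/
structure SpectralFrame (n : ℕ) (T O : Type) [Fintype T] [Fintype O] where
  /-- the hermitian matrices -/
  gen : T → Matrix (Fin n) (Fin n) ℂ
  span_gen : Submodule.span ℂ (Set.range gen) = ⊤
  /-- the projections -/
  Q : T × T → O → Matrix (Fin n) (Fin n) ℂ
  /-- the eigenvalues -/
  ev : T × T → O → ℂ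
  proj : ∀ y o, IsStarProjection (Q y o)
  mul_eq_zero : ∀ y o o', o ≠ o' → Q y o * Q y o' = 0
  sum_eq_one : ∀ y, ∑ o, Q y o = 1
  gen_add : ∀ y, gen y.1 + gen y.2 = ∑ o, ev y o • Q y o

namespace SpectralFrame

variable {n : ℕ} {T O : Type} [Fintype T] [Fintype O] (F : SpectralFrame n T O)

theorem span_Q : Submodule.span ℂ (Set.range fun q : (T × T) × O => F.Q q.1 q.2) = ⊤ := by
  rw [eq_top_iff, ← F.span_gen, Submodule.span_le]
  rintro _ ⟨t, rfl⟩
  have h : F.gen t = (1 / 2 : ℂ) • ∑ o, F.ev (t, t) o • F.Q (t, t) o := by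
    rw [← F.gen_add (t, t)]
    module
  rw [h]
  exact Submodule.smul_mem _ _ (sum_mem fun o _ => Submodule.smul_mem _ _
    (Submodule.subset_span ⟨((t, t), o), rfl⟩))

theorem sum_smul_mul_self {R : Type*} [Ring R] [Algebra ℂ R] (c : O → ℂ) {p : O → R}
    (hp : ∀ o, p o * p o = p o) (hpo : ∀ o o', o ≠ o' → p o * p o' = 0) :
    (∑ o, c o • p o) * ∑ o, c o • p o = ∑ o, (c o * c o) • p o := by
  classical
  rw [Finset.sum_mul_sum]
  refine Finset.sum_congr rfl fun o _ => ?_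
  rw [Finset.sum_eq_single o, smul_mul_smul_comm, hp]
  · intro o' _ h
    rw [smul_mul_smul_comm, hpo _ _ h.symm, smul_zero]
  · simp

end SpectralFrame

namespace LocalRep

variable {N : ℕ} {𝔸 𝔹 : Fin N → Type*} [∀ j, Ring (𝔸 j)] [∀ j, StarRing (𝔸 j)]
  [∀ j, Algebra ℂ (𝔸 j)] [∀ j, Ring (𝔹 j)] [∀ j, StarRing (𝔹 j)] [∀ j, Algebra ℂ (𝔹 j)]
  {H : Type*} [NormedAddCommGroup H] [InnerProductSpace ℂ H] [CompleteSpace H]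
  {L : LocalRep 𝔸 H} {M : LocalRep 𝔹 H} {Ψ : H}
  {n : ℕ} {T O : Type} [Fintype T] [Fintype O] (F : SpectralFrame n T O) {j : Fin N}
  {A : T × T → O → 𝔸 j} {B : T × T → O → 𝔹 j}

/-- All four inner products of the two vectors equal `tr Q / n`: the mixed ones by the correlations
for equal inputs, the others by summing out the partner's outcome. So their difference has norm
zero. -/
theorem single_apply_eq_of_frame (hA : ∀ y o, IsStarProjection (A y o)) (hA1 : ∀ y, ∑ o, A y o = 1)
    (hB : ∀ y o, IsStarProjection (B y o)) (hB1 : ∀ y, ∑ o, B y o = 1)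
    (hcorr : ∀ y y' o o', inner ℂ Ψ (L.single j (A y o) (M.single j (B y' o') Ψ)) =
      (n : ℂ)⁻¹ * (F.Q y o * F.Q y' o').trace) (y : T × T) (o : O) :
    L.single j (A y o) Ψ = M.single j (B y o) Ψ := by
  have hab : inner ℂ (L.single j (A y o) Ψ) (M.single j (B y o) Ψ) =
      (n : ℂ)⁻¹ * (F.Q y o).trace := by
    rw [inner_single_left, (hA y o).isSelfAdjoint.star_eq, hcorr,
      (F.proj y o).isIdempotentElem.eq]
  have haa : inner ℂ (L.single j (A y o) Ψ) (L.single j (A y o) Ψ) =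
      (n : ℂ)⁻¹ * (F.Q y o).trace := by
    rw [inner_single_left, (hA y o).isSelfAdjoint.star_eq, ← mul_apply_eq_comp, ← single_mul,
      (hA y o).isIdempotentElem.eq]
    have h1 : L.single j (A y o) Ψ = L.single j (A y o) (M.single j (∑ o', B y o') Ψ) := by
      rw [hB1, single_one]
      rfl
    rw [h1, map_sum, _root_.sum_apply, map_sum, inner_sum]
    simp_rw [hcorr]
    rw [← Finset.mul_sum, ← Matrix.trace_sum, ← Finset.mul_sum, F.sum_eq_one, mul_one]
  have hbb : inner ℂ (M.single j (B y o) Ψ) (M.single j (B y o) Ψ) =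
      (n : ℂ)⁻¹ * (F.Q y o).trace := by
    rw [inner_single_left, (hB y o).isSelfAdjoint.star_eq, ← mul_apply_eq_comp, ← single_mul,
      (hB y o).isIdempotentElem.eq]
    have h1 : M.single j (B y o) Ψ = L.single j (∑ o', A y o') (M.single j (B y o) Ψ) := by
      rw [hA1, single_one]
      rfl
    rw [h1, map_sum, _root_.sum_apply, inner_sum]
    simp_rw [hcorr]
    rw [← Finset.mul_sum, ← Matrix.trace_sum, ← Finset.sum_mul, F.sum_eq_one, one_mul]
  have hba : inner ℂ (M.single j (B y o) Ψ) (L.single j (A y o) Ψ) =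
      (n : ℂ)⁻¹ * (F.Q y o).trace := by
    rw [← inner_conj_symm, hab, ← haa, inner_conj_symm]
  rw [← sub_eq_zero, ← inner_self_eq_zero (𝕜 := ℂ), inner_sub_left, inner_sub_right,
    inner_sub_right, haa, hab, hba, hbb]
  ring

/-- The vectors `A q Ψ` have the same Gram matrix as the projections `F.Q` in the Hilbert–Schmidt
product, up to `1 / n`, so they satisfy the same linear relations. -/
theorem sum_single_apply_eq_zero (hA : ∀ y o, IsStarProjection (A y o))
    (hAB : ∀ y o, L.single j (A y o) Ψ = M.single j (B y o) Ψ)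
    (hcorr : ∀ y y' o o', inner ℂ Ψ (L.single j (A y o) (M.single j (B y' o') Ψ)) =
      (n : ℂ)⁻¹ * (F.Q y o * F.Q y' o').trace) (c : (T × T) × O → ℂ)
    (hc : ∑ q, c q • F.Q q.1 q.2 = 0) : L.single j (∑ q, c q • A q.1 q.2) Ψ = 0 := by
  have hG : ∀ q q' : (T × T) × O, inner ℂ (L.single j (A q.1 q.2) Ψ) (L.single j (A q'.1 q'.2) Ψ) =
      (n : ℂ)⁻¹ * (F.Q q.1 q.2 * F.Q q'.1 q'.2).trace := fun q q' => by
    rw [hAB q'.1, inner_single_left, (hA _ _).isSelfAdjoint.star_eq, hcorr]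
  rw [← inner_self_eq_zero (𝕜 := ℂ)]
  simp_rw [map_sum, map_smul, _root_.sum_apply, _root_.smul_apply, sum_inner, inner_sum,
    inner_smul_left, inner_smul_right, hG]
  calc _ = (n : ℂ)⁻¹ * (star (∑ q, c q • F.Q q.1 q.2) * ∑ q, c q • F.Q q.1 q.2).trace := by
        simp_rw [star_sum, star_smul, (F.proj _ _).isSelfAdjoint.star_eq, Finset.sum_mul_sum,
          Matrix.trace_sum, Finset.mul_sum, smul_mul_smul_comm, Matrix.trace_smul, smul_eq_mul,
          Complex.star_def]
        exact Finset.sum_congr rfl fun q _ => Finset.sum_congr rfl fun q' _ => by ring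
    _ = 0 := by rw [hc, mul_zero, Matrix.trace_zero, mul_zero]

/-- If the statistics of the measurements of a main and an auxiliary party are those of a spectral
frame on a maximally entangled state, then a real representation of the matrices is mirrored by the
measurements of the auxiliary party. -/
theorem exists_jordan_of_frame [∀ j, StarModule ℂ (𝔸 j)]
    (hc : ∀ S T, Commute (L.op S) (M.op T)) {P : 𝔸 j} (hP : IsSupport L Ψ j P)
    (hA : ∀ y o, IsStarProjection (A y o)) (hA1 : ∀ y, ∑ o, A y o = 1)
    (hA0 : ∀ y o o', o ≠ o' → A y o * A y o' = 0)
    (hB : ∀ y o, IsStarProjection (B y o)) (hB1 : ∀ y, ∑ o, B y o = 1)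
    (hcorr : ∀ y y' o o', inner ℂ Ψ (L.single j (A y o) (M.single j (B y' o') Ψ)) =
      (n : ℂ)⁻¹ * (F.Q y o * F.Q y' o').trace) [Nonempty T] :
    ∃ π : Matrix (Fin n) (Fin n) ℂ →ₗ[ℂ] 𝔸 j, π 1 = P ∧
      (∀ y o, Mirror L M Ψ j (π (F.Q y o)) (B y o)) ∧
      (∀ X Y, π (X * Y) + π (Y * X) = π X * π Y + π Y * π X) ∧
      ∀ X, π (star X) = star (π X) := by
  have hAB := single_apply_eq_of_frame F hA hA1 hB hB1 hcorr
  have hmir : ∀ y o, Mirror L M Ψ j (A y o) (B y o) := fun y o =>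
    ⟨hAB y o, by
      rw [(hA y o).isSelfAdjoint.star_eq, (hB y o).isSelfAdjoint.star_eq]
      exact hAB y o⟩
  have hcomm : ∀ y o, A y o * P = P * A y o := fun y o => hP.commute hc ⟨_, hmir y o⟩
  have hPP := hP.proj.isIdempotentElem.eq
  have hprod : ∀ y o o', (A y o * P) * (A y o' * P) = (A y o * A y o') * P := fun y o o' => by
    rw [hcomm y o', mul_assoc, ← mul_assoc P, hPP, ← hcomm y o', mul_assoc]
  -- Linear relations between the `F.Q` hold for the `A` on `Ψ`, hence as operators on the support.
  obtain ⟨π, hπ⟩ := exists_linearMap_of_relations F.span_Q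
    (e := fun q : (T × T) × O => A q.1 q.2 * P) fun c hc0 => by
      have := hP.mul_eq_zero _ (sum_single_apply_eq_zero F hA hAB hcorr c hc0)
      simpa only [Finset.sum_mul, smul_mul_assoc] using this
  have hπ' : ∀ y o, π (F.Q y o) = A y o * P := fun y o => hπ (y, o)
  have hstar : ∀ y o, star (A y o * P) = A y o * P := fun y o => by
    rw [star_mul, (hA y o).isSelfAdjoint.star_eq, hP.proj.isSelfAdjoint.star_eq, hcomm]
  -- The sum of the pair `y` is a combination of orthogonal projections, and their images under `π`
  -- are orthogonal projections with the same coefficients. So `π` respects its square.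
  have hsq : ∀ y : T × T, π ((F.gen y.1 + F.gen y.2) * (F.gen y.1 + F.gen y.2)) =
      π (F.gen y.1 + F.gen y.2) * π (F.gen y.1 + F.gen y.2) := fun y => by
    rw [F.gen_add, SpectralFrame.sum_smul_mul_self _ (fun o => (F.proj y o).isIdempotentElem.eq)
      (F.mul_eq_zero y)]
    simp_rw [map_sum, map_smul, hπ']
    rw [SpectralFrame.sum_smul_mul_self _ (fun o => ?_) fun o o' h => ?_]
    · rw [hprod, (hA y o).isIdempotentElem.eq]
    · rw [hprod, hA0 y o o' h, zero_mul]
  have hself : ∀ t, π (F.gen t * F.gen t) = π (F.gen t) * π (F.gen t) := fun t => by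
    have h := hsq (t, t)
    simp only [add_mul, mul_add, map_add] at h
    have h4 : (4 : ℂ) • π (F.gen t * F.gen t) = (4 : ℂ) • (π (F.gen t) * π (F.gen t)) := by
      linear_combination (norm := module) h
    exact smul_right_injective _ (by norm_num : (4 : ℂ) ≠ 0) h4
  refine ⟨π, ?_, fun y o => ⟨?_, ?_⟩, jordan_of_span F.span_gen fun s t => ?_,
    map_star_of_span F.span_Q (fun q => (F.proj q.1 q.2).isSelfAdjoint) fun q => ?_⟩
  · obtain ⟨t⟩ := ‹Nonempty T›
    rw [← F.sum_eq_one (t, t), map_sum]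
    simp_rw [hπ']
    rw [← Finset.sum_mul, hA1, one_mul]
  · rw [hπ', hP.single_mul, hAB]
  · rw [hπ', hstar, hP.single_mul, hAB, (hB y o).isSelfAdjoint.star_eq]
  -- Polarization: subtracting the squares of the two generators leaves the anticommutator.
  · have h := hsq (s, t)
    simp only [add_mul, mul_add, map_add, hself] at h
    linear_combination (norm := abel) h
  · rw [hπ, hstar]

end LocalRep

end Frames

/-! ### Reference measurements of arbitrary dimension -/

section Reference

theorem isStarProjection_zero {R : Type*} [NonUnitalSemiring R] [StarRing R] :
    IsStarProjection (0 : R) := ⟨by simp [IsIdempotentElem], by simp [IsSelfAdjoint]⟩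

theorem isStarProjection_single {n : ℕ} (a : Fin n) :
    IsStarProjection (Matrix.single a a 1 : Matrix (Fin n) (Fin n) ℂ) := by
  refine ⟨by simp [IsIdempotentElem], ?_⟩
  rw [IsSelfAdjoint, Matrix.star_eq_conjTranspose, Matrix.conjTranspose_single, star_one]

/-- The spectral decomposition of a hermitian matrix. -/
theorem exists_spectral_projections {n : ℕ} {H : Matrix (Fin n) (Fin n) ℂ} (hH : H.IsHermitian) :
    ∃ (Q : Fin n × Fin n → Matrix (Fin n) (Fin n) ℂ) (ev : Fin n × Fin n → ℂ),
      (∀ o, IsStarProjection (Q o)) ∧ (∀ o o', o ≠ o' → Q o * Q o' = 0) ∧ ∑ o, Q o = 1 ∧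
        H = ∑ o, ev o • Q o := by
  set φ := Unitary.conjStarAlgAut ℂ (Matrix (Fin n) (Fin n) ℂ) hH.eigenvectorUnitary
  -- Outcomes are pairs, so that this alphabet agrees with the `n²` outcomes of the teleportation
  -- measurement; off-diagonal pairs get the zero projection.
  refine ⟨fun o => if o.1 = o.2 then φ (Matrix.single o.1 o.1 1) else 0,
    fun o => (hH.eigenvalues o.1 : ℂ), fun o => ?_, fun o o' h => ?_, ?_, ?_⟩
  · dsimp only
    split_ifs
    · exact (isStarProjection_single o.1).map φ
    · exact isStarProjection_zero
  · dsimp only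
    split_ifs with h1 h2
    · rw [← map_mul, Matrix.single_mul_single_of_ne, map_zero]
      exact fun h3 => h (Prod.ext h3 (h1.symm.trans (h3.trans h2)))
    all_goals simp
  · simp only [Fintype.sum_prod_type, Finset.sum_ite_eq, Finset.mem_univ, if_true]
    rw [← map_sum, ← map_one φ]
    congr 1
    ext x y
    simp [Matrix.sum_apply, Matrix.single_apply, Matrix.one_apply, ite_and]
  · simp only [smul_ite, smul_zero, Fintype.sum_prod_type, Finset.sum_ite_eq, Finset.mem_univ,
      if_true]
    conv_lhs => rw [hH.spectral_theorem]
    change φ _ = _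
    simp_rw [← map_smul, ← map_sum]
    congr 1
    ext x y
    simp [Matrix.sum_apply, Matrix.single_apply, Matrix.diagonal_apply, ite_and]

/-- A family of hermitian matrices that spans all matrices. -/
def hermitianUnit {n : ℕ} (t : Fin n × Fin n × Fin 2) : Matrix (Fin n) (Fin n) ℂ :=
  if t.2.2 = 0 then Matrix.single t.1 t.2.1 1 + Matrix.single t.2.1 t.1 1
  else Complex.I • (Matrix.single t.1 t.2.1 1 - Matrix.single t.2.1 t.1 1)

theorem hermitianUnit_isHermitian {n : ℕ} (t : Fin n × Fin n × Fin 2) :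
    (hermitianUnit t).IsHermitian := by
  unfold hermitianUnit
  split_ifs
  · rw [Matrix.IsHermitian, Matrix.conjTranspose_add, Matrix.conjTranspose_single,
      Matrix.conjTranspose_single, star_one, add_comm]
  · rw [Matrix.IsHermitian, Matrix.conjTranspose_smul, Matrix.conjTranspose_sub,
      Matrix.conjTranspose_single, Matrix.conjTranspose_single, star_one, Complex.star_def,
      Complex.conj_I, neg_smul, ← smul_neg, neg_sub]

theorem span_hermitianUnit (n : ℕ) :
    Submodule.span ℂ (Set.range (hermitianUnit (n := n))) = ⊤ := by
  rw [eq_top_iff]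
  rintro X -
  have h : ∀ i k : Fin n, Matrix.single i k (1 : ℂ) ∈
      Submodule.span ℂ (Set.range (hermitianUnit (n := n))) := fun i k => by
    have e : Matrix.single i k (1 : ℂ) =
        (1 / 2 : ℂ) • hermitianUnit (i, k, 0) + (-Complex.I / 2) • hermitianUnit (i, k, 1) := by
      simp only [hermitianUnit, if_true, one_ne_zero, if_false, smul_smul]
      have hI : -Complex.I / 2 * Complex.I = 1 / 2 := by
        linear_combination (-1 / 2 : ℂ) * Complex.I_mul_I
      rw [hI]
      module
    rw [e]
    exact add_mem (Submodule.smul_mem _ _ (Submodule.subset_span ⟨_, rfl⟩))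
      (Submodule.smul_mem _ _ (Submodule.subset_span ⟨_, rfl⟩))
  rw [Matrix.matrix_eq_sum_single X]
  refine sum_mem fun i _ => sum_mem fun k _ => ?_
  have e : Matrix.single i k (X i k) = X i k • Matrix.single i k (1 : ℂ) := by
    rw [Matrix.smul_single, smul_eq_mul, mul_one]
  rw [e]
  exact Submodule.smul_mem _ _ (h i k)

theorem nonempty_spectralFrame (n : ℕ) :
    Nonempty (SpectralFrame n (Fin n × Fin n × Fin 2) (Fin n × Fin n)) := by
  have h : ∀ y : (Fin n × Fin n × Fin 2) × (Fin n × Fin n × Fin 2),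
      (hermitianUnit y.1 + hermitianUnit y.2).IsHermitian := fun y =>
    (hermitianUnit_isHermitian y.1).add (hermitianUnit_isHermitian y.2)
  choose Q ev h1 h2 h3 h4 using fun y => exists_spectral_projections (h y)
  exact ⟨⟨hermitianUnit, span_hermitianUnit n, Q, ev, h1, h2, h3, h4⟩⟩

/-- The products of powers of the shift and of the clock matrix. -/
def clockShift {n : ℕ} [NeZero n] (a : Fin n × Fin n) : Matrix (Fin n) (Fin n) ℂ :=
  Matrix.of fun m i =>
    if ZMod.finEquiv n m = ZMod.finEquiv n i + ZMod.finEquiv n a.1 then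
      ZMod.stdAddChar (ZMod.finEquiv n a.2 * ZMod.finEquiv n i) else 0

theorem conj_clockShift_mul {n : ℕ} [NeZero n] (a : Fin n × Fin n) (m i l k : Fin n) :
    conj (clockShift a m i) * clockShift a l k =
      if ZMod.finEquiv n m = ZMod.finEquiv n i + ZMod.finEquiv n a.1 ∧
        ZMod.finEquiv n l = ZMod.finEquiv n k + ZMod.finEquiv n a.1 then
        ZMod.stdAddChar (ZMod.finEquiv n a.2 * (ZMod.finEquiv n k - ZMod.finEquiv n i)) else 0 := by
  simp only [clockShift, Matrix.of_apply]
  by_cases h1 : ZMod.finEquiv n m = ZMod.finEquiv n i + ZMod.finEquiv n a.1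
  · by_cases h2 : ZMod.finEquiv n l = ZMod.finEquiv n k + ZMod.finEquiv n a.1
    · rw [if_pos h1, if_pos h2, if_pos ⟨h1, h2⟩, ← AddChar.map_neg_eq_conj, ← AddChar.map_add_eq_mul]
      congr 1
      ring
    · rw [if_neg h2, if_neg (not_and_of_not_right _ h2), mul_zero]
  · rw [if_neg h1, if_neg (not_and_of_not_left _ h1), map_zero, zero_mul]

theorem clockShift_mul_star {n : ℕ} [NeZero n] (a : Fin n × Fin n) :
    clockShift a * star (clockShift a) = 1 := by
  ext m l
  rw [Matrix.mul_apply, Matrix.one_apply]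
  simp_rw [Matrix.star_apply, Complex.star_def, mul_comm (clockShift a m _), conj_clockShift_mul,
    sub_self, mul_zero, AddChar.map_zero_eq_one]
  rw [Finset.sum_eq_single ((ZMod.finEquiv n).symm (ZMod.finEquiv n m - ZMod.finEquiv n a.1))]
  · simp [eq_comm]
  · intro i _ hi
    refine if_neg fun h => hi ?_
    rw [h.2]
    simp
  · simp

/-- The shift exponent is determined by `m` and `i`, and the sum over the clock exponent is
orthogonality of characters, which forces `i = k`. -/
theorem sum_clockShift {n : ℕ} [NeZero n] (m i l k : Fin n) :
    ∑ a, conj (clockShift a m i) * clockShift a l k = if m = l ∧ i = k then (n : ℂ) else 0 := by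
  simp_rw [conj_clockShift_mul]
  rw [Fintype.sum_prod_type]
  have h : ∀ p : Fin n, (∑ q : Fin n, if ZMod.finEquiv n m = ZMod.finEquiv n i + ZMod.finEquiv n p ∧
        ZMod.finEquiv n l = ZMod.finEquiv n k + ZMod.finEquiv n p then
        ZMod.stdAddChar (ZMod.finEquiv n q * (ZMod.finEquiv n k - ZMod.finEquiv n i)) else 0) =
      if p = (ZMod.finEquiv n).symm (ZMod.finEquiv n m - ZMod.finEquiv n i) then
        if m = l ∧ i = k then (n : ℂ) else 0 else 0 := fun p => by
    have hp : p = (ZMod.finEquiv n).symm (ZMod.finEquiv n m - ZMod.finEquiv n i) ↔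
        ZMod.finEquiv n m = ZMod.finEquiv n i + ZMod.finEquiv n p := by
      rw [eq_comm, RingEquiv.symm_apply_eq, sub_eq_iff_eq_add, add_comm]
    have hs : ∑ q : Fin n, ZMod.stdAddChar (ZMod.finEquiv n q *
        (ZMod.finEquiv n k - ZMod.finEquiv n i)) = if i = k then (n : ℂ) else 0 := by
      refine ((ZMod.finEquiv n).toEquiv.sum_comp
        (fun q => ZMod.stdAddChar (q * (ZMod.finEquiv n k - ZMod.finEquiv n i)))).trans ?_
      rw [AddChar.sum_mulShift _ (ZMod.isPrimitive_stdAddChar n), ZMod.card]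
      simp [sub_eq_zero, eq_comm (a := i)]
    by_cases h1 : ZMod.finEquiv n m = ZMod.finEquiv n i + ZMod.finEquiv n p
    · by_cases h2 : ZMod.finEquiv n l = ZMod.finEquiv n k + ZMod.finEquiv n p
      · rw [if_pos (hp.2 h1)]
        simp only [h1, h2, and_self, if_true, hs]
        have : m = l ∧ i = k ↔ i = k := by
          refine ⟨And.right, fun h => ⟨?_, h⟩⟩
          apply (ZMod.finEquiv n).injective
          rw [h1, h2, h]
        simp only [this]
      · rw [if_pos (hp.2 h1), if_neg]
        · simp only [h2, and_false, if_false, Finset.sum_const_zero]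
        rintro ⟨rfl, rfl⟩
        exact h2 h1
    · simp only [h1, false_and, if_false, Finset.sum_const_zero, if_neg (mt hp.1 h1)]
  simp_rw [h]
  simp

theorem auxDim_ne_zero (d : ℕ) : auxDim d ≠ 0 := by simp [auxDim]

theorem le_auxDim (d : ℕ) : d ≤ auxDim d := Nat.le_pow_clog one_lt_two d

instance (d : ℕ) : NeZero (auxDim d) := ⟨auxDim_ne_zero d⟩

variable {N : ℕ}

theorem sum_update_univ {O : Fin N → Type} [∀ j, Fintype (O j)] {R : Fin N → Type*}
    [∀ j, Semiring (R j)] (f : ∀ j, O j → R j) (hf : ∀ j, ∑ o, f j o = 1) (j : Fin N) (o : O j) :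
    (fun k => ∑ a ∈ Function.update (fun _ => Finset.univ) j {o} k, f k a) =
      Function.update (fun _ => 1) j (f j o) := by
  funext k
  rcases eq_or_ne k j with rfl | h
  · simp
  · simp [h, hf]

/-- Equal correlations have equal marginals for each main party and its auxiliary party. -/
theorem expect_single_eq {ιA ιB : Fin N → Type u} {κA κB O : Fin N → Type}
    [∀ j, Fintype (O j)]
    (Ψ : Hil ((∀ j, ιA j) × (∀ j, ιB j))) (Φ : Hil ((∀ j, κA j) × (∀ j, κB j)))
    {A : ∀ j, O j → Hil (ιA j) →L[ℂ] Hil (ιA j)} {B : ∀ j, O j → Hil (ιB j) →L[ℂ] Hil (ιB j)}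
    {A' : ∀ j, O j → Hil (κA j) →L[ℂ] Hil (κA j)} {B' : ∀ j, O j → Hil (κB j) →L[ℂ] Hil (κB j)}
    (hA : ∀ j, ∑ o, A j o = 1) (hB : ∀ j, ∑ o, B j o = 1) (hA' : ∀ j, ∑ o, A' j o = 1)
    (hB' : ∀ j, ∑ o, B' j o = 1)
    (h : ∀ a b : ∀ j, O j, expect Ψ (fun j => A j (a j)) (fun j => B j (b j)) =
      expect Φ (fun j => A' j (a j)) (fun j => B' j (b j))) (j : Fin N) (a b : O j) :
    expect Ψ (Function.update (fun _ => 1) j (A j a)) (Function.update (fun _ => 1) j (B j b)) =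
      expect Φ (Function.update (fun _ => 1) j (A' j a))
        (Function.update (fun _ => 1) j (B' j b)) := by
  rw [← sum_update_univ A hA, ← sum_update_univ B hB, ← sum_update_univ A' hA',
    ← sum_update_univ B' hB', expect_sum, expect_sum]
  exact Finset.sum_congr rfl fun a _ => Finset.sum_congr rfl fun b _ => h a b

/-- The measurements of a main party: the teleportation measurement, and the transposes of the
measurements of a spectral frame. -/
def frameMeasurement {d n : ℕ} [NeZero n] {T : Type} [Fintype T] (emb : Fin d → Fin n)
    (F : SpectralFrame n T (Fin n × Fin n)) :
    Option (T × T) → Fin n × Fin n → Matrix (Fin d × Fin n) (Fin d × Fin n) ℂ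
  | none, o => bellOp emb (clockShift o)
  | some y, o => Matrix.kroneckerMap (· * ·) (1 : Matrix (Fin d) (Fin d) ℂ) (F.Q y o).transpose

theorem sum_frameMeasurement {d n : ℕ} [NeZero n] {T : Type} [Fintype T] {emb : Fin d → Fin n}
    (hemb : Function.Injective emb) (F : SpectralFrame n T (Fin n × Fin n)) (x : Option (T × T)) :
    ∑ o, frameMeasurement emb F x o = 1 := by
  rcases x with _ | y
  · exact sum_bellOp (NeZero.ne n) hemb sum_clockShift
  · rw [← Matrix.one_kronecker_one, ← Matrix.transpose_one (n := Fin n), ← F.sum_eq_one y,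
      Matrix.transpose_sum]
    ext a b
    simp [frameMeasurement, Matrix.sum_apply, Matrix.kroneckerMap_apply, Finset.mul_sum]

theorem exists_eq_star_mul_of_isStarProjection {R : Type*} [Semiring R] [StarRing R] {p : R}
    (hp : IsStarProjection p) : ∃ c, p = star c * c :=
  ⟨p, by rw [hp.isSelfAdjoint.star_eq, hp.isIdempotentElem.eq]⟩

theorem exists_frameMeasurement_eq {d n : ℕ} [NeZero n] {T : Type} [Fintype T]
    (emb : Fin d → Fin n) (F : SpectralFrame n T (Fin n × Fin n)) (x : Option (T × T))
    (o : Fin n × Fin n) : ∃ C, frameMeasurement emb F x o = star C * C := by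
  rcases x with _ | y
  · exact exists_bellOp_eq _ _
  · refine exists_eq_star_mul_of_isStarProjection (isStarProjection_kronecker ⟨?_, ?_⟩)
    · rw [IsIdempotentElem, ← Matrix.transpose_mul, (F.proj y o).isIdempotentElem.eq]
    · exact congrArg Matrix.transpose (F.proj y o).isSelfAdjoint.star_eq

/-! ### Rigidity of the reference correlations for a spectral frame. -/

section Rigidity

variable {d n : Fin N → ℕ} [∀ j, NeZero (n j)] {T : Fin N → Type} [∀ j, Fintype (T j)]
  (F : ∀ j, SpectralFrame (n j) (T j) (Fin (n j) × Fin (n j))) {emb : ∀ j, Fin (d j) → Fin (n j)}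
  {ψ : (∀ j, Fin (d j)) → ℂ} {ιA ιB : Fin N → Type u} {Ψ : Hil ((∀ j, ιA j) × (∀ j, ιB j))}
  {A : ∀ j, Option (T j × T j) → Fin (n j) × Fin (n j) → Hil (ιA j) →L[ℂ] Hil (ιA j)}
  {B : ∀ j, T j × T j → Fin (n j) × Fin (n j) → Hil (ιB j) →L[ℂ] Hil (ιB j)}

/-- All parties but the `j`-th pair receive arbitrary inputs given by `t`, and their outcomes are
summed out. In the reference, the transpose in the measurement cancels the one from the maximally
entangled state. -/
theorem inner_single_single_of_frame (hψ : IsUnitVector ψ)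
    (hemb : ∀ j, Function.Injective (emb j)) (hA1 : ∀ j x, ∑ o, A j x o = 1)
    (hB1 : ∀ j y, ∑ o, B j y o = 1)
    (hcorr : ∀ (x : ∀ j, Option (T j × T j)) (y : ∀ j, T j × T j)
      (a b : ∀ j, Fin (n j) × Fin (n j)),
      expect Ψ (fun j => A j (x j) (a j)) (fun j => B j (y j) (b j)) =
        expect (netState n ψ) (fun j => matOp (frameMeasurement (emb j) (F j) (x j) (a j)))
          (fun j => matOp ((F j).Q (y j) (b j)))) (t : ∀ j, T j)
    (j : Fin N) (y y' : T j × T j) (o o' : Fin (n j) × Fin (n j)) :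
    inner ℂ (jointVec Ψ) ((mainRep ιA ιB).single j (A j (some y) o)
        ((auxRep ιA ιB).single j (B j y' o') (jointVec Ψ))) =
      (n j : ℂ)⁻¹ * ((F j).Q y o * (F j).Q y' o').trace := by
  have h := expect_single_eq Ψ (netVec n ψ)
    (A := fun k => A k (some (Function.update (fun k => (t k, t k)) j y k)))
    (B := fun k => B k (Function.update (fun k => (t k, t k)) j y' k))
    (A' := fun k o => matOp (frameMeasurement (emb k) (F k)
      (some (Function.update (fun k => (t k, t k)) j y k)) o))
    (B' := fun k o => matOp ((F k).Q (Function.update (fun k => (t k, t k)) j y' k) o))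
    (fun k => hA1 k _) (fun k => hB1 k _)
    (fun k => by rw [← map_sum, sum_frameMeasurement (hemb k), map_one])
    (fun k => by rw [← map_sum, (F k).sum_eq_one, map_one])
    (fun a b => by
      rw [coe_netVec]
      exact hcorr _ _ a b) j o o'
  simp only [Function.update_self] at h
  rw [coe_netVec] at h
  have h' := h.trans (expect_netState_single (fun k => NeZero.ne (n k)) hψ j
    (reduced_kronecker ((F j).Q y o).transpose ((F j).Q y' o')))
  rw [expect_eq, Matrix.transpose_transpose] at h'
  exact h'

/-- The inputs `some y` certify the Jordan homomorphism through the correlations within each pair,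
and the input `none` of all main parties supplies the tomography of the teleported state. -/
theorem extractsHeralded_of_frame [∀ j, Nonempty (T j)] (hΨ : ‖Ψ‖ = 1) (hψ : IsUnitVector ψ)
    (hemb : ∀ j, Function.Injective (emb j)) (hA : ∀ j x o, IsStarProjection (A j x o))
    (hB : ∀ j y o, IsStarProjection (B j y o)) (hA1 : ∀ j x, ∑ o, A j x o = 1)
    (hB1 : ∀ j y, ∑ o, B j y o = 1)
    (hcorr : ∀ (x : ∀ j, Option (T j × T j)) (y : ∀ j, T j × T j)
      (a b : ∀ j, Fin (n j) × Fin (n j)),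
      expect Ψ (fun j => A j (x j) (a j)) (fun j => B j (y j) (b j)) =
        expect (netState n ψ) (fun j => matOp (frameMeasurement (emb j) (F j) (x j) (a j)))
          (fun j => matOp ((F j).Q (y j) (b j)))) :
    ExtractsHeralded Ψ ψ := by
  have hsingle := inner_single_single_of_frame F hψ hemb hA1 hB1 hcorr
    fun j => Classical.arbitrary _
  choose P hP using exists_isSupport (ιB := ιB) (jointVec Ψ)
  have hπ := fun j => LocalRep.exists_jordan_of_frame (L := mainRep ιA ιB) (M := auxRep ιA ιB)
    (Ψ := jointVec Ψ) (F j) (j := j) (A := fun y => A j (some y)) (B := B j)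
    mainRep_commute_auxRep (hP j) (fun y o => hA j _ o) (fun y => hA1 j _)
    (fun y o o' h => mul_eq_zero_of_sum_eq_one (hA j _) (hA1 j _) h) (hB j) (hB1 j)
    fun y y' o o' => hsingle j y y' o o'
  choose π h1 hmir hj hs using hπ
  refine extractsHeralded_of_jordan Ψ hΨ hψ (fun j => NeZero.ne (n j))
    emb hemb (fun j a => A j none a) (fun j a => hA j _ a) (fun j => hA1 j _)
    (fun j => clockShift) (fun j => clockShift_mul_star) π (fun j => (h1 j).symm ▸ (hP j).proj)
    hj hs (fun j (q : (T j × T j) × (Fin (n j) × Fin (n j))) => (F j).Q q.1 q.2)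
    (fun j => (F j).span_Q) (fun j q => B j q.1 q.2) (fun j q => hmir j q.1 q.2) fun a q => ?_
  refine (hcorr (fun _ => none) (fun j => (q j).1) a (fun j => (q j).2)).trans ?_
  rw [expect_netState, tensorExpect_apply, Finset.mul_sum]
  refine Finset.sum_congr rfl fun i _ => ?_
  rw [Finset.mul_sum]
  refine Finset.sum_congr rfl fun k _ => ?_
  have h : ∀ j, reduced (frameMeasurement (emb j) (F j) none (a j)) ((F j).Q (q j).1 (q j).2)
      (i j) (k j) = (Fintype.card (Fin (n j) × Fin (n j)) : ℂ)⁻¹ *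
        (star (clockShift (a j)) * (F j).Q (q j).1 (q j).2 *
          clockShift (a j)) (emb j (i j)) (emb j (k j)) := fun j => by
    refine (congrFun (congrFun (reduced_bellOp (emb j) (clockShift (a j)) _) (i j)) (k j)).trans ?_
    rw [Matrix.smul_apply, Matrix.submatrix_apply, smul_eq_mul, ← mul_inv, Fintype.card_prod,
      Fintype.card_fin, Nat.cast_mul]
  simp_rw [h]
  rw [Finset.prod_mul_distrib]
  ring

end Rigidity

/-- Some correlations, produced in the network where the main parties share `ψ`, self-test `ψ` up
to heralded conjugations. -/
theorem networkSelfTestableFromItself {d : Fin N → ℕ} {ψ : (∀ j, Fin (d j)) → ℂ}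
    (hψ : IsUnitVector ψ) : NetworkSelfTestableFromItself.{u} ψ := by
  let T : Fin N → Type := fun j => Fin (auxDim (d j)) × Fin (auxDim (d j)) × Fin 2
  let O : Fin N → Type := fun j => Fin (auxDim (d j)) × Fin (auxDim (d j))
  have F : ∀ j, SpectralFrame (auxDim (d j)) (T j) (O j) := fun j =>
    (nonempty_spectralFrame (auxDim (d j))).some
  have hemb : ∀ j, Function.Injective (Fin.castLE (le_auxDim (d j))) := fun j =>
    Fin.castLE_injective _
  have hA : ∀ j x o, ∃ C : Matrix (Fin (d j) × Fin (auxDim (d j))) _ ℂ,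
      frameMeasurement (Fin.castLE (le_auxDim (d j))) (F j) x o = star C * C := fun j =>
    exists_frameMeasurement_eq _ (F j)
  have hB : ∀ j y o, ∃ C : Matrix (Fin (auxDim (d j))) _ ℂ, (F j).Q y o = star C * C := fun j y o =>
    exists_eq_star_mul_of_isStarProjection ((F j).proj y o)
  obtain ⟨m, r, E, hE⟩ := exists_networkExperiment hψ (fun j => Option (T j × T j))
    (fun j => T j × T j) O
    (fun j => frameMeasurement (Fin.castLE (le_auxDim (d j))) (F j)) (fun j => (F j).Q) hA hB
    (fun j => sum_frameMeasurement (hemb j) (F j)) (fun j => (F j).sum_eq_one)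
  refine ⟨m, r, E, fun ιA ιB R hR hRE => ?_⟩
  obtain ⟨A, B, hA, hB, hA1, hB1, hcorr⟩ := hE ιA ιB R hR hRE
  exact extractsHeralded_of_frame F R.norm_state hψ hemb hA hB hA1 hB1 hcorr

end Reference

/-! ### The superposition of a state and its conjugate -/

section Doubling

variable {P : Type} {d : P → ℕ}

/-- Splits the indices of doubled systems into indices and flags. -/
def doubleEquiv (d : P → ℕ) : (∀ p, Fin (2 * d p)) ≃ (∀ p, Fin (d p)) × (P → Fin 2) where
  toFun i := (fun p => (finProdFinEquiv.symm (i p)).2, fun p => (finProdFinEquiv.symm (i p)).1)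
  invFun z p := finProdFinEquiv (z.2 p, z.1 p)
  left_inv i := by
    funext p
    exact finProdFinEquiv.apply_symm_apply (i p)
  right_inv z := by
    refine Prod.ext ?_ ?_ <;> funext p <;> simp

/-- The vector `(ψ ⊗ |0 … 0⟩ + ψ* ⊗ |1 … 1⟩) / √2`. -/
def double [Fintype P] (ψ : (∀ p, Fin (d p)) → ℂ) : (∀ p, Fin (2 * d p)) → ℂ :=
  fun i => superposed ψ (1 / 2) (doubleEquiv d i).1 (doubleEquiv d i).2

theorem double_symm [Fintype P] (ψ : (∀ p, Fin (d p)) → ℂ) (z : (∀ p, Fin (d p)) × (P → Fin 2)) :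
    double ψ ((doubleEquiv d).symm z) = superposed ψ (1 / 2) z.1 z.2 := by
  rw [double, Equiv.apply_symm_apply]

theorem superposed_half [Fintype P] (ψ : (∀ p, Fin (d p)) → ℂ) (i : ∀ p, Fin (d p)) (f : P → Fin 2) :
    superposed ψ (1 / 2) i f =
      (√(1 / 2) : ℂ) * (heralded ψ 0 i f + heralded (conjVec ψ) 1 i f) := by
  rw [superposed, mul_add]
  norm_num

theorem norm_sqrt_half_sq : ‖(√(1 / 2) : ℂ)‖ ^ 2 = 1 / 2 := by
  rw [Complex.norm_real, Real.norm_eq_abs, sq_abs, Real.sq_sqrt (by norm_num)]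

theorem heralded_eq_ite [Fintype P] (ψ : (∀ p, Fin (d p)) → ℂ) (c : Fin 2) (i : ∀ p, Fin (d p))
    (f : P → Fin 2) : heralded ψ c i f = if f = (fun _ => c) then ψ i else 0 := by
  simp only [heralded, funext_iff]

theorem const_zero_ne_const_one [Nonempty P] : (fun _ : P => (0 : Fin 2)) ≠ fun _ => 1 := fun h =>
  zero_ne_one (congrFun h (Classical.arbitrary P))

theorem isUnitVector_double [Fintype P] [DecidableEq P] [Nonempty P] {ψ : (∀ p, Fin (d p)) → ℂ} (hψ : IsUnitVector ψ) :
    IsUnitVector (double ψ) := by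
  have hne := const_zero_ne_const_one (P := P)
  rw [IsUnitVector, ← (doubleEquiv d).symm.sum_comp, Fintype.sum_prod_type]
  have h : ∀ i, ∑ f, ‖double ψ ((doubleEquiv d).symm (i, f))‖ ^ 2 = ‖ψ i‖ ^ 2 := fun i => by
    have h1 : ∀ f : P → Fin 2, ‖double ψ ((doubleEquiv d).symm (i, f))‖ ^ 2 =
        (if f = (fun _ => 0) then ‖ψ i‖ ^ 2 / 2 else 0) +
          (if f = (fun _ => 1) then ‖ψ i‖ ^ 2 / 2 else 0) := fun f => by
      rw [double_symm, superposed_half, norm_mul, mul_pow, norm_sqrt_half_sq, heralded_eq_ite,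
        heralded_eq_ite, conjVec]
      by_cases h0 : f = fun _ => 0
      · subst h0
        simp only [hne, if_true, if_false, add_zero]
        ring
      · by_cases h1 : f = fun _ => 1
        · subst h1
          simp only [hne.symm, if_true, if_false, zero_add, Complex.norm_conj]
          ring
        · simp [h0, h1]
    simp_rw [h1]
    rw [Finset.sum_add_distrib]
    simp only [Finset.sum_ite_eq', Finset.mem_univ, if_true]
    ring
  simp_rw [h]
  exact hψ

/-- A product that is nonzero for all flags `0` and for all flags `1` would be nonzero for flags `0`
on `T` and `1` elsewhere, where the doubled vector vanishes. -/
theorem isGME_double [Fintype P] [DecidableEq P] {ψ : (∀ p, Fin (d p)) → ℂ}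
    (hψ : IsUnitVector ψ) : IsGME (double ψ) := by
  classical
  rintro T ⟨p, hp⟩ ⟨q, hq⟩ ⟨u, v, h⟩
  obtain ⟨l, hl⟩ : ∃ l, ψ l ≠ 0 := by
    by_contra! h
    simp [IsUnitVector, h] at hψ
  have : Nonempty P := ⟨p⟩
  have hne := const_zero_ne_const_one (P := P)
  have hs : (√(1 / 2) : ℂ) ≠ 0 := fun h => by
    have := norm_sqrt_half_sq
    rw [h] at this
    norm_num at this
  have hc : ∀ c : Fin 2, double ψ ((doubleEquiv d).symm (l, fun _ => c)) ≠ 0 := fun c => by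
    rw [double_symm, superposed_half, heralded_eq_ite, heralded_eq_ite, conjVec]
    refine mul_ne_zero hs ?_
    fin_cases c
    · simpa [hne] using hl
    · simpa [hne.symm] using hl
  have h0 := hc 0
  have h1 := hc 1
  rw [h] at h0 h1
  set g : P → Fin 2 := fun r => if r ∈ T then 0 else 1 with hg
  have hz : double ψ ((doubleEquiv d).symm (l, g)) = 0 := by
    rw [double_symm, superposed_half, heralded_eq_ite, heralded_eq_ite, if_neg, if_neg, add_zero,
      mul_zero]
    · intro h'
      have := congrFun h' p
      simp [hg, hp] at this
    · intro h'
      have := congrFun h' q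
      simp [hg, show q ∉ T from hq] at this
  rw [h] at hz
  have eu : (fun r : {r // r ∈ T} => (doubleEquiv d).symm (l, g) r) =
      fun r : {r // r ∈ T} => (doubleEquiv d).symm (l, fun _ => 0) r := by
    funext r
    simp [doubleEquiv, hg, r.2]
  have ev : (fun r : {r // r ∉ T} => (doubleEquiv d).symm (l, g) r) =
      fun r : {r // r ∉ T} => (doubleEquiv d).symm (l, fun _ => 1) r := by
    funext r
    simp [doubleEquiv, hg, r.2]
  rw [eu, ev] at hz
  exact (mul_ne_zero (left_ne_zero_of_mul h0) (right_ne_zero_of_mul h1)) hz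

theorem heralded_conj_flip [Fintype P] (ψ : (∀ p, Fin (d p)) → ℂ) (c : Fin 2) (i : ∀ p, Fin (d p))
    (f : P → Fin 2) :
    conj (heralded ψ c i (fun p => f p + 1)) = heralded (conjVec ψ) (c + 1) i f := by
  have h : (∀ p, f p + 1 = c) ↔ ∀ p, f p = c + 1 := forall_congr' fun p => by
    generalize f p = x
    revert x c
    decide
  unfold heralded
  by_cases hc : ∀ p, f p + 1 = c
  · rw [if_pos hc, if_pos (h.1 hc), conjVec]
  · rw [if_neg hc, if_neg (mt h.2 hc), map_zero]

/-- Conjugation and the flip of the flags both exchange the two branches, whose weights are equal.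
-/
theorem conj_superposed_flip [Fintype P] (ψ : (∀ p, Fin (d p)) → ℂ) (i : ∀ p, Fin (d p)) (f : P → Fin 2) :
    conj (superposed ψ (1 / 2) i (fun p => f p + 1)) = superposed ψ (1 / 2) i f := by
  rw [superposed_half, superposed_half, map_mul, map_add, Complex.conj_ofReal, heralded_conj_flip,
    heralded_conj_flip]
  have h : conjVec (conjVec ψ) = ψ := by
    funext i
    simp [conjVec]
  rw [h, zero_add, show (1 + 1 : Fin 2) = 0 from rfl, add_comm (heralded ψ 0 i f)]

end Doubling

/-! ### Undoing the conjugation by means of the heralding flag. -/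

section Superposition

variable {N : ℕ} {d : Fin N → ℕ} {ιA ιB : Fin N → Type u}

/-- Moves the flag of a doubled system into the flag register. -/
def flagEquiv (d : ℕ) (κ : Type*) :
    Fin d × Fin 2 × (Fin 2 × κ) ≃ Fin (2 * d) × Fin 2 × κ where
  toFun y := (finProdFinEquiv (y.2.1 + y.2.2.1, y.1), y.2.2.1, y.2.2.2)
  invFun z := ((finProdFinEquiv.symm z.1).2, (finProdFinEquiv.symm z.1).1 - z.2.1, (z.2.1, z.2.2))
  left_inv y := by simp
  right_inv z := by
    simp only [sub_add_cancel]
    exact Prod.ext (finProdFinEquiv.apply_symm_apply z.1) rfl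

/-- A permutation of the computational basis. -/
def reindexIsometry {I J : Type*} (e : I ≃ J) : Hil J →ₗᵢ[ℂ] Hil I where
  toFun v := hilMk (fun i => v (e i)) (e.summable_iff.2 (hil_summable v))
  map_add' v w := by
    ext i
    simp
  map_smul' c v := by
    ext i
    simp
  norm_map' v := by
    rw [← sq_eq_sq₀ (norm_nonneg _) (norm_nonneg _)]
    change ‖hilMk (fun i => v (e i)) (e.summable_iff.2 (hil_summable v))‖ ^ 2 = _
    rw [norm_hilMk_sq, ← (hil_hasSum_norm_sq v).tsum_eq]
    exact e.tsum_eq fun y => ‖v y‖ ^ 2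

/-- Separates flags from discarded registers. -/
def discardEquiv (κ : Fin N → Type*) (B : Type*) :
    (∀ j, Fin 2 × κ j) × B ≃ (Fin N → Fin 2) × ((∀ j, κ j) × B) where
  toFun y := (fun j => (y.1 j).1, (fun j => (y.1 j).2, y.2))
  invFun z := (fun j => (z.1 j, z.2.1 j), z.2.2)
  left_inv _ := rfl
  right_inv _ := rfl

/-- The heralding flags join the discarded registers. The two branches have different flag patterns,
so their weights add to one; this needs at least one party. -/
theorem exists_flagged [NeZero N] {κ : Fin N → Type*} {B X : Type*} (f : (∀ j, κ j) × B ≃ X)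
    {ζ₀ ζ₁ : Hil X} (h₀ : ‖ζ₀‖ = 1) (h₁ : ‖ζ₁‖ = 1) {α : ℝ} (hα : α ∈ Set.Icc (0 : ℝ) 1) :
    ∃ ζ : Hil ((∀ j, Fin 2 × κ j) × B), ‖ζ‖ = 1 ∧ ∀ y,
      ζ y = (if ∀ j, (y.1 j).1 = 0 then (√α : ℂ) * ζ₀ (f (fun j => (y.1 j).2, y.2)) else 0) +
        if ∀ j, (y.1 j).1 = 1 then (√(1 - α) : ℂ) * ζ₁ (f (fun j => (y.1 j).2, y.2)) else 0 := by
  have : Nonempty (Fin N) := ⟨0⟩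
  have hne := const_zero_ne_const_one (P := Fin N)
  let V : (Fin N → Fin 2) → Hil X := fun g =>
    (if g = (fun _ => 0) then (√α : ℂ) • ζ₀ else 0) +
      if g = (fun _ => 1) then (√(1 - α) : ℂ) • ζ₁ else 0
  have hV : ∀ g, ‖V g‖ ^ 2 = (if g = (fun _ => 0) then α else 0) +
      if g = (fun _ => 1) then 1 - α else 0 := fun g => by
    by_cases h0 : g = fun _ => 0
    · subst h0
      simp only [V, hne, if_true, if_false, add_zero]
      rw [norm_smul, h₀, mul_one, Complex.norm_real, Real.norm_eq_abs, sq_abs, Real.sq_sqrt hα.1]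
    · by_cases h1 : g = fun _ => 1
      · subst h1
        simp only [V, hne.symm, if_true, if_false, zero_add]
        rw [norm_smul, h₁, mul_one, Complex.norm_real, Real.norm_eq_abs, sq_abs,
          Real.sq_sqrt (sub_nonneg.2 hα.2)]
      · simp [V, h0, h1]
  have hsum : HasSum (fun g => ‖V g‖ ^ 2) 1 := by
    have : ∑ g, ‖V g‖ ^ 2 = 1 := by
      simp_rw [hV]
      rw [Finset.sum_add_distrib]
      simp
    exact this ▸ hasSum_fintype _
  have hs := hasSum_norm_records (discardEquiv κ B) f V hsum
  refine ⟨hilMk _ hs.summable, ?_, fun y => ?_⟩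
  · rw [← sq_eq_sq₀ (norm_nonneg _) zero_le_one, norm_hilMk_sq, hs.tsum_eq, one_pow]
  · rw [hilMk_apply]
    change V (fun j => (y.1 j).1) (f (fun j => (y.1 j).2, y.2)) = _
    simp only [V, funext_iff]
    rw [lp.coeFn_add, Pi.add_apply]
    congr 1
    · split_ifs
      · rfl
      · rfl
    · split_ifs
      · rfl
      · rfl

/-- The heralded branches of the doubled state differ by a flip of all internal flags. Each party
adds its heralding flag to its internal one, which makes both branches equal, and then discards the
heralding flag. The extracted weight is always `1 / 2`; the unknown weight `α` goes into the
discarded state. -/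
theorem extractsSuperposition_of_double [NeZero N] {ψ : (∀ j, Fin (d j)) → ℂ}
    (hψ : IsUnitVector ψ) {Ψ : (∀ j, ιA j) × (∀ j, ιB j) → ℂ}
    (h : ExtractsHeralded Ψ (double ψ)) : ExtractsSuperposition Ψ ψ := by
  obtain ⟨κ, W, hW, hS⟩ := h
  let res : (∀ p : {j // j ∈ (Finset.univ : Finset (Fin N))}, Fin (d p)) ≃ ∀ j, Fin (d j) :=
    { toFun := fun i j => i ⟨j, Finset.mem_univ j⟩
      invFun := fun i p => i p
      left_inv := fun _ => rfl
      right_inv := fun _ => rfl }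
  set ψ' : (∀ p : {j // j ∈ (Finset.univ : Finset (Fin N))}, Fin (d p)) → ℂ := fun i => ψ (res i)
    with hψ'
  have hu : IsUnitVector ψ' := (res.sum_comp fun i => ‖ψ i‖ ^ 2).trans hψ
  have : Nonempty {j // j ∈ (Finset.univ : Finset (Fin N))} := ⟨⟨0, Finset.mem_univ 0⟩⟩
  have hdouble : ∀ i : ∀ j, Fin (2 * d j), double ψ i =
      double (P := {j // j ∈ (Finset.univ : Finset (Fin N))}) (d := fun p => d p) ψ'
        (fun p => i p) := fun i => by
    have h : ∀ c : Fin 2, (∀ p : {j // j ∈ (Finset.univ : Finset (Fin N))},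
        (doubleEquiv d i).2 p = c) ↔ ∀ p, (doubleEquiv d i).2 p = c := fun c => by
      simp only [Subtype.forall, Finset.mem_univ, forall_true_left]
    simp only [double, superposed, heralded]
    refine congrArg₂ (· + ·) (congrArg _ ?_) (congrArg _ ?_)
    · by_cases hc : ∀ p, (doubleEquiv d i).2 p = 0
      · exact (if_pos hc).trans (if_pos ((h 0).2 hc)).symm
      · exact (if_neg hc).trans (if_neg (mt (h 0).1 hc)).symm
    · by_cases hc : ∀ p, (doubleEquiv d i).2 p = 1
      · exact (if_pos hc).trans (if_pos ((h 1).2 hc)).symm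
      · exact (if_neg hc).trans (if_neg (mt (h 1).1 hc)).symm
  obtain ⟨α, hα, ζ₀, ζ₁, h₀, h₁, hy⟩ := hS Finset.univ _
    ⟨isUnitVector_double hu, isGME_double hu, fun _ => 1, fun i => by rw [mul_one, hdouble]⟩
  have : IsEmpty {j // j ∉ (Finset.univ : Finset (Fin N))} := ⟨fun p => p.2 (Finset.mem_univ _)⟩
  obtain ⟨ζ, hζ, hζy⟩ := exists_flagged (B := ∀ j, ιB j)
    (Equiv.uniqueProd ((∀ j, κ j) × (∀ j, ιB j))
      (∀ p : {j // j ∉ (Finset.univ : Finset (Fin N))}, Fin (2 * d p) × Fin 2)).symm h₀ h₁ hα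
  refine ⟨fun j => Fin 2 × κ j, fun j =>
    (reindexIsometry (flagEquiv (d j) (κ j))).toContinuousLinearMap ∘L W j, fun j v => ?_, 1 / 2,
    ⟨by norm_num, by norm_num⟩, ζ, hζ, fun y => ?_⟩
  · exact ((reindexIsometry (flagEquiv (d j) (κ j))).norm_map _).trans (hW j v)
  · have h1 := hy (fun j => flagEquiv (d j) (κ j) (y.1 j), y.2)
    -- The additional isometry permutes the basis, so the entries of the composite are those of `W`
    -- at the relabelled index.
    refine Eq.trans (b := localApply W (fun _ => 1) Ψ
      (fun j => flagEquiv (d j) (κ j) (y.1 j), y.2)) rfl (h1.trans ?_)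
    rw [hζy]
    have hflag : ∀ c : Fin 2, (∀ p : {j // j ∈ (Finset.univ : Finset (Fin N))},
        (y.1 p).2.2.1 = c) ↔ ∀ j, (y.1 j).2.2.1 = c := fun c => by
      simp only [Subtype.forall, Finset.mem_univ, forall_true_left]
    simp only [heralded, conjVec, flagEquiv, Equiv.coe_fn_mk, hflag]
    have hd' := hdouble fun j => finProdFinEquiv ((y.1 j).2.1 + (y.1 j).2.2.1, (y.1 j).1)
    simp only [← hd']
    have hd : ∀ g : Fin N → Fin 2,
        double ψ (fun j => finProdFinEquiv ((y.1 j).2.1 + g j, (y.1 j).1)) =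
          superposed ψ (1 / 2) (fun j => (y.1 j).1) (fun j => (y.1 j).2.1 + g j) := fun g =>
      double_symm ψ (fun j => (y.1 j).1, fun j => (y.1 j).2.1 + g j)
    rw [mul_add]
    congr 1
    · by_cases h0 : ∀ j, (y.1 j).2.2.1 = 0
      · rw [if_pos h0, if_pos h0]
        simp only [h0, add_zero]
        have := hd fun _ => 0
        simp only [add_zero] at this
        rw [this, mul_right_comm, mul_comm (superposed _ _ _ _)]
        refine congrArg (fun z => (√α : ℂ) * z * _) (congrArg ζ₀ (Prod.ext ?_ rfl))
        exact Subsingleton.elim _ _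
      · rw [if_neg h0, if_neg h0]
        simp
    · by_cases h1 : ∀ j, (y.1 j).2.2.1 = 1
      · rw [if_pos h1, if_pos h1]
        simp only [h1]
        have := hd fun _ => 1
        rw [this, conj_superposed_flip, mul_right_comm, mul_comm (superposed _ _ _ _)]
        refine congrArg (fun z => (√(1 - α) : ℂ) * z * _) (congrArg ζ₁ (Prod.ext ?_ rfl))
        exact Subsingleton.elim _ _
      · rw [if_neg h1, if_neg h1]
        simp

/-- Without parties `ψ` is a phase, which the discarded state compensates. Both flag conditions hold
vacuously, so `α = 1` is chosen to remove the second branch. -/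
theorem extractsSuperposition_of_isEmpty [IsEmpty (Fin N)] {ψ : (∀ j, Fin (d j)) → ℂ}
    (hψ : IsUnitVector ψ) {Ψ : Hil ((∀ j, ιA j) × (∀ j, ιB j))} (hΨ : ‖Ψ‖ = 1) :
    ExtractsSuperposition Ψ ψ := by
  have hψ1 : ‖ψ default‖ ^ 2 = 1 := by
    rw [IsUnitVector, Fintype.sum_unique] at hψ
    exact hψ
  have hψ2 : ψ default * conj (ψ default) = 1 := by
    rw [Complex.mul_conj']
    exact_mod_cast hψ1
  refine ⟨ιA, fun j => isEmptyElim j, fun j => isEmptyElim j, 1, ⟨zero_le_one, le_rfl⟩,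
    conj (ψ default) • Ψ, ?_, fun y => ?_⟩
  · rw [norm_smul, hΨ, mul_one, Complex.norm_conj]
    exact (pow_eq_one_iff_of_nonneg (norm_nonneg _) two_ne_zero).1 hψ1
  · rw [localApply, tsum_eq_single default]
    · simp only [superposed, heralded, IsEmpty.forall_iff, if_true, sub_self, Real.sqrt_zero,
        Real.sqrt_one, Complex.ofReal_one, Complex.ofReal_zero, zero_mul, add_zero, one_mul,
        Finset.univ_eq_empty, Finset.prod_empty, lp.coeFn_smul, Pi.smul_apply, smul_eq_mul]
      rw [← mul_assoc, Subsingleton.elim (fun j => (y.1 j).1) (default : ∀ j, Fin (d j)), hψ2,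
        one_mul]
      exact congrArg Ψ (Subsingleton.elim _ _)
    · exact fun x hx => absurd (Subsingleton.elim _ _) hx

theorem networkSelfTestable {ψ : (∀ j, Fin (d j)) → ℂ} (hψ : IsUnitVector ψ) :
    NetworkSelfTestable.{u} ψ := by
  -- Without parties the two branches of `double ψ` are not orthogonal and it need not be a unit
  -- vector, so `N = 0` is treated apart.
  rcases Nat.eq_zero_or_pos N with rfl | hN
  · obtain ⟨m, r, E, -⟩ := networkSelfTestableFromItself.{u} hψ
    exact ⟨d, ψ, m, r, E, fun ιA ιB R _ _ => extractsSuperposition_of_isEmpty hψ R.norm_state⟩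
  · have : NeZero N := ⟨hN.ne'⟩
    have : Nonempty (Fin N) := ⟨0⟩
    obtain ⟨m, r, E, hE⟩ := networkSelfTestableFromItself.{u} (isUnitVector_double hψ)
    exact ⟨_, double ψ, m, r, E, fun ιA ιB R hR hRE =>
      extractsSuperposition_of_double hψ (hE ιA ιB R hR hRE)⟩

end Superposition

end

theorem theorem1 (N : ℕ) :
    (∀ (d : Fin N → ℕ) (ψ : (∀ j, Fin (d j)) → ℂ), IsUnitVector ψ →
      NetworkSelfTestable.{u} ψ ∧ NetworkSelfTestableFromItself.{u} ψ) ∧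
    (∀ ψ : (Fin N → Fin 2) → ℂ, IsUnitVector ψ →
      (∃ E : QubitExperiment (fun _ : Fin N => Fin 2 × Fin 2) (fun _ : Fin N => Fin 2),
        E.IsProjective ∧ (∀ x, E.state x = netState (fun _ => 2) ψ x) ∧ E.IsReference ψ) ∧
      ∀ (ιA ιB : Fin N → Type u) (R : QubitExperiment ιA ιB),
        R.IsProjective → R.IsReference ψ → ExtractsHeralded R.state ψ) := by
  exact ⟨fun d ψ hψ => ⟨networkSelfTestable hψ, networkSelfTestableFromItself hψ⟩,
    fun ψ hψ => ⟨⟨qubitReference hψ,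
      ⟨fun j x a => isStarProjection_matOp (isStarProjection_referenceMain x a), fun j y b =>
        isStarProjection_matOp (isStarProjection_reflProj (star_pauli y) (pauli_mul_self y) b)⟩,
      netVec_apply ψ, isReference_qubitReference hψ⟩,
      fun ιA ιB R hR hRef => extractsHeralded_of_isReference hψ R hR hRef⟩⟩
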